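/- **Setting.** Let $\gamma\in(0,1)$, $\nu\in(0,1)$, $T>0$. Let $b:[-\pi/2,\pi/2]\setminus\{0\}\to\mathbb R_+$ be even, smooth on $(0,\pi/2]$, with $c\,\theta^{-1-\nu}\le b(\theta)\le C\theta^{-1-\nu}$ on $(0,\pi/2]$ for some $0<c<C$, and, for every $k\ge1$, $|b^{(k)}(\theta)|\le C_k\theta^{-1-\nu-k}$ on $(0,\pi/2]$ for some $C_k$. Put $A(\theta)=\frac12(R_\theta-I)$, where $R_\theta$ is the rotation of $\mathbb R^2$ of angle $\theta$. Let $\delta>\gamma$, $\eta_0\in(1/\delta,\,1/\max(\gamma,\nu))$, and let $f_0$ be a probability measure on $\mathbb R^2$ which is not a Dirac mass. Let $(f_t)_{t\in[0,T]}$ be a weak solution, starting from $f_0$, of the homogeneous Boltzmann equation with cross section $|v-v_*|^\gamma b(\theta)$: a family of probability measures on $\mathbb R^2$ such that $\int v f_t(dv)=\int vf_0(dv)$ and $\int|v|^2f_t(dv)=\int|v|^2f_0(dv)<\infty$ for all $t\in[0,T]$ and, for all globally Lipschitz $\psi:\mathbb R^2\to\mathbb R$ and all $t\in[0,T]$, $$\frac{d}{dt}\int\psi\,df_t=\int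 f_t(dv)\int f_t(dv_*)\int_{-\pi/2}^{\pi/2}b(\theta)|v-v_*|^\gamma\big[\psi(v+A(\theta)(v-v_*))-\psi(v)\big]d\theta .$$ Assume that $\sup_{[0,T]}\int e^{|v|^\delta}f_t(dv)<\infty$. Let $(t,\rho)\mapsto v_t(\rho)\in\mathbb R^2$ be measurable and such that, for every $t\in[0,T]$, $f_t$ is the law of $v_t$ under the Lebesgue measure on $[0,1]$. **The regularized process.** Let $\chi$ be a $C^\infty$ even nonnegative function and $\chi_1$ a $C^\infty$ $[0,1]$-valued function, both on $\mathbb R$, supported by $(-1,1)$ and with integral $1$. Let $\zeta\in(0,1)$, and let $\epsilon\in(0,1)$ be such that $3\epsilon<1<\Gamma_\epsilon-1$, where $$\Gamma_\epsilon=[\log(1/\epsilon)]^{\eta_0},\qquad \phi_\epsilon(x)=\int_{\mathbb R}\big((y\vee2\epsilon)\wedge\Gamma_\epsilon\big)\,\frac{\chi((x-y)/\epsilon)}{\epsilon}\,dy .$$ Put $G(x)=\int_x^{\pi/2}b(\theta)d\theta$ on $(0,\pi/2)$, let $\vartheta:(0,\infty)\to(0,\pi/2)$ be the inverse of $G$,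 extended by $\vartheta(z)=-\vartheta(-z)$ for $z<0$. Let $\mathbf I_\zeta:\mathbb R\to[0,1]$ be $C^\infty$ and even, with $\mathbf I_\zeta(z)=1$ for $|z|\le G(\zeta)$ and $\mathbf I_\zeta(z)=0$ for $|z|\ge G(\zeta)+1$. Let $U_\zeta:\mathbb R\to[0,1]$ be $C^\infty$, with $U_\zeta(z)=1$ for $|z|\in(1,G(\zeta)-1)$ and $U_\zeta(z)=0$ for $|z|\le1/2$ and for $|z|\ge G(\zeta)-1/2$. Put $\lambda_{\epsilon,\zeta}=4(G(\zeta)+1)\Gamma_\epsilon^\gamma$ and $$q_{\epsilon,\zeta}(t,w,\rho,z)=\Big(1-\frac1{2\Gamma_\epsilon^\gamma}\int_0^1\phi_\epsilon^\gamma(|w-v_t(\rho')|)d\rho'\Big)\chi_1(z-G(\zeta)-3)+\frac{\phi_\epsilon^\gamma(|w-v_t(\rho)|)}{\lambda_{\epsilon,\zeta}}\mathbf 1_{\{|z|\le G(\zeta)+1\}},$$ a probability density in $(\rho,z)$ on $[0,1]\times\mathbb R_*$. On a probability space, let $V_0$ have law $f_0$, let $0=T_0<T_1<T_2<\dots$ be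 the jump times (with $T_0=0$) of a Poisson process of rate $\lambda_{\epsilon,\zeta}$ independent of $V_0$, put $J_t=\sum_{k\ge1}\mathbf 1_{\{T_k\le t\}}$, and let $(R_k,Z_k)_{k\ge1}$ be such that, with $V^{\epsilon,\zeta}_{T_0}=V_0$ and $$V^{\epsilon,\zeta}_{T_{k+1}}=V^{\epsilon,\zeta}_{T_k}+\mathbf I_\zeta(Z_{k+1})\,A(\vartheta(Z_{k+1}))\big(V^{\epsilon,\zeta}_{T_k}-v_{T_{k+1}}(R_{k+1})\big),$$ for every $k\ge 0$, on $\{T_{k+1}\le T\}$, conditionally on $V_0$, $(T_j)_{j\ge 1}$ and $(R_j,Z_j)_{1\le j\le k}$, the pair $(R_{k+1},Z_{k+1})$ has density $q_{\epsilon,\zeta}(T_{k+1},V^{\epsilon,\zeta}_{T_k},\cdot,\cdot)$. Let $V^{\epsilon,\zeta}_t=V^{\epsilon,\zeta}_{T_{J_t}}$. Let also $(Z_{-1},Z_0)$ have law $\mathcal N(0,I_2)$ and be independent of everything else. **Malliavin covariance matrix.** Put $\pi_{-1}=\pi_0=1$ and $\pi_k=U_\zeta(Z_k)$ for $k\ge1$.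 For a random variable $F$ which is a function of $Z_{-1},\dots,Z_{J_t}$, the other variables $V_0,(T_k),(R_k)$ being frozen, put $D_kF=\pi_k\,\partial_{z_k}F$. Let $\sigma(V^{\epsilon,\zeta}_t)$ be the $2\times2$ matrix with entries $\sigma^{i,j}=\sum_{k=-1}^{J_t}D_k(V^{\epsilon,\zeta}_t)_i\,D_k(V^{\epsilon,\zeta}_t)_j$. **Proposition 4.2.** Put $u_\zeta(t)=t\,\zeta^{4+\nu}$. For all $p\ge1$ and all $0<t_0<t<T$, $$\mathbb E\Big[\big(\det[u_\zeta(t)I+\sigma(V^{\epsilon,\zeta}_t)]\big)^{-p}\Big]\le C_{t_0,p}\,e^{C_p\Gamma_\epsilon^\gamma},$$ where $C_p$ depends only on $b,\nu,\gamma,\delta,\eta_0,T,f_0$ and $p$, and $C_{t_0,p}$ only on these and $t_0$; in particular neither depends on $t$, $\epsilon$ or $\zeta$. -/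

import Mathlib

open MeasureTheory ProbabilityTheory Set
open scoped ENNReal NNReal

noncomputable section

namespace BoltzmannMalliavin

/-- The velocity space `ℝ²` with its Euclidean norm. -/
abbrev Plane : Type := EuclideanSpace ℝ (Fin 2)

/-! ### The Boltzmann equation -/

/-- The angular part of assumption `A(γ, ν)` for the cross section `B(r, θ) = r ^ γ * b θ`:
`b` is even on `[-π/2, π/2] \ {0}`, `c θ^(-1-ν) ≤ b θ ≤ C θ^(-1-ν)` on `(0, π/2]`, and every
derivative of order `k ≥ 1` is bounded by `C_k θ^(-1-ν-k)` on `(0, π/2]`.  Only the values of `b`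
on `[-π/2, π/2] \ {0}` are ever used. -/
structure CrossSection (ν : ℝ) (b : ℝ → ℝ) : Prop where
  even : ∀ θ ∈ Icc (-(Real.pi / 2)) (Real.pi / 2), θ ≠ 0 → b (-θ) = b θ
  bounds : ∃ c C : ℝ, 0 < c ∧ c < C ∧ ∀ θ ∈ Ioc 0 (Real.pi / 2),
    c * θ ^ (-1 - ν) ≤ b θ ∧ b θ ≤ C * θ ^ (-1 - ν)
  smooth : ContDiffOn ℝ (⊤ : ℕ∞) b (Ioc 0 (Real.pi / 2))
  deriv_bounds : ∀ k : ℕ, 1 ≤ k → ∃ C : ℝ, ∀ θ ∈ Ioc 0 (Real.pi / 2),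
    |iteratedDerivWithin k b (Ioc 0 (Real.pi / 2)) θ| ≤ C * θ ^ (-1 - ν - (k : ℝ))

/-- The matrix `A(θ) = (R_θ - I) / 2`, where `R_θ` is the rotation of angle `θ`. -/
def collisionMatrix (θ : ℝ) : Matrix (Fin 2) (Fin 2) ℝ :=
  (1 / 2 : ℝ) • !![Real.cos θ - 1, -Real.sin θ; Real.sin θ, Real.cos θ - 1]

/-- The vector `A(θ) x`. -/
def collide (θ : ℝ) (x : Plane) : Plane :=
  Matrix.toEuclideanLin (collisionMatrix θ) x

/-- `(f_t)_{t ∈ [0, T]}` is a weak solution of the homogeneous Boltzmann equation with cross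
section `|v - v_*| ^ γ * b θ`: probability measures with the same momentum and the same finite
energy at all times, satisfying the weak equation against every globally Lipschitz function. The
time derivative is the one on `[0, T]` (one-sided at both ends). -/
structure IsWeakSolution (γ : ℝ) (b : ℝ → ℝ) (T : ℝ) (f : ℝ → Measure Plane) : Prop where
  prob : ∀ t ∈ Icc 0 T, IsProbabilityMeasure (f t)
  finite_energy : ∀ t ∈ Icc 0 T, Integrable (fun v : Plane => ‖v‖ ^ 2) (f t)
  momentum : ∀ t ∈ Icc 0 T, ∫ v, v ∂(f t) = ∫ v, v ∂(f 0)
  energy : ∀ t ∈ Icc 0 T, ∫ v, ‖v‖ ^ 2 ∂(f t) = ∫ v, ‖v‖ ^ 2 ∂(f 0)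
  weak : ∀ ψ : Plane → ℝ, (∃ K : ℝ≥0, LipschitzWith K ψ) → ∀ t ∈ Icc 0 T,
    HasDerivWithinAt (fun s => ∫ v, ψ v ∂(f s))
      (∫ v, ∫ w, (∫ θ in (-(Real.pi / 2))..(Real.pi / 2),
        b θ * ‖v - w‖ ^ γ * (ψ (v + collide θ (v - w)) - ψ v)) ∂(f t) ∂(f t))
      (Icc 0 T) t

/-- `sup_{t ∈ [0, T]} ∫ exp(|v| ^ δ) f_t(dv) < ∞`. -/
def HasExpMoment (δ T : ℝ) (f : ℝ → Measure Plane) : Prop :=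
  ∃ K : ℝ≥0, ∀ t ∈ Icc 0 T, ∫⁻ v, ENNReal.ofReal (Real.exp (‖v‖ ^ δ)) ∂(f t) ≤ K

/-- A measurable family of maps `v_t : [0, 1] → ℝ²` such that `v_t` has law `f_t` when `[0, 1]`
carries the Lebesgue measure, for every `t ∈ [0, T]`. -/
structure IsRepresentation (T : ℝ) (f : ℝ → Measure Plane) (v : ℝ → ℝ → Plane) : Prop where
  measurable : Measurable (Function.uncurry v)
  law : ∀ t ∈ Icc 0 T, (volume.restrict (Icc (0 : ℝ) 1)).map (v t) = f t

/-! ### Truncations and regularizations -/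

/-- `Γ_ε = (log (1 / ε)) ^ η₀`. -/
def Gam (η₀ ε : ℝ) : ℝ := Real.log (1 / ε) ^ η₀

/-- A `C^∞` even nonnegative mollifier supported by `(-1, 1)` with integral one. -/
structure IsEvenMollifier (χ : ℝ → ℝ) : Prop where
  smooth : ContDiff ℝ (⊤ : ℕ∞) χ
  even : ∀ x, χ (-x) = χ x
  nonneg : ∀ x, 0 ≤ χ x
  support : Function.support χ ⊆ Ioo (-1) 1
  integral : ∫ x, χ x = 1

/-- A `C^∞` function `ℝ → [0, 1]` supported by `(-1, 1)` with integral one. -/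
structure IsBumpDensity (χ : ℝ → ℝ) : Prop where
  smooth : ContDiff ℝ (⊤ : ℕ∞) χ
  mem_Icc : ∀ x, χ x ∈ Icc (0 : ℝ) 1
  support : Function.support χ ⊆ Ioo (-1) 1
  integral : ∫ x, χ x = 1

/-- `φ_ε(x) = ∫ ((y ∨ 2ε) ∧ Γ_ε) χ((x - y) / ε) / ε dy`. -/
def phi (χ : ℝ → ℝ) (η₀ ε x : ℝ) : ℝ :=
  ∫ y, min (max y (2 * ε)) (Gam η₀ ε) * (χ ((x - y) / ε) / ε)

/-- `G(x) = ∫_x^{π/2} b(θ) dθ`. -/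
def angG (b : ℝ → ℝ) (x : ℝ) : ℝ := ∫ θ in x..(Real.pi / 2), b θ

/-- The inverse `ϑ : (0, ∞) → (0, π/2)` of `G : (0, π/2) → (0, ∞)`, extended as an odd function
(with the irrelevant value `0` at `0`). -/
def angle (b : ℝ → ℝ) (z : ℝ) : ℝ :=
  SignType.sign z * Function.invFunOn (angG b) (Ioo 0 (Real.pi / 2)) |z|

/-- The smooth cutoff `z ↦ 𝐈_ζ(z) = I_ζ(ϑ(|z|))`, an even function `ℝ → [0, 1]`. -/
structure IsAngularCutoff (b : ℝ → ℝ) (ζ : ℝ) (I : ℝ → ℝ) : Prop where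
  smooth : ContDiff ℝ (⊤ : ℕ∞) I
  even : ∀ z, I (-z) = I z
  mem_Icc : ∀ z, I z ∈ Icc (0 : ℝ) 1
  eq_one : ∀ z, |z| ≤ angG b ζ → I z = 1
  eq_zero : ∀ z, angG b ζ + 1 ≤ |z| → I z = 0

/-- The smooth weight `U_ζ` with values in `[0, 1]`. -/
structure IsWeight (b : ℝ → ℝ) (ζ : ℝ) (U : ℝ → ℝ) : Prop where
  smooth : ContDiff ℝ (⊤ : ℕ∞) U
  mem_Icc : ∀ z, U z ∈ Icc (0 : ℝ) 1
  eq_one : ∀ z, |z| ∈ Ioo 1 (angG b ζ - 1) → U z = 1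
  eq_zero_of_le : ∀ z, |z| ≤ 1 / 2 → U z = 0
  eq_zero_of_ge : ∀ z, angG b ζ - 1 / 2 ≤ |z| → U z = 0

/-! ### The regularized process -/

/-- The rate `λ_{ε,ζ} = 4 (G(ζ) + 1) Γ_ε ^ γ` of the driving Poisson process. -/
def rate (γ : ℝ) (b : ℝ → ℝ) (η₀ ε ζ : ℝ) : ℝ := 4 * (angG b ζ + 1) * Gam η₀ ε ^ γ

/-- `g_{ε,ζ}(t, w) = 1 - (2 Γ_ε ^ γ)⁻¹ ∫_0^1 φ_ε ^ γ(|w - v_t(ρ)|) dρ`. -/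
def fictitiousProb (γ : ℝ) (χ : ℝ → ℝ) (v : ℝ → ℝ → Plane) (η₀ ε t : ℝ) (w : Plane) : ℝ :=
  1 - 1 / (2 * Gam η₀ ε ^ γ) * ∫ ρ in Icc (0 : ℝ) 1, phi χ η₀ ε ‖w - v t ρ‖ ^ γ

/-- The density `q_{ε,ζ}(t, w, ρ, z)` on `[0, 1] × ℝ_*` of the mark `(ρ, z)` of a jump that occurs
at time `t` from the position `w`. -/
def markDensity (γ : ℝ) (b χ χ₁ : ℝ → ℝ) (v : ℝ → ℝ → Plane) (η₀ ε ζ t : ℝ) (w : Plane)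
    (ρ z : ℝ) : ℝ :=
  fictitiousProb γ χ v η₀ ε t w * χ₁ (z - angG b ζ - 3) +
    phi χ η₀ ε ‖w - v t ρ‖ ^ γ / rate γ b η₀ ε ζ *
      (Icc (-(angG b ζ + 1)) (angG b ζ + 1)).indicator (fun _ => (1 : ℝ)) z

/-- The function `ℋ_k(x, (t_1, ρ_1, z_1), …, (t_k, ρ_k, z_k))` giving the position after `k` jumps.
The variables `z` are indexed by integers `k ≥ -1`; those of index `-1` and `0` play no role
here. -/
def position (b I : ℝ → ℝ) (v : ℝ → ℝ → Plane) (x : Plane) (τ ρ : ℕ → ℝ) (z : ℤ → ℝ) :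
    ℕ → Plane
  | 0 => x
  | k + 1 =>
    position b I v x τ ρ z k +
      I (z (k + 1)) • collide (angle b (z (k + 1)))
        (position b I v x τ ρ z k - v (τ (k + 1)) (ρ (k + 1)))

/-- The joint law of the random variables `V₀`, `(T_k)_{k ≥ 0}`, `(R_k)_{k ≥ 1}`, `(Z_k)_{k ≥ -1}`
which define the process `V^{ε,ζ}` on `[0, T]` (here `T_k` is written `τ k`, and `R 0` plays no
role).
* `V₀` has law `f_0`;
* the `T_k` are the jump times of a Poisson process with rate `λ_{ε,ζ}`, independent of `V₀`;
* as long as `T_{k+1} ≤ T`, conditionally on `V₀`, on all the jump times and on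
  `(R_1, Z_1), …, (R_k, Z_k)`, the law of `(R_{k+1}, Z_{k+1})` is
  `q_{ε,ζ}(T_{k+1}, V^{ε,ζ}_{T_k}, ρ, z) dρ dz` on `[0, 1] × ℝ_*`, where
  `V^{ε,ζ}_{T_k} = ℋ_k(V₀, (T_1, R_1, Z_1), …, (T_k, R_k, Z_k))`;
* `(Z_{-1}, Z_0)` has law `N(0, I_2)` and is independent of everything else. -/
structure IsRegularizedSystem {Ω : Type*} [MeasurableSpace Ω] (P : Measure Ω)
    (γ : ℝ) (b χ χ₁ I : ℝ → ℝ) (f : ℝ → Measure Plane) (v : ℝ → ℝ → Plane) (T η₀ ε ζ : ℝ)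
    (V₀ : Ω → Plane) (τ R : ℕ → Ω → ℝ) (Z : ℤ → Ω → ℝ) : Prop where
  measurable_V₀ : Measurable V₀
  measurable_τ : ∀ k, Measurable (τ k)
  measurable_R : ∀ k, Measurable (R k)
  measurable_Z : ∀ k, Measurable (Z k)
  law_V₀ : P.map V₀ = f 0
  τ_zero : ∀ ω, τ 0 ω = 0
  law_gap : ∀ k, P.map (fun ω => τ (k + 1) ω - τ k ω) = expMeasure (rate γ b η₀ ε ζ)
  indep_gap : iIndepFun (fun k ω => τ (k + 1) ω - τ k ω) P
  indep_V₀ : IndepFun V₀ (fun ω k => τ k ω) P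
  law_mark : ∀ (k : ℕ) (ψ : (Plane × (ℕ → ℝ) × (Fin k → ℝ × ℝ)) × (ℝ × ℝ) → ℝ≥0∞),
    Measurable ψ →
    ∫⁻ ω in {ω | τ (k + 1) ω ≤ T},
        ψ ((V₀ ω, fun j => τ j ω, fun i : Fin k => (R (i + 1) ω, Z ((i : ℤ) + 1) ω)),
          (R (k + 1) ω, Z ((k : ℤ) + 1) ω)) ∂P =
      ∫⁻ ω in {ω | τ (k + 1) ω ≤ T}, (∫⁻ y in Icc (0 : ℝ) 1 ×ˢ ({0}ᶜ : Set ℝ),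
        ψ ((V₀ ω, fun j => τ j ω, fun i : Fin k => (R (i + 1) ω, Z ((i : ℤ) + 1) ω)), y) *
          ENNReal.ofReal (markDensity γ b χ χ₁ v η₀ ε ζ (τ (k + 1) ω)
            (position b I v (V₀ ω) (fun j => τ j ω) (fun j => R j ω) (fun j => Z j ω) k)
            y.1 y.2)) ∂P
  law_gaussian : P.map (fun ω => (Z (-1) ω, Z 0 ω)) = (gaussianReal 0 1).prod (gaussianReal 0 1)
  indep_gaussian : IndepFun (fun ω => (Z (-1) ω, Z 0 ω))
    (fun ω => (V₀ ω, fun k : ℕ => (τ (k + 1) ω, R (k + 1) ω, Z ((k : ℤ) + 1) ω))) P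

/-- `J_t = ∑_{k ≥ 1} 1_{T_k ≤ t}`, the number of jumps up to time `t`. -/
def jumpCount (τ : ℕ → ℝ) (t : ℝ) : ℕ := {k : ℕ | 1 ≤ k ∧ τ k ≤ t}.ncard

/-- `V^{ε,ζ}_t = ℋ_{J_t}(V₀, (T_1, R_1, Z_1), …)` as a function of the variables `z`, the other
variables being frozen. -/
def process (b I : ℝ → ℝ) (v : ℝ → ℝ → Plane) (x : Plane) (τ ρ : ℕ → ℝ) (t : ℝ)
    (z : ℤ → ℝ) : Plane :=
  position b I v x τ ρ z (jumpCount τ t)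

/-! ### Malliavin calculus with respect to the variables `Z` -/

/-- `π_{-1} = π_0 = 1` and `π_k = U_ζ(z_k)` for `k ≥ 1`. -/
def weight (U : ℝ → ℝ) (z : ℤ → ℝ) (k : ℤ) : ℝ := if k ≤ 0 then 1 else U (z k)

/-- The Malliavin derivative `D_k F = π_k ∂_{z_k} h(z)` of the simple functional `F = h(z)`. -/
def malliavinDeriv (U : ℝ → ℝ) (h : (ℤ → ℝ) → ℝ) (z : ℤ → ℝ) (k : ℤ) : ℝ :=
  weight U z k * deriv (fun x => h (Function.update z k x)) (z k)

/-- The Malliavin covariance matrix `σ^{i,j}(F) = ∑_{k=-1}^{J} D_k F_i D_k F_j` of the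
two-dimensional simple functional `F = h(z_{-1}, …, z_J)`. -/
def malliavinCov (U : ℝ → ℝ) (J : ℕ) (h : (ℤ → ℝ) → Plane) (z : ℤ → ℝ) :
    Matrix (Fin 2) (Fin 2) ℝ :=
  Matrix.of fun i j => ∑ k ∈ Finset.Icc (-1 : ℤ) J,
    malliavinDeriv U (fun y => h y i) z k * malliavinDeriv U (fun y => h y j) z k

/-- The Malliavin covariance matrix `σ(V^{ε,ζ}_t)`. -/
def processCov (b I U : ℝ → ℝ) (v : ℝ → ℝ → Plane) (x : Plane) (τ ρ : ℕ → ℝ) (z : ℤ → ℝ)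
    (t : ℝ) : Matrix (Fin 2) (Fin 2) ℝ :=
  malliavinCov U (jumpCount τ t) (process b I v x τ ρ t) z

/-- `u_ζ(t) = t ζ ^ (4 + ν)`. -/
def uReg (ν ζ t : ℝ) : ℝ := t * ζ ^ (4 + ν)

end BoltzmannMalliavin

end

open BoltzmannMalliavin

/-! Identify the plane with ℂ, so that A(θ) is multiplication by (e^{iθ} - 1)/2 and each jump is
affine in the position. Perturbing the mark of a jump moves the final position by Y d_k, where Y is
the product over all jumps of the factors 1 + 𝐈(z)(e^{iθ} - 1)/2, and d_k (`jumpDirection`) depends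
only on the jump time, the state before the jump and its mark (`malliavinDeriv_position`). The
determinant of the regularized covariance is then an explicit function of Y, ∑|d_k|² and ∑d_k²
(`det_processCov`), so these quantities are carried along with the position as one Markov chain. The
determinant is at least |Y|⁴ times `reducedDet`, which involves the d_k alone, and the
arithmetic-geometric inequality reduces the claim to moments of |Y|^{-8p} and of `reducedDet`^{-2p}
(`covDet_rpow_neg_le`).

For |Y|: one factor has modulus 1 - O(θ²), the function ϑ² is integrable because ν < 1, and the
density of a mark within the cutoff range is at most Γ^γ/λ. A jump therefore multiplies the
conditional moment by at most 1 + CΓ^γ/λ, and since jumps come at rate λ the total is exp(CΓ^γ).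
This is the only source of the exponential in the result.

For `reducedDet`: a negative power of a determinant is dominated by a Gaussian moment over
frequencies ξ (`det_rpow_neg_le_lintegral`), which leaves the Laplace transform E exp(-∑(Re(conj(ξ)
d_k))²). A mark with 1 < |z| < |ξ|^{ν/(1+ν)} satisfies |ϑ'(z)||ξ| ≥ c₀, and it adds a definite
amount to the sum as soon as v_t(ρ) is at a definite distance from a line determined by ξ and the
current state; the sign of z is chosen so that nothing cancels (`covExp_step_le_of_nondegenerate`).
Up to constants this yields the bound exp(-c min(|ξ|^{ν/(1+ν)}, G(ζ))). The cap G(ζ), at least of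
order ζ^{-ν}, is compensated by the Gaussian factor exp(-tζ^{4+ν}|ξ|²): the two together decay like
exp(-m|ξ|^{ν/(2+ν)}) uniformly in ζ (`exists_regularized_exp_le`).

What remains is that f_s stays away from all lines, uniformly over the solutions started from f₀,
for s in some time interval before t₀ (`exists_window`). If f₀ is not carried by a line, this
follows from compactness of the set of relevant lines and Lipschitz continuity in time. If f₀ is
carried by a line without being a Dirac mass, collisions between particles near two distinct points
of the line make a convex function of the distance to the line grow linearly in time, while
near-concentration on any other line would allow only quadratic growth.

Conditional one-step estimates are turned into estimates at time t by solving the renewal equation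
of the exponential clocks (`lintegral_prod_arrival_le`, `lintegral_stateAfter_jumpCount_le`). -/

open BoltzmannMalliavin

namespace BoltzmannMalliavin

/-! ### The tail function G, its inverse ϑ, and their power-law bounds. -/

section Angular

variable {ν : ℝ} {b : ℝ → ℝ}

theorem CrossSection.continuousOn (hb : CrossSection ν b) :
    ContinuousOn b (Ioc 0 (Real.pi / 2)) := hb.smooth.continuousOn

theorem CrossSection.pos (hb : CrossSection ν b) {θ : ℝ} (hθ : θ ∈ Ioc 0 (Real.pi / 2)) :
    0 < b θ := by
  obtain ⟨c, C, hc, _, h⟩ := hb.bounds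
  exact lt_of_lt_of_le (mul_pos hc (Real.rpow_pos_of_pos hθ.1 _)) (h θ hθ).1

theorem CrossSection.intervalIntegrable (hb : CrossSection ν b) {x y : ℝ} (hx : 0 < x)
    (hxy : x ≤ y) (hy : y ≤ Real.pi / 2) : IntervalIntegrable b volume x y := by
  apply ContinuousOn.intervalIntegrable
  rw [uIcc_of_le hxy]
  exact hb.continuousOn.mono fun t ht => ⟨hx.trans_le ht.1, ht.2.trans hy⟩

theorem integral_rpow_angular {ν : ℝ} (hν : 0 < ν) {x : ℝ} (hx : 0 < x) {h : ℝ} (hxh : x ≤ h) :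
    ∫ θ in x..h, θ ^ (-1 - ν) = (x ^ (-ν) - h ^ (-ν)) / ν := by
  rw [integral_rpow]
  · have : -1 - ν + 1 = -ν := by ring
    rw [this]; field_simp; ring
  · right
    refine ⟨by linarith, ?_⟩
    rw [uIcc_of_le hxh]
    exact fun h0 => absurd h0.1 (not_le.2 hx)

theorem intervalIntegrable_rpow_angular {ν : ℝ} {x : ℝ} (hx : 0 < x) {h : ℝ}
    (hxh : x ≤ h) : IntervalIntegrable (fun θ : ℝ => θ ^ (-1 - ν)) volume x h := by
  apply intervalIntegral.intervalIntegrable_rpow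
  right
  rw [uIcc_of_le hxh]
  exact fun h0 => absurd h0.1 (not_le.2 hx)

theorem angG_le (hν : 0 < ν) {C : ℝ} (hb : CrossSection ν b)
    (hC : ∀ θ ∈ Ioc 0 (Real.pi / 2), b θ ≤ C * θ ^ (-1 - ν)) {x : ℝ}
    (hx : x ∈ Ioc 0 (Real.pi / 2)) :
    angG b x ≤ C * ((x ^ (-ν) - (Real.pi / 2) ^ (-ν)) / ν) := by
  rw [← integral_rpow_angular hν hx.1 hx.2, ← intervalIntegral.integral_const_mul]
  apply intervalIntegral.integral_mono_on hx.2 (hb.intervalIntegrable hx.1 hx.2 le_rfl)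
    ((intervalIntegrable_rpow_angular hx.1 hx.2).const_mul C)
  exact fun θ hθ => hC θ ⟨hx.1.trans_le hθ.1, hθ.2⟩

theorem le_angG (hν : 0 < ν) {c : ℝ} (hb : CrossSection ν b)
    (hc : ∀ θ ∈ Ioc 0 (Real.pi / 2), c * θ ^ (-1 - ν) ≤ b θ) {x : ℝ}
    (hx : x ∈ Ioc 0 (Real.pi / 2)) :
    c * ((x ^ (-ν) - (Real.pi / 2) ^ (-ν)) / ν) ≤ angG b x := by
  rw [← integral_rpow_angular hν hx.1 hx.2, ← intervalIntegral.integral_const_mul]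
  apply intervalIntegral.integral_mono_on hx.2
    ((intervalIntegrable_rpow_angular hx.1 hx.2).const_mul c)
    (hb.intervalIntegrable hx.1 hx.2 le_rfl)
  exact fun θ hθ => hc θ ⟨hx.1.trans_le hθ.1, hθ.2⟩

theorem angG_sub (hb : CrossSection ν b) {x y : ℝ} (hx : 0 < x) (hxy : x ≤ y)
    (hy : y ≤ Real.pi / 2) : angG b x = (∫ θ in x..y, b θ) + angG b y := by
  unfold angG
  rw [intervalIntegral.integral_add_adjacent_intervals (hb.intervalIntegrable hx hxy hy)
    (hb.intervalIntegrable (hx.trans_le hxy) hy le_rfl)]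

theorem strictAntiOn_angG (hb : CrossSection ν b) :
    StrictAntiOn (angG b) (Ioc 0 (Real.pi / 2)) := by
  intro x hx y hy hxy
  rw [angG_sub hb hx.1 hxy.le hy.2]
  have := intervalIntegral.intervalIntegral_pos_of_pos_on
    (hb.intervalIntegrable hx.1 hxy.le hy.2)
    (fun t ht => hb.pos ⟨hx.1.trans ht.1, ht.2.le.trans hy.2⟩) hxy
  linarith

theorem angG_pi_div_two : angG b (Real.pi / 2) = 0 := by simp [angG]

theorem angG_pos (hb : CrossSection ν b) {x : ℝ} (hx : x ∈ Ioo 0 (Real.pi / 2)) :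
    0 < angG b x := by
  rw [← angG_pi_div_two (b := b)]
  exact strictAntiOn_angG hb ⟨hx.1, hx.2.le⟩ ⟨by positivity, le_rfl⟩ hx.2

theorem hasDerivAt_angG (hb : CrossSection ν b) {x : ℝ} (hx : x ∈ Ioo 0 (Real.pi / 2)) :
    HasDerivAt (angG b) (-b x) x := by
  have hU : Ioc 0 (Real.pi / 2) ∈ nhds x := Ioc_mem_nhds hx.1 hx.2
  refine intervalIntegral.integral_hasDerivAt_left (hb.intervalIntegrable hx.1 hx.2.le le_rfl)
    ?_ (hb.continuousOn.continuousAt hU)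
  exact ContinuousOn.stronglyMeasurableAtFilter isOpen_Ioo
    (hb.continuousOn.mono Ioo_subset_Ioc_self) x hx

theorem continuousOn_angG (hb : CrossSection ν b) {a : ℝ} (ha : 0 < a) :
    ContinuousOn (angG b) (Icc a (Real.pi / 2)) := by
  by_cases h : a ≤ Real.pi / 2
  · have := intervalIntegral.continuousOn_primitive_interval_left (μ := volume) (f := b)
      (a := a) (b := Real.pi / 2) (by
        rw [uIcc_of_le h]
        exact (hb.continuousOn.mono fun t ht => ⟨ha.trans_le ht.1, ht.2⟩).integrableOn_Icc)
    rwa [uIcc_of_le h] at this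
  · rw [Icc_eq_empty h]; exact continuousOn_empty _

theorem exists_angG_eq (hν : 0 < ν) (hb : CrossSection ν b) {z : ℝ} (hz : 0 < z) :
    ∃ x ∈ Ioo 0 (Real.pi / 2), angG b x = z := by
  obtain ⟨c, C, hc, _, h⟩ := hb.bounds
  have hpi := Real.pi_pos
  -- K is the value of a^(-ν) at the left end of the interval: the lower power bound for G at a is
  -- then z + c/ν, strictly above z, and K > (π/2)^(-ν) forces a < π/2.
  set K := ν * z / c + (Real.pi / 2) ^ (-ν) + 1 with hK
  have hK0 : 0 < K := by positivity
  set a := K ^ (-1 / ν) with ha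
  have ha0 : 0 < a := Real.rpow_pos_of_pos hK0 _
  have haν : a ^ (-ν) = K := by
    rw [ha, ← Real.rpow_mul hK0.le]
    have : -1 / ν * -ν = 1 := by field_simp
    rw [this, Real.rpow_one]
  have haH : a < Real.pi / 2 := by
    by_contra hcon
    push Not at hcon
    have := Real.rpow_le_rpow_of_nonpos (by positivity) hcon (by linarith : -ν ≤ 0)
    rw [haν, hK] at this
    have : 0 < ν * z / c := by positivity
    linarith
  have hlow := le_angG hν hb (fun θ hθ => (h θ hθ).1) (x := a) ⟨ha0, haH.le⟩
  rw [haν] at hlow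
  have h2 : c * ((K - (Real.pi / 2) ^ (-ν)) / ν) = z + c / ν := by
    rw [hK]; field_simp; ring
  have h3 : z < angG b a := by
    have : 0 < c / ν := by positivity
    linarith
  have := intermediate_value_Ioo' haH.le (continuousOn_angG hb ha0)
  obtain ⟨x, hx, hxz⟩ := this (show z ∈ Ioo _ _ from ⟨by rw [angG_pi_div_two]; exact hz, h3⟩)
  exact ⟨x, ⟨ha0.trans hx.1, hx.2⟩, hxz⟩

theorem angle_neg (z : ℝ) : angle b (-z) = -angle b z := by
  unfold angle
  rw [abs_neg]
  rcases lt_trichotomy z 0 with h | h | h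
  · simp [sign_neg h, sign_pos (neg_pos.2 h)]
  · simp [h]
  · simp [sign_pos h, sign_neg (neg_neg_of_pos h)]

theorem angle_zero : angle b 0 = 0 := by simp [angle]

theorem angle_mem (hν : 0 < ν) (hb : CrossSection ν b) {z : ℝ} (hz : 0 < z) :
    angle b z ∈ Ioo 0 (Real.pi / 2) := by
  have := Function.invFunOn_mem (exists_angG_eq hν hb hz)
  simpa [angle, sign_pos hz, abs_of_pos hz] using this

theorem angG_angle (hν : 0 < ν) (hb : CrossSection ν b) {z : ℝ} (hz : 0 < z) :
    angG b (angle b z) = z := by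
  have := Function.invFunOn_eq (exists_angG_eq hν hb hz)
  simpa [angle, sign_pos hz, abs_of_pos hz] using this

theorem angle_angG (hν : 0 < ν) (hb : CrossSection ν b) {x : ℝ} (hx : x ∈ Ioo 0 (Real.pi / 2)) :
    angle b (angG b x) = x := by
  have hz := angG_pos hb hx
  have h1 := angle_mem hν hb hz
  exact (strictAntiOn_angG hb).injOn ⟨h1.1, h1.2.le⟩ ⟨hx.1, hx.2.le⟩ (angG_angle hν hb hz)

theorem strictAntiOn_angle (hν : 0 < ν) (hb : CrossSection ν b) :
    StrictAntiOn (angle b) (Ioi 0) := by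
  intro x hx y hy hxy
  have h1 := angle_mem hν hb hx
  have h2 := angle_mem hν hb hy
  rw [← (strictAntiOn_angG hb).lt_iff_gt ⟨h1.1, h1.2.le⟩ ⟨h2.1, h2.2.le⟩,
    angG_angle hν hb hx, angG_angle hν hb hy]
  exact hxy

theorem continuousAt_angle (hν : 0 < ν) (hb : CrossSection ν b) {z : ℝ} (hz : 0 < z) :
    ContinuousAt (angle b) z := by
  have hm : StrictMonoOn (fun x => -angle b x) (Ioi 0) :=
    fun x hx y hy hxy => neg_lt_neg (strictAntiOn_angle hν hb hx hy hxy)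
  have hmem := angle_mem hν hb hz
  have key : ContinuousAt (fun x => -angle b x) z := by
    refine hm.continuousAt_of_image_mem_nhds (Ioi_mem_nhds hz) ?_
    refine Filter.mem_of_superset (Ioo_mem_nhds (a := -(Real.pi / 2)) (b := 0)
      (by linarith [hmem.2]) (by linarith [hmem.1])) ?_
    intro y hy
    have hy' : -y ∈ Ioo 0 (Real.pi / 2) := ⟨by linarith [hy.2], by linarith [hy.1]⟩
    exact ⟨angG b (-y), angG_pos hb hy', by simp [angle_angG hν hb hy']⟩
  have := key.neg
  exact this.congr (Filter.Eventually.of_forall fun x => by simp)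

theorem hasDerivAt_angle_of_pos (hν : 0 < ν) (hb : CrossSection ν b) {z : ℝ} (hz : 0 < z) :
    HasDerivAt (angle b) (-b (angle b z))⁻¹ z := by
  have hmem := angle_mem hν hb hz
  refine HasDerivAt.of_local_left_inverse (continuousAt_angle hν hb hz) (hasDerivAt_angG hb hmem)
    (neg_ne_zero.2 (hb.pos ⟨hmem.1, hmem.2.le⟩).ne') ?_
  filter_upwards [Ioi_mem_nhds hz] with y hy using angG_angle hν hb hy

theorem hasDerivAt_angle (hν : 0 < ν) (hb : CrossSection ν b) {z : ℝ} (hz : z ≠ 0) :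
    HasDerivAt (angle b) (-b (angle b |z|))⁻¹ z := by
  rcases lt_or_gt_of_ne hz with h | h
  · rw [abs_of_neg h]
    have h1 := (hasDerivAt_angle_of_pos hν hb (neg_pos.2 h))
    have h2 := (h1.scomp z (hasDerivAt_neg z)).neg
    have h3 : (-(angle b ∘ Neg.neg)) = angle b := by
      ext x; simp [angle_neg]
    rw [h3] at h2
    simpa using h2
  · rw [abs_of_pos h]
    exact hasDerivAt_angle_of_pos hν hb h

theorem measurable_angle (hν : 0 < ν) (hb : CrossSection ν b) : Measurable (angle b) :=
  measurable_of_continuousOn_compl_singleton 0 fun _ hz =>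
    (hasDerivAt_angle hν hb hz).continuousAt.continuousWithinAt

theorem abs_angle (hν : 0 < ν) (hb : CrossSection ν b) {z : ℝ} (hz : z ≠ 0) :
    |angle b z| = angle b |z| := by
  rcases lt_or_gt_of_ne hz with h | h
  · rw [abs_of_neg h, angle_neg, ← abs_neg, ← angle_neg]
    rw [abs_of_pos (angle_mem hν hb (neg_pos.2 h)).1, angle_neg]
  · rw [abs_of_pos h, abs_of_pos (angle_mem hν hb h).1]

theorem abs_angle_lt (hν : 0 < ν) (hb : CrossSection ν b) (z : ℝ) :
    |angle b z| < Real.pi / 2 := by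
  by_cases hz : z = 0
  · rw [hz, angle_zero, abs_zero]; positivity
  · rw [abs_angle hν hb hz]; exact (angle_mem hν hb (abs_pos.2 hz)).2

/-- The upper bound on b gives θ^ν |z| ≤ C/ν with θ = ϑ(|z|); adding θ^ν ≤ (π/2)^ν removes the
singularity at small z. The decay |z|^(-1/ν) makes ϑ² integrable, since 2/ν > 1. -/
theorem exists_abs_angle_le (hν : 0 < ν) (hb : CrossSection ν b) :
    ∃ K : ℝ, 0 < K ∧ ∀ z, |angle b z| ≤ (K / (1 + |z|)) ^ (1 / ν) := by
  obtain ⟨c, C, hc, hcC, h⟩ := hb.bounds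
  have hC : 0 < C := hc.trans hcC
  refine ⟨(Real.pi / 2) ^ ν + C / ν, by positivity, fun z => ?_⟩
  by_cases hz : z = 0
  · rw [hz, angle_zero, abs_zero]; positivity
  rw [abs_angle hν hb hz]
  have hz0 := abs_pos.2 hz
  obtain ⟨h1, h2⟩ := angle_mem hν hb hz0
  have hup := angG_le hν hb (fun θ hθ => (h θ hθ).2) (x := angle b |z|) ⟨h1, h2.le⟩
  rw [angG_angle hν hb hz0] at hup
  set θ := angle b |z|
  have hp : 0 < θ ^ ν := Real.rpow_pos_of_pos h1 _
  have h3 : |z| ≤ C / ν * θ ^ (-ν) := by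
    refine hup.trans ?_
    have : 0 ≤ (Real.pi / 2) ^ (-ν) := by positivity
    rw [mul_div_assoc', div_mul_eq_mul_div]
    gcongr
    linarith
  have h4 : θ ^ ν * |z| ≤ C / ν := by
    rw [Real.rpow_neg h1.le, ← div_eq_mul_inv, le_div_iff₀ hp] at h3
    linarith
  have h5 : θ ^ ν ≤ (Real.pi / 2) ^ ν := Real.rpow_le_rpow h1.le h2.le hν.le
  have h6 : θ ^ ν ≤ ((Real.pi / 2) ^ ν + C / ν) / (1 + |z|) := by
    rw [le_div_iff₀ (by positivity)]; linarith
  calc θ = (θ ^ ν) ^ (1 / ν) := by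
        rw [← Real.rpow_mul h1.le]; field_simp; simp
    _ ≤ _ := Real.rpow_le_rpow hp.le h6 (by positivity)

theorem exists_lintegral_angle_sq_le (hν : ν ∈ Ioo (0 : ℝ) 1) (hb : CrossSection ν b) :
    ∃ K : ℝ, 0 ≤ K ∧ ∫⁻ z, ENNReal.ofReal (angle b z ^ 2) ≤ ENNReal.ofReal K := by
  obtain ⟨K, hK, h⟩ := exists_abs_angle_le hν.1 hb
  have hint : Integrable (fun z : ℝ => K ^ (2 / ν) * (1 + ‖z‖) ^ (-(2 / ν))) volume := by
    refine (integrable_one_add_norm ?_).const_mul _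
    simp only [Module.finrank_self, Nat.cast_one]
    rw [lt_div_iff₀ hν.1]; linarith [hν.2]
  refine ⟨∫ z : ℝ, K ^ (2 / ν) * (1 + ‖z‖) ^ (-(2 / ν)),
    integral_nonneg fun z => by positivity, ?_⟩
  rw [ofReal_integral_eq_lintegral_ofReal hint (Filter.Eventually.of_forall fun z => by positivity)]
  refine lintegral_mono fun z => ENNReal.ofReal_le_ofReal ?_
  rw [← sq_abs]
  calc |angle b z| ^ 2 ≤ ((K / (1 + |z|)) ^ (1 / ν)) ^ 2 := by gcongr; exact h z
    _ = (K / (1 + |z|)) ^ (2 / ν) := by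
        rw [← Real.rpow_natCast, ← Real.rpow_mul (by positivity)]; congr 1; push_cast; ring
    _ = _ := by
        rw [Real.div_rpow hK.le (by positivity), Real.rpow_neg (by positivity), Real.norm_eq_abs]
        rfl

/-- Here |ϑ'| = 1/b(ϑ), so an upper bound on b at ϑ is combined with θ^(-ν) = O(|z|); the
restriction |z| ≥ 1 absorbs the constant (π/2)^(-ν). The exponent (1+ν)/ν is the one that later
fixes which marks are useful at frequency ξ. -/
theorem exists_le_abs_deriv_angle (hν : 0 < ν) (hb : CrossSection ν b) :
    ∃ c : ℝ, 0 < c ∧ ∀ z, 1 ≤ |z| → c * |z| ^ (-((1 + ν) / ν)) ≤ |deriv (angle b) z| := by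
  obtain ⟨c, C, hc, hcC, h⟩ := hb.bounds
  have hC : 0 < C := hc.trans hcC
  set K := ν / c + (Real.pi / 2) ^ (-ν) with hK
  have hK0 : 0 < K := by positivity
  refine ⟨K ^ (-((1 + ν) / ν)) / C, by positivity, fun z hz => ?_⟩
  have hz0 : 0 < |z| := by linarith
  rw [(hasDerivAt_angle hν hb (abs_pos.1 hz0)).deriv]
  obtain ⟨h1, h2⟩ := angle_mem hν hb hz0
  have hlow := le_angG hν hb (fun θ hθ => (h θ hθ).1) (x := angle b |z|) ⟨h1, h2.le⟩
  rw [angG_angle hν hb hz0] at hlow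
  have hup := (h (angle b |z|) ⟨h1, h2.le⟩).2
  have hpos := hb.pos (θ := angle b |z|) ⟨h1, h2.le⟩
  set θ := angle b |z|
  rw [abs_inv, abs_neg, abs_of_pos hpos]
  have h3 : θ ^ (-ν) ≤ K * |z| := by
    have h4 : θ ^ (-ν) - (Real.pi / 2) ^ (-ν) ≤ ν / c * |z| := by
      rw [div_mul_eq_mul_div, le_div_iff₀ hc]
      rw [mul_div_assoc', div_le_iff₀ hν] at hlow
      linarith
    have h5 : (Real.pi / 2) ^ (-ν) ≤ (Real.pi / 2) ^ (-ν) * |z| :=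
      le_mul_of_one_le_right (by positivity) hz
    rw [hK]; linarith
  have h6 : θ ^ (-1 - ν) ≤ (K * |z|) ^ ((1 + ν) / ν) := by
    calc θ ^ (-1 - ν) = (θ ^ (-ν)) ^ ((1 + ν) / ν) := by
          rw [← Real.rpow_mul h1.le]; congr 1; field_simp; ring
      _ ≤ _ := Real.rpow_le_rpow (by positivity) h3 (by positivity)
  have h7 : b θ ≤ C * (K * |z|) ^ ((1 + ν) / ν) :=
    hup.trans (mul_le_mul_of_nonneg_left h6 hC.le)
  calc K ^ (-((1 + ν) / ν)) / C * |z| ^ (-((1 + ν) / ν))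
      = (C * (K * |z|) ^ ((1 + ν) / ν))⁻¹ := by
        rw [Real.mul_rpow hK0.le hz0.le, Real.rpow_neg hK0.le, Real.rpow_neg hz0.le]
        field_simp
    _ ≤ _ := inv_anti₀ hpos h7

theorem exists_le_angG (hν : 0 < ν) (hb : CrossSection ν b) :
    ∃ c K : ℝ, 0 < c ∧ 0 ≤ K ∧ ∀ ζ ∈ Ioo (0 : ℝ) 1, c * ζ ^ (-ν) - K ≤ angG b ζ := by
  obtain ⟨c, C, hc, hcC, h⟩ := hb.bounds
  refine ⟨c / ν, c / ν * (Real.pi / 2) ^ (-ν), by positivity, by positivity, fun ζ hζ => ?_⟩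
  have hpi : (1 : ℝ) < Real.pi / 2 := by linarith [Real.pi_gt_three]
  refine le_trans (le_of_eq ?_)
    (le_angG hν hb (fun θ hθ => (h θ hθ).1) (x := ζ) ⟨hζ.1, hζ.2.le.trans hpi.le⟩)
  field_simp

end Angular

/-! ### Negative powers of a 2×2 determinant as Gaussian moments. -/

theorem volume_sheared_rectangle {s h k : ℝ} (hs : 0 ≤ s) :
    MeasurableSet {ξ : ℝ × ℝ | |ξ.2| ≤ h ∧ |ξ.1 + k * ξ.2| ≤ s} ∧
    volume {ξ : ℝ × ℝ | |ξ.2| ≤ h ∧ |ξ.1 + k * ξ.2| ≤ s} = ENNReal.ofReal (2 * s * (2 * h)) := by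
  have hm : MeasurableSet {ξ : ℝ × ℝ | |ξ.2| ≤ h ∧ |ξ.1 + k * ξ.2| ≤ s} := by
    apply MeasurableSet.inter
    · exact measurableSet_le (f := fun ξ : ℝ × ℝ => |ξ.2|) (by fun_prop) measurable_const
    · exact measurableSet_le (f := fun ξ : ℝ × ℝ => |ξ.1 + k * ξ.2|) (by fun_prop)
        measurable_const
  refine ⟨hm, ?_⟩
  rw [Measure.volume_eq_prod, Measure.prod_apply_symm hm]
  have : ∀ y : ℝ, volume ((fun x => (x, y)) ⁻¹' {ξ : ℝ × ℝ | |ξ.2| ≤ h ∧ |ξ.1 + k * ξ.2| ≤ s}) =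
      (Icc (-h) h).indicator (fun _ => ENNReal.ofReal (2 * s)) y := by
    intro y
    by_cases hy : y ∈ Icc (-h) h
    · rw [indicator_of_mem hy]
      have : ((fun x => (x, y)) ⁻¹' {ξ : ℝ × ℝ | |ξ.2| ≤ h ∧ |ξ.1 + k * ξ.2| ≤ s}) =
          Icc (-(k * y) - s) (-(k * y) + s) := by
        ext x
        simp only [mem_preimage, mem_ofPred_eq, abs_le, mem_Icc]
        constructor
        · rintro ⟨_, h1, h2⟩; constructor <;> linarith
        · rintro ⟨h1, h2⟩; exact ⟨⟨hy.1, hy.2⟩, by linarith, by linarith⟩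
      rw [this, Real.volume_Icc]
      congr 1; ring
    · rw [indicator_of_notMem hy]
      have : ((fun x => (x, y)) ⁻¹' {ξ : ℝ × ℝ | |ξ.2| ≤ h ∧ |ξ.1 + k * ξ.2| ≤ s}) = ∅ := by
        ext x
        simp only [mem_preimage, mem_ofPred_eq, abs_le, mem_empty_iff_false, iff_false]
        rintro ⟨h1, _⟩
        exact hy h1
      rw [this, measure_empty]
  simp_rw [this]
  rw [lintegral_indicator measurableSet_Icc, setLIntegral_const, Real.volume_Icc,
    ← ENNReal.ofReal_mul (by positivity)]
  congr 1; ring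

/-- A negative power of the determinant of a positive quadratic form on the plane is bounded by
a moment of the corresponding Gaussian density. -/
theorem det_rpow_neg_le_lintegral {m : ℝ} (hm : 0 ≤ m) {α β δ : ℝ} (hα : 0 < α)
    (hD : 0 < α * δ - β ^ 2) :
    ENNReal.ofReal (Real.exp (-1) * (1 / 4) ^ m * (α * δ - β ^ 2) ^ (-(1 / 2 + m / 2))) ≤
      ∫⁻ ξ : ℝ × ℝ, ENNReal.ofReal ((ξ.1 ^ 2 + ξ.2 ^ 2) ^ m *
        Real.exp (-(α * ξ.1 ^ 2 + 2 * β * ξ.1 * ξ.2 + δ * ξ.2 ^ 2))) := by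
  set D := α * δ - β ^ 2 with hDdef
  -- The half-widths s and h are those for which, after completing the square, each of the two
  -- squares contributes at most 1/2 on the sheared rectangle E, whose area is 2/√D. The square Q of
  -- half-side r has half that area, so E \ Q still has area at least 1/√D, and outside Q one has
  -- |ξ|² ≥ r² = 1/(4√D).
  set s := √(1 / (2 * α)) with hs
  set h := √(α / (2 * D)) with hh
  set r := √(1 / (4 * √D)) with hr
  have hDs : 0 < √D := Real.sqrt_pos.2 hD
  have hs2 : s ^ 2 = 1 / (2 * α) := Real.sq_sqrt (by positivity)
  have hh2 : h ^ 2 = α / (2 * D) := Real.sq_sqrt (by positivity)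
  have hr2 : r ^ 2 = 1 / (4 * √D) := Real.sq_sqrt (by positivity)
  have hsh : s * h = 1 / (2 * √D) := by
    rw [hs, hh, ← Real.sqrt_mul (by positivity)]
    have : 1 / (2 * α) * (α / (2 * D)) = (1 / (2 * √D)) ^ 2 := by
      rw [div_pow, mul_pow, Real.sq_sqrt hD.le]; field_simp
    rw [this, Real.sqrt_sq (by positivity)]
  set E : Set (ℝ × ℝ) := {ξ : ℝ × ℝ | |ξ.2| ≤ h ∧ |ξ.1 + β / α * ξ.2| ≤ s} with hE
  set Q : Set (ℝ × ℝ) := {ξ : ℝ × ℝ | |ξ.2| ≤ r ∧ |ξ.1 + 0 * ξ.2| ≤ r} with hQ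
  obtain ⟨hEm, hEv⟩ := volume_sheared_rectangle (k := β / α) (h := h) (Real.sqrt_nonneg _ : 0 ≤ s)
  obtain ⟨hQm, hQv⟩ := volume_sheared_rectangle (k := 0) (h := r) (Real.sqrt_nonneg _ : 0 ≤ r)
  have hvol : ENNReal.ofReal (1 / √D) ≤ volume (E \ Q) := by
    refine le_trans ?_ (le_measure_sdiff)
    rw [hE, hQ, hEv, hQv, ← ENNReal.ofReal_sub _ (by positivity)]
    apply ENNReal.ofReal_le_ofReal
    have : 2 * s * (2 * h) - 2 * r * (2 * r) = 4 * (s * h) - 4 * r ^ 2 := by ring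
    rw [this, hsh, hr2]
    apply le_of_eq; field_simp; ring
  calc ENNReal.ofReal (Real.exp (-1) * (1 / 4) ^ m * D ^ (-(1 / 2 + m / 2)))
      = ENNReal.ofReal ((r ^ 2) ^ m * Real.exp (-1)) * ENNReal.ofReal (1 / √D) := by
        rw [← ENNReal.ofReal_mul (by positivity)]
        congr 1
        have e1 : D ^ (-(1 / 2 + m / 2)) = (√D)⁻¹ * ((√D)⁻¹) ^ m := by
          rw [neg_add, Real.rpow_add hD, Real.sqrt_eq_rpow, ← Real.rpow_neg hD.le,
            ← Real.rpow_mul hD.le]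
          congr 2; ring
        rw [hr2, e1, one_div (4 * √D), mul_inv, Real.mul_rpow (by positivity) (by positivity)]
        rw [one_div, one_div]; ring
    _ ≤ ENNReal.ofReal ((r ^ 2) ^ m * Real.exp (-1)) * volume (E \ Q) := by gcongr
    _ = ∫⁻ ξ in E \ Q, ENNReal.ofReal ((r ^ 2) ^ m * Real.exp (-1)) := by
        rw [setLIntegral_const]
    _ ≤ ∫⁻ ξ in E \ Q, ENNReal.ofReal ((ξ.1 ^ 2 + ξ.2 ^ 2) ^ m *
        Real.exp (-(α * ξ.1 ^ 2 + 2 * β * ξ.1 * ξ.2 + δ * ξ.2 ^ 2))) := by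
        refine setLIntegral_mono' (hEm.diff hQm) fun ξ hξ => ENNReal.ofReal_le_ofReal ?_
        obtain ⟨⟨h1, h2⟩, h3⟩ := hξ
        have hrn : r ^ 2 ≤ ξ.1 ^ 2 + ξ.2 ^ 2 := by
          by_contra hcon
          push Not at hcon
          apply h3
          constructor
          · exact abs_le_of_sq_le_sq (by nlinarith [sq_nonneg ξ.1]) (Real.sqrt_nonneg _)
          · exact abs_le_of_sq_le_sq (by nlinarith [sq_nonneg ξ.2]) (Real.sqrt_nonneg _)
        have h1' : ξ.2 ^ 2 ≤ α / (2 * D) := by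
          rw [← hh2, ← sq_abs]; gcongr
        have h2' : (ξ.1 + β / α * ξ.2) ^ 2 ≤ 1 / (2 * α) := by
          rw [← hs2, ← sq_abs]; gcongr
        have hq : α * ξ.1 ^ 2 + 2 * β * ξ.1 * ξ.2 + δ * ξ.2 ^ 2 ≤ 1 := by
          have e : α * ξ.1 ^ 2 + 2 * β * ξ.1 * ξ.2 + δ * ξ.2 ^ 2 =
              α * (ξ.1 + β / α * ξ.2) ^ 2 + D / α * ξ.2 ^ 2 := by
            rw [hDdef]; field_simp; ring
          rw [e]
          calc α * (ξ.1 + β / α * ξ.2) ^ 2 + D / α * ξ.2 ^ 2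
              ≤ α * (1 / (2 * α)) + D / α * (α / (2 * D)) := by gcongr
            _ = 1 := by field_simp; norm_num
        gcongr
    _ ≤ _ := setLIntegral_le_lintegral _ _

/-! ### The collision map in coordinates. -/

theorem collide_apply_zero (θ : ℝ) (x : Plane) :
    collide θ x 0 = ((Real.cos θ - 1) * x 0 - Real.sin θ * x 1) / 2 := by
  simp [collide, collisionMatrix, Matrix.toLpLin_apply, dotProduct, Fin.sum_univ_two]
  ring

theorem collide_apply_one (θ : ℝ) (x : Plane) :
    collide θ x 1 = (Real.sin θ * x 0 + (Real.cos θ - 1) * x 1) / 2 := by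
  simp [collide, collisionMatrix, Matrix.toLpLin_apply, dotProduct, Fin.sum_univ_two]
  ring

theorem plane_norm_sq (x : Plane) : ‖x‖ ^ 2 = x 0 ^ 2 + x 1 ^ 2 := by
  rw [EuclideanSpace.norm_sq_eq]; simp [Fin.sum_univ_two]

theorem norm_collide_sq (θ : ℝ) (x : Plane) :
    ‖collide θ x‖ ^ 2 = (1 - Real.cos θ) / 2 * ‖x‖ ^ 2 := by
  rw [plane_norm_sq, plane_norm_sq, collide_apply_zero, collide_apply_one]
  linear_combination (x 0 ^ 2 + x 1 ^ 2) / 4 * (Real.sin_sq_add_cos_sq θ)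

theorem norm_collide_le (θ : ℝ) (x : Plane) : ‖collide θ x‖ ≤ |θ| / 2 * ‖x‖ := by
  apply le_of_sq_le_sq _ (by positivity)
  rw [norm_collide_sq, mul_pow, div_pow, sq_abs]
  have := Real.one_sub_sq_div_two_le_cos (x := θ)
  exact mul_le_mul_of_nonneg_right (by linarith) (sq_nonneg _)

theorem continuous_collide : Continuous fun p : ℝ × Plane => collide p.1 p.2 := by
  refine (PiLp.continuous_toLp 2 (fun _ : Fin 2 => ℝ)).comp
    (f := fun p : ℝ × Plane => ((collide p.1 p.2 : Plane) : Fin 2 → ℝ)) ?_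
  refine continuous_pi fun i => ?_
  fin_cases i
  · simp only [Fin.zero_eta, collide_apply_zero]; fun_prop
  · simp only [Fin.mk_one, collide_apply_one]; fun_prop

/-! ### The singular kernel and the generator on Lipschitz functions. -/

/-- The even extension by zero of the restriction of `b` to `(0, π/2]`. -/
noncomputable def evenKernel (b : ℝ → ℝ) (θ : ℝ) : ℝ :=
  (Ioc 0 (Real.pi / 2)).piecewise b 0 |θ|

section Kernel

variable {ν : ℝ} {b : ℝ → ℝ}

theorem measurable_evenKernel (hb : CrossSection ν b) : Measurable (evenKernel b) :=
  (hb.continuousOn.measurable_piecewise continuousOn_const measurableSet_Ioc).comp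
    continuous_abs.measurable

theorem evenKernel_neg (θ : ℝ) : evenKernel b (-θ) = evenKernel b θ := by
  simp [evenKernel]

theorem evenKernel_of_mem {θ : ℝ} (h : θ ∈ Ioc 0 (Real.pi / 2)) : evenKernel b θ = b θ := by
  rw [evenKernel, abs_of_pos h.1, piecewise_eq_of_mem _ _ _ h]

theorem evenKernel_eq (hb : CrossSection ν b) {θ : ℝ}
    (h : θ ∈ Icc (-(Real.pi / 2)) (Real.pi / 2)) (h0 : θ ≠ 0) : evenKernel b θ = b θ := by
  rcases lt_or_gt_of_ne h0 with h1 | h1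
  · rw [← evenKernel_neg, evenKernel_of_mem ⟨by linarith, by linarith [h.1]⟩, hb.even θ h h0]
  · exact evenKernel_of_mem ⟨h1, h.2⟩

theorem evenKernel_nonneg (hb : CrossSection ν b) (θ : ℝ) : 0 ≤ evenKernel b θ := by
  by_cases h : |θ| ∈ Ioc 0 (Real.pi / 2)
  · rw [evenKernel, piecewise_eq_of_mem _ _ _ h]; exact (hb.pos h).le
  · rw [evenKernel, piecewise_eq_of_notMem _ _ _ h]; rfl

theorem evenKernel_le {C : ℝ} (hC : 0 < C)
    (h : ∀ θ ∈ Ioc 0 (Real.pi / 2), b θ ≤ C * θ ^ (-1 - ν)) (θ : ℝ) :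
    evenKernel b θ ≤ C * |θ| ^ (-1 - ν) := by
  by_cases h' : |θ| ∈ Ioc 0 (Real.pi / 2)
  · rw [evenKernel, piecewise_eq_of_mem _ _ _ h']; exact h _ h'
  · rw [evenKernel, piecewise_eq_of_notMem _ _ _ h']
    simp only [Pi.zero_apply]; positivity

/-- One factor |θ| lowers the singularity to θ^(-ν), integrable because ν < 1. This is why Lipschitz
test functions suffice, without using cancellation between θ and -θ. -/
theorem intervalIntegrable_abs_mul_evenKernel (hν : ν ∈ Ioo (0 : ℝ) 1) (hb : CrossSection ν b)
    (x y : ℝ) : IntervalIntegrable (fun θ => |θ| * evenKernel b θ) volume x y := by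
  obtain ⟨c, C, hc, hcC, h⟩ := hb.bounds
  have hC : 0 < C := hc.trans hcC
  have hpos : ∀ y : ℝ, 0 ≤ y → IntervalIntegrable (fun θ => |θ| * evenKernel b θ) volume 0 y := by
    intro y hy
    have hI : IntervalIntegrable (fun θ : ℝ => C * θ ^ (-ν)) volume 0 y :=
      (intervalIntegral.intervalIntegrable_rpow' (by linarith [hν.2])).const_mul C
    refine hI.mono_fun ?_ ?_
    · exact (measurable_id.abs.mul (measurable_evenKernel hb)).aestronglyMeasurable
    · refine (ae_restrict_mem measurableSet_uIoc).mono fun θ hθ => ?_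
      rw [uIoc_of_le hy] at hθ
      beta_reduce
      rw [Real.norm_of_nonneg (mul_nonneg (abs_nonneg _) (evenKernel_nonneg hb θ)),
        Real.norm_of_nonneg (mul_nonneg hC.le (Real.rpow_nonneg hθ.1.le _))]
      have h1 := evenKernel_le hC (fun θ hθ => (h θ hθ).2) θ
      rw [abs_of_pos hθ.1] at h1 ⊢
      calc θ * evenKernel b θ ≤ θ * (C * θ ^ (-1 - ν)) := by gcongr; exact hθ.1.le
        _ = C * θ ^ (-ν) := by
          have : -ν = 1 + (-1 - ν) := by ring
          rw [this, Real.rpow_add hθ.1, Real.rpow_one]; ring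
  have hall : ∀ y : ℝ, IntervalIntegrable (fun θ => |θ| * evenKernel b θ) volume 0 y := by
    intro y
    rcases le_total 0 y with hy | hy
    · exact hpos y hy
    · have := (IntervalIntegrable.iff_comp_neg).1 (hpos (-y) (by linarith))
      simpa [evenKernel_neg] using this
  exact (hall x).symm.trans (hall y)

end Kernel

/-- The generator `∫ b(θ) |v - w| ^ γ [ψ(v + A(θ)(v - w)) - ψ(v)] dθ` of the Boltzmann equation. -/
noncomputable def generator (γ : ℝ) (b : ℝ → ℝ) (ψ : Plane → ℝ) (v w : Plane) : ℝ :=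
  ∫ θ in (-(Real.pi / 2))..(Real.pi / 2),
    b θ * ‖v - w‖ ^ γ * (ψ (v + collide θ (v - w)) - ψ v)

section Generator

variable {γ ν : ℝ} {b : ℝ → ℝ} {ψ : Plane → ℝ} {K : ℝ≥0}

/-- The values of b at 0 and outside [-π/2, π/2] are arbitrary, so b itself need not be measurable.
Replacing it almost everywhere on the interval by `evenKernel` makes joint measurability available.
-/
theorem generator_eq (hb : CrossSection ν b) (ψ : Plane → ℝ) (v w : Plane) :
    generator γ b ψ v w = ∫ θ in (-(Real.pi / 2))..(Real.pi / 2),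
      evenKernel b θ * ‖v - w‖ ^ γ * (ψ (v + collide θ (v - w)) - ψ v) := by
  apply intervalIntegral.integral_congr_ae
  have : ∀ᵐ θ : ℝ, θ ≠ 0 := by simp [ae_iff, measure_singleton]
  filter_upwards [this] with θ h0 hθ
  rw [uIoc_of_le (by linarith [Real.pi_pos])] at hθ
  rw [evenKernel_eq hb ⟨hθ.1.le, hθ.2⟩ h0]

theorem abs_generator_integrand_le (hb : CrossSection ν b) (hψ : LipschitzWith K ψ)
    (v w : Plane) (θ : ℝ) :
    |evenKernel b θ * ‖v - w‖ ^ γ * (ψ (v + collide θ (v - w)) - ψ v)| ≤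
      K / 2 * ‖v - w‖ ^ γ * ‖v - w‖ * (|θ| * evenKernel b θ) := by
  have h1 := hψ.norm_sub_le (v + collide θ (v - w)) v
  rw [add_sub_cancel_left, Real.norm_eq_abs] at h1
  have h2 := norm_collide_le θ (v - w)
  have h3 := evenKernel_nonneg hb θ
  rw [abs_mul, abs_of_nonneg (by positivity)]
  calc evenKernel b θ * ‖v - w‖ ^ γ * |ψ (v + collide θ (v - w)) - ψ v|
      ≤ evenKernel b θ * ‖v - w‖ ^ γ * (K * (|θ| / 2 * ‖v - w‖)) := by
        gcongr; exact h1.trans (by gcongr)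
    _ = _ := by ring

theorem measurable_generator_integrand (hb : CrossSection ν b) (hψ : Continuous ψ) :
    Measurable fun p : (Plane × Plane) × ℝ => evenKernel b p.2 * ‖p.1.1 - p.1.2‖ ^ γ *
      (ψ (p.1.1 + collide p.2 (p.1.1 - p.1.2)) - ψ p.1.1) := by
  have h1 : Measurable fun p : (Plane × Plane) × ℝ => evenKernel b p.2 :=
    (measurable_evenKernel hb).comp measurable_snd
  have h2 : Measurable fun p : (Plane × Plane) × ℝ => ‖p.1.1 - p.1.2‖ ^ γ := by fun_prop
  have h3 : Continuous fun p : (Plane × Plane) × ℝ => collide p.2 (p.1.1 - p.1.2) :=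
    continuous_collide.comp (f := fun p : (Plane × Plane) × ℝ => (p.2, p.1.1 - p.1.2))
      (by fun_prop)
  have h4 : Continuous fun p : (Plane × Plane) × ℝ =>
      ψ (p.1.1 + collide p.2 (p.1.1 - p.1.2)) - ψ p.1.1 :=
    (hψ.comp ((continuous_fst.comp continuous_fst).add h3)).sub
      (hψ.comp (continuous_fst.comp continuous_fst))
  exact (h1.mul h2).mul h4.measurable

theorem intervalIntegrable_generator_integrand (hν : ν ∈ Ioo (0 : ℝ) 1) (hb : CrossSection ν b)
    (hψ : LipschitzWith K ψ) (v w : Plane) (x y : ℝ) :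
    IntervalIntegrable (fun θ => evenKernel b θ * ‖v - w‖ ^ γ *
      (ψ (v + collide θ (v - w)) - ψ v)) volume x y := by
  refine ((intervalIntegrable_abs_mul_evenKernel hν hb x y).const_mul
    (K / 2 * ‖v - w‖ ^ γ * ‖v - w‖)).mono_fun ?_ ?_
  · exact ((measurable_generator_integrand (γ := γ) hb hψ.continuous).comp
      (measurable_prodMk_left (x := (v, w)))).aestronglyMeasurable
  · refine Filter.Eventually.of_forall fun θ => ?_
    beta_reduce
    rw [Real.norm_eq_abs]
    exact (abs_generator_integrand_le hb hψ v w θ).trans (le_abs_self _)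

theorem stronglyMeasurable_generator (hb : CrossSection ν b) (hψ : Continuous ψ) :
    StronglyMeasurable fun p : Plane × Plane => generator γ b ψ p.1 p.2 := by
  simp_rw [generator_eq hb, intervalIntegral.integral_of_le
    (show -(Real.pi / 2) ≤ Real.pi / 2 by linarith [Real.pi_pos])]
  exact (measurable_generator_integrand hb hψ).stronglyMeasurable.integral_prod_right'

/-- The constant `∫ |θ| b(θ) dθ`. -/
noncomputable def firstMoment (b : ℝ → ℝ) : ℝ :=
  ∫ θ in (-(Real.pi / 2))..(Real.pi / 2), |θ| * evenKernel b θ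

theorem firstMoment_nonneg (hb : CrossSection ν b) : 0 ≤ firstMoment b :=
  intervalIntegral.integral_nonneg (by linarith [Real.pi_pos])
    fun θ _ => mul_nonneg (abs_nonneg _) (evenKernel_nonneg hb θ)

theorem rpow_mul_self_le (hγ : γ ∈ Ioo (0 : ℝ) 1) {r : ℝ} (hr : 0 ≤ r) : r ^ γ * r ≤ 1 + r ^ 2 := by
  rcases le_total r 1 with h | h
  · have := Real.rpow_le_one hr h hγ.1.le
    nlinarith [sq_nonneg r]
  · have := Real.rpow_le_rpow_of_exponent_le h hγ.2.le
    rw [Real.rpow_one] at this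
    nlinarith

theorem abs_generator_le (hγ : γ ∈ Ioo (0 : ℝ) 1) (hν : ν ∈ Ioo (0 : ℝ) 1)
    (hb : CrossSection ν b) (hψ : LipschitzWith K ψ) (v w : Plane) :
    |generator γ b ψ v w| ≤ K * firstMoment b * (1 + 2 * ‖v‖ ^ 2 + 2 * ‖w‖ ^ 2) := by
  have hpi : -(Real.pi / 2) ≤ Real.pi / 2 := by linarith [Real.pi_pos]
  have hM := firstMoment_nonneg hb
  rw [generator_eq hb, ← Real.norm_eq_abs]
  refine (intervalIntegral.norm_integral_le_of_norm_le hpi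
    (Filter.Eventually.of_forall fun θ _ => abs_generator_integrand_le hb hψ v w θ)
    ((intervalIntegrable_abs_mul_evenKernel hν hb _ _).const_mul _)).trans ?_
  rw [intervalIntegral.integral_const_mul]
  change K / 2 * ‖v - w‖ ^ γ * ‖v - w‖ * firstMoment b ≤ _
  have h1 := rpow_mul_self_le hγ (norm_nonneg (v - w))
  have h2 : ‖v - w‖ ^ 2 ≤ 2 * ‖v‖ ^ 2 + 2 * ‖w‖ ^ 2 := by
    have := norm_sub_le v w
    nlinarith [norm_nonneg (v - w), sq_nonneg (‖v‖ - ‖w‖)]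
  have hK : (0 : ℝ) ≤ K := K.2
  calc K / 2 * ‖v - w‖ ^ γ * ‖v - w‖ * firstMoment b
      = K * firstMoment b * ((‖v - w‖ ^ γ * ‖v - w‖) / 2) := by ring
    _ ≤ _ := by
      gcongr
      nlinarith [sq_nonneg ‖v‖, sq_nonneg ‖w‖]

end Generator

/-! ### Lipschitz continuity in time of the moments of a solution. -/

section Solution

variable {γ ν T : ℝ} {b : ℝ → ℝ} {f : ℝ → Measure Plane} {ψ : Plane → ℝ} {K : ℝ≥0}

theorem IsWeakSolution.hasDerivWithinAt (hf : IsWeakSolution γ b T f) (hψ : LipschitzWith K ψ)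
    {t : ℝ} (ht : t ∈ Icc 0 T) :
    HasDerivWithinAt (fun s => ∫ v, ψ v ∂(f s))
      (∫ v, ∫ w, generator γ b ψ v w ∂(f t) ∂(f t)) (Icc 0 T) t :=
  hf.weak ψ ⟨K, hψ⟩ t ht

theorem integrable_energy_prod {μ : Measure Plane} [IsProbabilityMeasure μ]
    (h : Integrable (fun v : Plane => ‖v‖ ^ 2) μ) :
    Integrable (fun p : Plane × Plane => 1 + 2 * ‖p.1‖ ^ 2 + 2 * ‖p.2‖ ^ 2) (μ.prod μ) := by
  have h1 : Integrable (fun p : Plane × Plane => ‖p.1‖ ^ 2) (μ.prod μ) := h.comp_fst μ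
  have h2 : Integrable (fun p : Plane × Plane => ‖p.2‖ ^ 2) (μ.prod μ) := h.comp_snd μ
  exact ((integrable_const 1).add (h1.const_mul 2)).add (h2.const_mul 2)

theorem integral_energy_prod {μ : Measure Plane} [IsProbabilityMeasure μ]
    (h : Integrable (fun v : Plane => ‖v‖ ^ 2) μ) :
    ∫ p : Plane × Plane, (1 + 2 * ‖p.1‖ ^ 2 + 2 * ‖p.2‖ ^ 2) ∂(μ.prod μ) =
      1 + 4 * ∫ v, ‖v‖ ^ 2 ∂μ := by
  have h1 : Integrable (fun p : Plane × Plane => ‖p.1‖ ^ 2) (μ.prod μ) := h.comp_fst μ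
  have h2 : Integrable (fun p : Plane × Plane => ‖p.2‖ ^ 2) (μ.prod μ) := h.comp_snd μ
  have h3 : Integrable (fun p : Plane × Plane => 1 + 2 * ‖p.1‖ ^ 2) (μ.prod μ) :=
    (integrable_const 1).add (h1.const_mul 2)
  rw [integral_add h3 (h2.const_mul 2),
    integral_add (integrable_const 1) (h1.const_mul 2), integral_const_mul, integral_const_mul,
    integral_fun_fst (fun v : Plane => ‖v‖ ^ 2), integral_fun_snd (fun v : Plane => ‖v‖ ^ 2)]
  simp
  ring

theorem integrable_generator {μ : Measure Plane} [IsProbabilityMeasure μ]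
    (hγ : γ ∈ Ioo (0 : ℝ) 1) (hν : ν ∈ Ioo (0 : ℝ) 1)
    (hb : CrossSection ν b) (hψ : LipschitzWith K ψ)
    (h : Integrable (fun v : Plane => ‖v‖ ^ 2) μ) :
    Integrable (fun p : Plane × Plane => generator γ b ψ p.1 p.2) (μ.prod μ) := by
  refine ((integrable_energy_prod h).const_mul (K * firstMoment b)).mono'
    (stronglyMeasurable_generator hb hψ.continuous).aestronglyMeasurable ?_
  exact Filter.Eventually.of_forall fun p => abs_generator_le hγ hν hb hψ p.1 p.2

/-- Mean value inequality: the generator is bounded by an affine function of the two energies, and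
the energy is conserved. The constant depends on the solution only through its initial energy, which
makes all later time scales functions of f₀. -/
theorem IsWeakSolution.abs_sub_le (hf : IsWeakSolution γ b T f) (hγ : γ ∈ Ioo (0 : ℝ) 1)
    (hν : ν ∈ Ioo (0 : ℝ) 1) (hb : CrossSection ν b) (hψ : LipschitzWith K ψ) {s t : ℝ}
    (hs : s ∈ Icc 0 T) (ht : t ∈ Icc 0 T) :
    |(∫ v, ψ v ∂(f s)) - ∫ v, ψ v ∂(f t)| ≤
      K * firstMoment b * (1 + 4 * ∫ v, ‖v‖ ^ 2 ∂(f 0)) * |s - t| := by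
  refine Convex.norm_image_sub_le_of_norm_hasDerivWithin_le
    (fun u hu => hf.hasDerivWithinAt hψ hu) (fun u hu => ?_) (convex_Icc 0 T) ht hs
  have := hf.prob u hu
  have hE := hf.finite_energy u hu
  rw [← integral_prod _ (integrable_generator hγ hν hb hψ hE), ← hf.energy u hu,
    ← integral_energy_prod hE, ← integral_const_mul]
  exact norm_integral_le_of_norm_le ((integrable_energy_prod hE).const_mul _)
    (Filter.Eventually.of_forall fun p => abs_generator_le hγ hν hb hψ p.1 p.2)

end Solution

/-! ### Quantitative convexity of y ↦ √(1 + y²). -/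

theorem sqrt_one_add_sq_tangent (y z : ℝ) :
    √(1 + z ^ 2) + (y - z) * (z / √(1 + z ^ 2)) ≤ √(1 + y ^ 2) := by
  have hA : 0 < √(1 + z ^ 2) := Real.sqrt_pos.2 (by positivity)
  have hA2 : √(1 + z ^ 2) ^ 2 = 1 + z ^ 2 := Real.sq_sqrt (by positivity)
  have hB2 : √(1 + y ^ 2) ^ 2 = 1 + y ^ 2 := Real.sq_sqrt (by positivity)
  have hB : 0 < √(1 + y ^ 2) := Real.sqrt_pos.2 (by positivity)
  have h : 1 + y * z ≤ √(1 + y ^ 2) * √(1 + z ^ 2) := by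
    apply le_of_sq_le_sq _ (by positivity)
    rw [mul_pow, hA2, hB2]
    nlinarith [sq_nonneg (y - z)]
  have : √(1 + z ^ 2) + (y - z) * (z / √(1 + z ^ 2)) = (1 + y * z) / √(1 + z ^ 2) := by
    field_simp; rw [hA2]; ring
  rw [this, div_le_iff₀ hA]
  exact h

/-- With A = √(1+z²) and B = √(1+y²), the tangent defect is (AB - (1+yz))/A, and the identity (AB)²
- (1+yz)² = (y-z)² turns it into a square over bounded denominators. -/
theorem sqrt_one_add_sq_strict_tangent {y z Q s : ℝ} (hs : 0 ≤ s) (hy : |y| ≤ Q) (hz : |z| ≤ Q)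
    (hyz : s ≤ |y - z|) :
    √(1 + z ^ 2) + (y - z) * (z / √(1 + z ^ 2)) + s ^ 2 / (2 * (1 + Q ^ 2) ^ 2) ≤
      √(1 + y ^ 2) := by
  have hA : 0 < √(1 + z ^ 2) := Real.sqrt_pos.2 (by positivity)
  have hA2 : √(1 + z ^ 2) ^ 2 = 1 + z ^ 2 := Real.sq_sqrt (by positivity)
  have hB2 : √(1 + y ^ 2) ^ 2 = 1 + y ^ 2 := Real.sq_sqrt (by positivity)
  have hB : 0 < √(1 + y ^ 2) := Real.sqrt_pos.2 (by positivity)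
  have hy2 : y ^ 2 ≤ Q ^ 2 := by rw [← sq_abs]; gcongr
  have hz2 : z ^ 2 ≤ Q ^ 2 := by rw [← sq_abs z]; gcongr
  have hs2 : s ^ 2 ≤ (y - z) ^ 2 := by rw [← sq_abs (y - z)]; gcongr
  set A := √(1 + z ^ 2)
  set B := √(1 + y ^ 2)
  have hB1 : B ≤ 1 + Q ^ 2 := by nlinarith
  have hid : (A * B) ^ 2 - (1 + y * z) ^ 2 = (y - z) ^ 2 := by
    rw [mul_pow, hA2, hB2]; ring
  have hAB : 0 < A * B := by positivity
  have h1 : |1 + y * z| ≤ A * B := abs_le_of_sq_le_sq (by nlinarith [sq_nonneg (y - z)]) hAB.le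
  have h1' := abs_le.1 h1
  have h2 : s ^ 2 ≤ (A * B - (1 + y * z)) * (2 * (A * B)) := by nlinarith
  have h3 : A * A * B ≤ (1 + Q ^ 2) ^ 2 := by
    calc A * A * B = (1 + z ^ 2) * B := by rw [← hA2]; ring
      _ ≤ (1 + Q ^ 2) * (1 + Q ^ 2) := by gcongr
      _ = _ := by ring
  have h4 : s ^ 2 / (2 * (1 + Q ^ 2) ^ 2) ≤ (A * B - (1 + y * z)) / A := by
    rw [div_le_div_iff₀ (by positivity) hA]
    calc s ^ 2 * A ≤ (A * B - (1 + y * z)) * (2 * (A * B)) * A := by gcongr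
      _ = (A * B - (1 + y * z)) * (2 * (A * A * B)) := by ring
      _ ≤ _ := by
        have : 0 ≤ A * B - (1 + y * z) := by linarith
        gcongr
  have h5 : A + (y - z) * (z / A) + (A * B - (1 + y * z)) / A = B := by
    field_simp; rw [hA2]; ring
  linarith

theorem abs_div_sqrt_le (z : ℝ) : |z / √(1 + z ^ 2)| ≤ min 1 |z| := by
  have hA : 1 ≤ √(1 + z ^ 2) := Real.one_le_sqrt.2 (by nlinarith [sq_nonneg z])
  have hz : |z| ≤ √(1 + z ^ 2) := Real.abs_le_sqrt (by linarith)
  rw [abs_div, abs_of_pos (by linarith : 0 < √(1 + z ^ 2))]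
  refine le_min ?_ (div_le_self (abs_nonneg _) hA)
  rw [div_le_one (by linarith)]; exact hz

/-- Adding the tangent inequalities at y cancels the terms in ±s. Only the drift a costs something,
and it costs nothing on the line y = 0, where the derivative vanishes. -/
theorem sqrt_second_difference_ge (y a s : ℝ) :
    -(2 * |a|) * min 1 |y| ≤
      √(1 + (y - a + s) ^ 2) + √(1 + (y - a - s) ^ 2) - 2 * √(1 + y ^ 2) := by
  have h1 := sqrt_one_add_sq_tangent (y - a + s) y
  have h2 := sqrt_one_add_sq_tangent (y - a - s) y
  have h3 := abs_div_sqrt_le y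
  have h4 : a * (y / √(1 + y ^ 2)) ≤ |a| * min 1 |y| :=
    (le_abs_self _).trans (by rw [abs_mul]; gcongr)
  nlinarith

theorem sqrt_second_difference_ge_strict {y a s Q s₀ : ℝ} (hs₀ : 0 ≤ s₀) (h : s₀ ≤ |s|)
    (h0 : |y - a| ≤ Q) (h1 : |y - a + s| ≤ Q) (h2 : |y - a - s| ≤ Q) :
    -(2 * |a|) * min 1 |y| + s₀ ^ 2 / (1 + Q ^ 2) ^ 2 ≤
      √(1 + (y - a + s) ^ 2) + √(1 + (y - a - s) ^ 2) - 2 * √(1 + y ^ 2) := by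
  have e1 := sqrt_one_add_sq_strict_tangent hs₀ h1 h0 (by simpa using h)
  have e2 := sqrt_one_add_sq_strict_tangent hs₀ h2 h0 (by simpa using h)
  have e3 := sqrt_one_add_sq_tangent (y - a) y
  have h3 := abs_div_sqrt_le y
  have h4 : a * (y / √(1 + y ^ 2)) ≤ |a| * min 1 |y| :=
    (le_abs_self _).trans (by rw [abs_mul]; gcongr)
  have : s₀ ^ 2 / (1 + Q ^ 2) ^ 2 = 2 * (s₀ ^ 2 / (2 * (1 + Q ^ 2) ^ 2)) := by field_simp
  nlinarith

/-! ### Distance to a line and its change under a pair of symmetric collisions. -/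

/-- The affine form `v ↦ ξ · v - c` on the plane, with `ξ = (p, q)`. -/
def affineForm (p q c : ℝ) (v : Plane) : ℝ := p * v 0 + q * v 1 - c

section AffineForm

variable {p q c : ℝ}

theorem abs_dot_le (hpq : p ^ 2 + q ^ 2 = 1) (x : Plane) : |p * x 0 + q * x 1| ≤ ‖x‖ := by
  apply abs_le_of_sq_le_sq _ (norm_nonneg _)
  rw [plane_norm_sq]
  nlinarith [sq_nonneg (p * x 1 - q * x 0)]

theorem abs_cross_le (hpq : p ^ 2 + q ^ 2 = 1) (x : Plane) : |q * x 0 - p * x 1| ≤ ‖x‖ := by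
  have := abs_dot_le (p := q) (q := -p) (by linarith [neg_sq p]) x
  rwa [neg_mul, ← sub_eq_add_neg] at this

theorem affineForm_sub (v w : Plane) :
    affineForm p q c v - affineForm p q c w = p * (v - w) 0 + q * (v - w) 1 := by
  simp [affineForm]; ring

theorem continuous_affineForm : Continuous (affineForm p q c) := by
  unfold affineForm; fun_prop

theorem lipschitzWith_affineForm (hpq : p ^ 2 + q ^ 2 = 1) :
    LipschitzWith 1 (affineForm p q c) :=
  LipschitzWith.of_dist_le_mul fun v w => by
    rw [Real.dist_eq, affineForm_sub, dist_eq_norm]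
    simpa using abs_dot_le hpq (v - w)

theorem lipschitzWith_min_abs_affineForm (hpq : p ^ 2 + q ^ 2 = 1) :
    LipschitzWith 1 fun v => min 1 |affineForm p q c v| := by
  have h1 : LipschitzWith 1 fun v => |affineForm p q c v| := by
    simpa [Function.comp_def] using lipschitzWith_one_norm.comp (lipschitzWith_affineForm hpq)
  exact h1.const_min 1

theorem lipschitzWith_sqrt_one_add_sq : LipschitzWith 1 fun y : ℝ => √(1 + y ^ 2) := by
  refine LipschitzWith.of_dist_le_mul fun y z => ?_
  have key : ∀ y z : ℝ, √(1 + z ^ 2) - √(1 + y ^ 2) ≤ |y - z| := fun y z => by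
    have h := sqrt_one_add_sq_tangent y z
    have h2 := (abs_div_sqrt_le z).trans (min_le_left _ _)
    have h3 : -((y - z) * (z / √(1 + z ^ 2))) ≤ |y - z| := by
      refine (neg_le_abs _).trans ?_
      rw [abs_mul]
      exact mul_le_of_le_one_right (abs_nonneg _) h2
    linarith
  rw [Real.dist_eq, Real.dist_eq, NNReal.coe_one, one_mul, abs_le]
  constructor
  · have := key y z; linarith
  · have := key z y; rw [abs_sub_comm] at this; exact this

/-- The convex function `√(1 + (ξ · v - c)²) - 1` measuring the distance to a line. -/
noncomputable def lineDefect (p q c : ℝ) (v : Plane) : ℝ := √(1 + affineForm p q c v ^ 2) - 1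

theorem lipschitzWith_lineDefect (hpq : p ^ 2 + q ^ 2 = 1) :
    LipschitzWith 1 (lineDefect p q c) := by
  have h := lipschitzWith_sqrt_one_add_sq.comp (lipschitzWith_affineForm (c := c) hpq)
  rw [mul_one] at h
  refine LipschitzWith.of_dist_le_mul fun v w => ?_
  simpa [lineDefect, Real.dist_eq] using h.dist_le_mul v w

theorem affineForm_add_collide (v x : Plane) (θ : ℝ) :
    affineForm p q c (v + collide θ x) = affineForm p q c v -
      (1 - Real.cos θ) / 2 * (p * x 0 + q * x 1) + Real.sin θ / 2 * (q * x 0 - p * x 1) := by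
  simp only [affineForm, PiLp.add_apply, collide_apply_zero, collide_apply_one]
  ring

theorem affineForm_add_collide_neg (v x : Plane) (θ : ℝ) :
    affineForm p q c (v + collide (-θ) x) = affineForm p q c v -
      (1 - Real.cos θ) / 2 * (p * x 0 + q * x 1) - Real.sin θ / 2 * (q * x 0 - p * x 1) := by
  rw [affineForm_add_collide, Real.cos_neg, Real.sin_neg]; ring

theorem two_mul_abs_drift_le (hpq : p ^ 2 + q ^ 2 = 1) (x : Plane) {θ : ℝ} (hθ : |θ| ≤ 2) :
    2 * |(1 - Real.cos θ) / 2 * (p * x 0 + q * x 1)| ≤ |θ| * ‖x‖ := by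
  have h1 := Real.one_sub_sq_div_two_le_cos (x := θ)
  have h2 := Real.cos_le_one θ
  rw [abs_mul, abs_of_nonneg (by linarith : 0 ≤ (1 - Real.cos θ) / 2)]
  have h3 := abs_dot_le hpq x
  have h4 : 1 - Real.cos θ ≤ |θ| := by
    rw [← sq_abs] at h1; nlinarith [abs_nonneg θ]
  calc 2 * ((1 - Real.cos θ) / 2 * |p * x 0 + q * x 1|)
      = (1 - Real.cos θ) * |p * x 0 + q * x 1| := by ring
    _ ≤ _ := by gcongr

/-- The collisions of angles θ and -θ share the drift (1 - cos θ)/2 ξ·x and have opposite transverse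
displacements, so `sqrt_second_difference_ge` applies with the transverse part as s. -/
theorem lineDefect_second_difference (hpq : p ^ 2 + q ^ 2 = 1) (v x : Plane) {θ : ℝ}
    (hθ : |θ| ≤ 2) :
    -(|θ| * ‖x‖) * min 1 |affineForm p q c v| ≤ lineDefect p q c (v + collide θ x) +
      lineDefect p q c (v + collide (-θ) x) - 2 * lineDefect p q c v := by
  have h1 := sqrt_second_difference_ge (affineForm p q c v)
    ((1 - Real.cos θ) / 2 * (p * x 0 + q * x 1)) (Real.sin θ / 2 * (q * x 0 - p * x 1))
  have h2 := two_mul_abs_drift_le hpq x hθ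
  have h3 : 0 ≤ min 1 |affineForm p q c v| := le_min zero_le_one (abs_nonneg _)
  unfold lineDefect
  rw [affineForm_add_collide_neg, affineForm_add_collide]
  have h4 := mul_le_mul_of_nonneg_right h2 h3
  linarith

/-- When the relative velocity x has a component of size at least D/2 along the line, a collision
with sin θ ≥ 1/2 pushes the particle off the line by at least D/8, and strict convexity turns this
into a gain. The range 5D covers |y| ≤ D plus a drift and a transverse displacement of at most 2D
each. -/
theorem lineDefect_second_difference_strict (hpq : p ^ 2 + q ^ 2 = 1) {v x : Plane} {D : ℝ}
    (hD : 0 < D) (hv : |affineForm p q c v| ≤ D) (hx : ‖x‖ ≤ 2 * D)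
    (hx' : D / 2 ≤ |q * x 0 - p * x 1|) {θ : ℝ}
    (hθ : θ ∈ Icc (Real.pi / 4) (Real.pi / 3)) :
    -(|θ| * ‖x‖) * min 1 |affineForm p q c v| + (D / 8) ^ 2 / (1 + (5 * D) ^ 2) ^ 2 ≤
      lineDefect p q c (v + collide θ x) +
      lineDefect p q c (v + collide (-θ) x) - 2 * lineDefect p q c v := by
  have hpi := Real.pi_pos
  have hpi4 := Real.pi_le_four
  have hθ2 : |θ| ≤ 2 := by
    rw [abs_of_nonneg (by linarith [hθ.1])]; linarith [hθ.2]
  have hsin : 1 / 2 ≤ Real.sin θ := by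
    rw [← Real.sin_pi_div_six]
    apply Real.sin_le_sin_of_le_of_le_pi_div_two <;> linarith [hθ.1, hθ.2]
  have hsin1 := Real.sin_le_one θ
  set a := (1 - Real.cos θ) / 2 * (p * x 0 + q * x 1) with ha
  set s := Real.sin θ / 2 * (q * x 0 - p * x 1) with hs
  have h2 := two_mul_abs_drift_le hpq x hθ2
  have hs0 : D / 8 ≤ |s| := by
    rw [hs, abs_mul, abs_of_pos (by linarith)]
    calc D / 8 = 1 / 4 * (D / 2) := by ring
      _ ≤ _ := mul_le_mul (by linarith) hx' (by positivity) (by linarith)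
  have hs1 : |s| ≤ 2 * D := by
    rw [hs, abs_mul, abs_of_pos (by linarith)]
    have := abs_cross_le hpq x
    calc Real.sin θ / 2 * |q * x 0 - p * x 1| ≤ 1 * (2 * D) := by gcongr <;> linarith
      _ = _ := by ring
  have ha1 : |a| ≤ 2 * D := by
    nlinarith [norm_nonneg x]
  have ha2 := abs_le.1 ha1
  have hs2 := abs_le.1 hs1
  have hv2 := abs_le.1 hv
  have h1 := sqrt_second_difference_ge_strict (y := affineForm p q c v) (a := a) (s := s) (Q := 5 * D)
    (by positivity : 0 ≤ D / 8) hs0 (abs_le.2 ⟨by linarith, by linarith⟩)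
    (abs_le.2 ⟨by linarith, by linarith⟩) (abs_le.2 ⟨by linarith, by linarith⟩)
  have h3 : 0 ≤ min 1 |affineForm p q c v| := le_min zero_le_one (abs_nonneg _)
  unfold lineDefect
  rw [affineForm_add_collide_neg, affineForm_add_collide]
  have h4 := mul_le_mul_of_nonneg_right h2 h3
  linarith

end AffineForm

/-- The Lipschitz bump `v ↦ max 0 (1 - |v - a| / r)`. -/
noncomputable def tent (a : Plane) (r : ℝ) (v : Plane) : ℝ := max 0 (1 - ‖v - a‖ / r)

theorem tent_nonneg (a : Plane) (r : ℝ) (v : Plane) : 0 ≤ tent a r v := le_max_left _ _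

theorem tent_le_one (a : Plane) {r : ℝ} (hr : 0 < r) (v : Plane) : tent a r v ≤ 1 := by
  refine max_le zero_le_one ?_
  have : 0 ≤ ‖v - a‖ / r := by positivity
  linarith

theorem tent_eq_zero (a : Plane) {r : ℝ} (hr : 0 < r) {v : Plane} (h : r ≤ ‖v - a‖) :
    tent a r v = 0 := by
  refine max_eq_left ?_
  have : 1 ≤ ‖v - a‖ / r := by rwa [le_div_iff₀ hr, one_mul]
  linarith

theorem lipschitzWith_tent (a : Plane) {r : ℝ} (hr : 0 < r) :
    LipschitzWith (Real.toNNReal (1 / r)) (tent a r) := by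
  have h : LipschitzWith (Real.toNNReal (1 / r)) fun v : Plane => 1 - ‖v - a‖ / r := by
    refine LipschitzWith.of_dist_le_mul fun v w => ?_
    rw [Real.dist_eq, dist_eq_norm, Real.coe_toNNReal _ (by positivity)]
    have e : 1 - ‖v - a‖ / r - (1 - ‖w - a‖ / r) = 1 / r * (‖w - a‖ - ‖v - a‖) := by ring
    rw [e, abs_mul, abs_of_pos (by positivity)]
    gcongr
    have := abs_norm_sub_norm_le (w - a) (v - a)
    rwa [sub_sub_sub_cancel_right, norm_sub_rev w v] at this
  exact h.const_max 0

theorem half_indicator_le_tent (a : Plane) {r : ℝ} (hr : 0 < r) (v : Plane) :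
    (Metric.ball a (r / 2)).indicator (fun _ => (1 / 2 : ℝ)) v ≤ tent a r v := by
  by_cases h : v ∈ Metric.ball a (r / 2)
  · rw [indicator_of_mem h]
    rw [Metric.mem_ball, dist_eq_norm] at h
    refine le_max_of_le_right ?_
    have : ‖v - a‖ / r ≤ 1 / 2 := by rw [div_le_iff₀ hr]; linarith
    linarith
  · rw [indicator_of_notMem h]; exact tent_nonneg a r v

/-! ### Lower bound for the generator on the distance to a line. -/

section

variable {γ ν : ℝ} {b : ℝ → ℝ} {p q c : ℝ}

theorem half_firstMoment (hν : ν ∈ Ioo (0 : ℝ) 1) (hb : CrossSection ν b) :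
    ∫ θ in Ioc 0 (Real.pi / 2), |θ| * evenKernel b θ ≤ firstMoment b := by
  unfold firstMoment
  rw [intervalIntegral.integral_of_le (by linarith [Real.pi_pos])]
  apply setIntegral_mono_set
  · have := intervalIntegrable_abs_mul_evenKernel hν hb (-(Real.pi / 2)) (Real.pi / 2)
    rwa [intervalIntegrable_iff_integrableOn_Ioc_of_le (by linarith [Real.pi_pos])] at this
  · exact Filter.Eventually.of_forall fun θ => mul_nonneg (abs_nonneg _) (evenKernel_nonneg hb θ)
  · exact (Ioc_subset_Ioc_left (by linarith [Real.pi_pos])).eventuallyLE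

theorem generator_symm (hν : ν ∈ Ioo (0 : ℝ) 1) (hb : CrossSection ν b) {ψ : Plane → ℝ} {K : ℝ≥0}
    (hψ : LipschitzWith K ψ) (v w : Plane) :
    IntegrableOn (fun θ => evenKernel b θ * ‖v - w‖ ^ γ *
      (ψ (v + collide θ (v - w)) + ψ (v + collide (-θ) (v - w)) - 2 * ψ v))
      (Ioc 0 (Real.pi / 2)) ∧
    generator γ b ψ v w = ∫ θ in Ioc 0 (Real.pi / 2), evenKernel b θ * ‖v - w‖ ^ γ *
      (ψ (v + collide θ (v - w)) + ψ (v + collide (-θ) (v - w)) - 2 * ψ v) := by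
  have hpi : 0 ≤ Real.pi / 2 := by positivity
  set F : ℝ → ℝ := fun θ => evenKernel b θ * ‖v - w‖ ^ γ *
    (ψ (v + collide θ (v - w)) - ψ v) with hF
  have h1 : ∀ x y, IntervalIntegrable F volume x y := fun x y =>
    intervalIntegrable_generator_integrand hν hb hψ v w x y
  have h2 : IntervalIntegrable (fun θ => F (-θ)) volume 0 (Real.pi / 2) := by
    have := (IntervalIntegrable.iff_comp_neg).1 (h1 0 (-(Real.pi / 2)))
    simpa using this
  have e : (fun θ => evenKernel b θ * ‖v - w‖ ^ γ *
      (ψ (v + collide θ (v - w)) + ψ (v + collide (-θ) (v - w)) - 2 * ψ v)) =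
      fun θ => F θ + F (-θ) := by
    funext θ; simp only [hF, evenKernel_neg]; ring
  rw [e]
  constructor
  · exact (intervalIntegrable_iff_integrableOn_Ioc_of_le hpi).1 ((h1 _ _).add h2)
  · rw [generator_eq hb, ← intervalIntegral.integral_of_le hpi,
      intervalIntegral.integral_add (h1 _ _) h2, intervalIntegral.integral_comp_neg,
      neg_zero, add_comm, intervalIntegral.integral_add_adjacent_intervals (h1 _ _) (h1 _ _)]

theorem evenKernel_mass_pos (hb : CrossSection ν b) :
    IntegrableOn (evenKernel b) (Icc (Real.pi / 4) (Real.pi / 3)) ∧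
    0 < ∫ θ in Icc (Real.pi / 4) (Real.pi / 3), evenKernel b θ := by
  have hpi := Real.pi_pos
  have hsub : ∀ θ ∈ Icc (Real.pi / 4) (Real.pi / 3), θ ∈ Ioc 0 (Real.pi / 2) :=
    fun θ hθ => ⟨by linarith [hθ.1], by linarith [hθ.2]⟩
  have hi : IntervalIntegrable b volume (Real.pi / 4) (Real.pi / 3) :=
    hb.intervalIntegrable (by positivity) (by linarith) (by linarith)
  have hi' : IntegrableOn b (Icc (Real.pi / 4) (Real.pi / 3)) := by
    rw [integrableOn_Icc_iff_integrableOn_Ioc]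
    exact (intervalIntegrable_iff_integrableOn_Ioc_of_le (by linarith)).1 hi
  constructor
  · exact hi'.congr_fun (fun θ hθ => (evenKernel_of_mem (hsub θ hθ)).symm) measurableSet_Icc
  · rw [setIntegral_congr_fun measurableSet_Icc (fun θ hθ => evenKernel_of_mem (hsub θ hθ)),
      integral_Icc_eq_integral_Ioc, ← intervalIntegral.integral_of_le (by linarith)]
    exact intervalIntegral.intervalIntegral_pos_of_pos_on hi
      (fun θ hθ => hb.pos (hsub θ ⟨hθ.1.le, hθ.2.le⟩)) (by linarith)

/-- Pairs (v, w) close to two distinct points of the line have relative velocity almost parallel to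
it and give the strict gain. All pairs pay at most the drift error, which contains the truncated
distance of v to the line and is therefore small while f_t is close to the line. -/
theorem exists_generator_lineDefect_ge (hν : ν ∈ Ioo (0 : ℝ) 1)
    (hb : CrossSection ν b) (hpq : p ^ 2 + q ^ 2 = 1) {a₁ a₂ : Plane} (ha : a₁ ≠ a₂)
    (h₁ : affineForm p q c a₁ = 0) (h₂ : affineForm p q c a₂ = 0) (hγ : 0 < γ) :
    ∃ κ : ℝ, 0 < κ ∧ ∀ v w,
      κ * (tent a₁ (‖a₁ - a₂‖ / 8) v * tent a₂ (‖a₁ - a₂‖ / 8) w) -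
        firstMoment b * (‖v - w‖ ^ γ * ‖v - w‖ * min 1 |affineForm p q c v|) ≤
      generator γ b (lineDefect p q c) v w := by
  have hpi := Real.pi_pos
  set D := ‖a₁ - a₂‖ with hDdef
  have hD : 0 < D := norm_pos_iff.2 (sub_ne_zero.2 ha)
  obtain ⟨hBi, hB⟩ := evenKernel_mass_pos hb
  set B := ∫ θ in Icc (Real.pi / 4) (Real.pi / 3), evenKernel b θ
  set κ₀ := (D / 8) ^ 2 / (1 + (5 * D) ^ 2) ^ 2
  have hκ₀ : 0 < κ₀ := by positivity
  refine ⟨(D / 2) ^ γ * κ₀ * B, by positivity, fun v w => ?_⟩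
  set x := v - w with hx
  set m := min 1 |affineForm p q c v| with hm
  have hm0 : 0 ≤ m := le_min zero_le_one (abs_nonneg _)
  set τ := tent a₁ (D / 8) v * tent a₂ (D / 8) w with hτ
  have hτ0 : 0 ≤ τ := mul_nonneg (tent_nonneg _ _ _) (tent_nonneg _ _ _)
  have hτ1 : τ ≤ 1 := mul_le_one₀ (tent_le_one _ (by positivity) _) (tent_nonneg _ _ _)
    (tent_le_one _ (by positivity) _)
  obtain ⟨hgi, hge⟩ := generator_symm (γ := γ) hν hb (lipschitzWith_lineDefect (c := c) hpq) v w
  rw [hge]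
  -- Pointwise minorant of the symmetrized integrand: the gain is kept only for angles in [π/4,
  -- π/3], away from the singularity of the kernel, and the drift error for all angles.
  set L : ℝ → ℝ := fun θ => (Icc (Real.pi / 4) (Real.pi / 3)).indicator
    (fun θ => (D / 2) ^ γ * κ₀ * τ * evenKernel b θ) θ -
      ‖x‖ ^ γ * ‖x‖ * m * (|θ| * evenKernel b θ) with hL
  have hi1 : IntegrableOn (fun θ => |θ| * evenKernel b θ) (Ioc 0 (Real.pi / 2)) :=
    (intervalIntegrable_iff_integrableOn_Ioc_of_le (by positivity)).1
      (intervalIntegrable_abs_mul_evenKernel hν hb _ _)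
  have hi2 : Integrable ((Icc (Real.pi / 4) (Real.pi / 3)).indicator
      (fun θ => (D / 2) ^ γ * κ₀ * τ * evenKernel b θ)) :=
    (IntegrableOn.integrable_indicator (hBi.const_mul _) measurableSet_Icc)
  have hsub : Ioc 0 (Real.pi / 2) ∩ Icc (Real.pi / 4) (Real.pi / 3) =
      Icc (Real.pi / 4) (Real.pi / 3) :=
    inter_eq_right.2 fun θ hθ => ⟨by linarith [hθ.1], by linarith [hθ.2]⟩
  have hLint : ∫ θ in Ioc 0 (Real.pi / 2), L θ = (D / 2) ^ γ * κ₀ * τ * B -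
      ‖x‖ ^ γ * ‖x‖ * m * ∫ θ in Ioc 0 (Real.pi / 2), |θ| * evenKernel b θ := by
    rw [hL, integral_sub hi2.integrableOn (hi1.const_mul _),
      setIntegral_indicator measurableSet_Icc, hsub, integral_const_mul, integral_const_mul]
  have hle : (D / 2) ^ γ * κ₀ * B * τ - firstMoment b * (‖x‖ ^ γ * ‖x‖ * m) ≤
      ∫ θ in Ioc 0 (Real.pi / 2), L θ := by
    rw [hLint]
    have := mul_le_mul_of_nonneg_left (half_firstMoment hν hb)
      (show 0 ≤ ‖x‖ ^ γ * ‖x‖ * m by positivity)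
    nlinarith
  refine hle.trans (setIntegral_mono_on (hi2.integrableOn.sub (hi1.const_mul _)) hgi
    measurableSet_Ioc fun θ hθ => ?_)
  have hθ2 : |θ| ≤ 2 := by
    rw [abs_of_pos hθ.1]; linarith [hθ.2, Real.pi_le_four]
  have hk := evenKernel_nonneg hb θ
  have hxg : 0 ≤ ‖x‖ ^ γ := by positivity
  simp only [hL]
  by_cases hmem : θ ∈ Icc (Real.pi / 4) (Real.pi / 3) ∧ 0 < τ
  · obtain ⟨hmem, hτp⟩ := hmem
    rw [indicator_of_mem hmem]
    have hv : ‖v - a₁‖ < D / 8 := by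
      by_contra hcon
      push Not at hcon
      rw [hτ, tent_eq_zero a₁ (by positivity) hcon, zero_mul] at hτp
      exact lt_irrefl _ hτp
    have hw : ‖w - a₂‖ < D / 8 := by
      by_contra hcon
      push Not at hcon
      rw [hτ, tent_eq_zero a₂ (by positivity) hcon, mul_zero] at hτp
      exact lt_irrefl _ hτp
    have hxa : ‖x - (a₁ - a₂)‖ ≤ D / 4 := by
      have : x - (a₁ - a₂) = (v - a₁) - (w - a₂) := by rw [hx]; abel
      rw [this]
      exact (norm_sub_le _ _).trans (by linarith)
    have hx1 : ‖x‖ ≤ 2 * D := by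
      have := norm_le_norm_add_norm_sub (a₁ - a₂) x
      rw [norm_sub_rev _ x] at this
      linarith
    have hcr : |q * (a₁ - a₂) 0 - p * (a₁ - a₂) 1| = D := by
      have h0 : p * (a₁ - a₂) 0 + q * (a₁ - a₂) 1 = 0 := by
        rw [← affineForm_sub (c := c), h₁, h₂, sub_zero]
      rw [← abs_of_pos hD, ← sq_eq_sq_iff_abs_eq_abs, hDdef, plane_norm_sq]
      linear_combination ((a₁ - a₂) 0 ^ 2 + (a₁ - a₂) 1 ^ 2) * hpq -
        (p * (a₁ - a₂) 0 + q * (a₁ - a₂) 1) * h0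
    have hx2 : D / 2 ≤ |q * x 0 - p * x 1| := by
      have h5 := abs_cross_le hpq (x - (a₁ - a₂))
      have h6 : q * (x - (a₁ - a₂)) 0 - p * (x - (a₁ - a₂)) 1 =
          (q * x 0 - p * x 1) - (q * (a₁ - a₂) 0 - p * (a₁ - a₂) 1) := by
        simp only [PiLp.sub_apply]; ring
      rw [h6] at h5
      have h7 := abs_sub_abs_le_abs_sub (q * (a₁ - a₂) 0 - p * (a₁ - a₂) 1) (q * x 0 - p * x 1)
      rw [hcr, abs_sub_comm (q * (a₁ - a₂) 0 - p * (a₁ - a₂) 1)] at h7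
      linarith
    have hx3 : D / 2 ≤ ‖x‖ := hx2.trans (abs_cross_le hpq x)
    have hv1 : |affineForm p q c v| ≤ D := by
      have := abs_dot_le hpq (v - a₁)
      rw [← affineForm_sub (c := c), h₁, sub_zero] at this
      linarith
    have key := lineDefect_second_difference_strict (c := c) hpq hD hv1 hx1 hx2 hmem
    have hpow : (D / 2) ^ γ ≤ ‖x‖ ^ γ := Real.rpow_le_rpow (by positivity) hx3 hγ.le
    calc (D / 2) ^ γ * κ₀ * τ * evenKernel b θ - ‖x‖ ^ γ * ‖x‖ * m * (|θ| * evenKernel b θ)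
        ≤ ‖x‖ ^ γ * κ₀ * 1 * evenKernel b θ - ‖x‖ ^ γ * ‖x‖ * m * (|θ| * evenKernel b θ) := by
          gcongr
      _ = evenKernel b θ * ‖x‖ ^ γ * (-(|θ| * ‖x‖) * m + κ₀) := by ring
      _ ≤ _ := by gcongr
  · have hz : (Icc (Real.pi / 4) (Real.pi / 3)).indicator
        (fun θ => (D / 2) ^ γ * κ₀ * τ * evenKernel b θ) θ = 0 := by
      by_cases h : θ ∈ Icc (Real.pi / 4) (Real.pi / 3)
      · have : τ = 0 := le_antisymm (not_lt.1 fun h' => hmem ⟨h, h'⟩) hτ0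
        rw [this]; simp
      · exact indicator_of_notMem h _
    rw [hz]
    have key := lineDefect_second_difference (c := c) hpq v x hθ2
    calc 0 - ‖x‖ ^ γ * ‖x‖ * m * (|θ| * evenKernel b θ)
        = evenKernel b θ * ‖x‖ ^ γ * (-(|θ| * ‖x‖) * m) := by ring
      _ ≤ _ := by gcongr

end

/-! ### Truncated distances to lines and points of the support. -/

theorem measurable_min_abs_affineForm (p q c : ℝ) :
    Measurable fun v => min 1 |affineForm p q c v| :=
  (measurable_const.min continuous_affineForm.measurable.abs)

theorem min_abs_nonneg (y : ℝ) : 0 ≤ min 1 |y| := le_min zero_le_one (abs_nonneg _)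

theorem integrable_min_abs_affineForm (μ : Measure Plane) [IsProbabilityMeasure μ] (p q c : ℝ) :
    Integrable (fun v => min 1 |affineForm p q c v|) μ := by
  refine (integrable_const (1 : ℝ)).mono'
    (measurable_min_abs_affineForm p q c).aestronglyMeasurable
    (Filter.Eventually.of_forall fun v => ?_)
  rw [Real.norm_of_nonneg (min_abs_nonneg _)]
  exact min_le_left _ _

theorem integrable_norm_of_sq {μ : Measure Plane} [IsProbabilityMeasure μ]
    (h : Integrable (fun v : Plane => ‖v‖ ^ 2) μ) : Integrable (fun v : Plane => ‖v‖) μ := by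
  refine ((integrable_const (1 : ℝ)).add h).mono' continuous_norm.aestronglyMeasurable
    (Filter.Eventually.of_forall fun v => ?_)
  rw [norm_norm, Pi.add_apply]
  nlinarith [sq_nonneg (‖v‖ - 1), norm_nonneg v]

theorem exists_ne_forall_ball_pos {μ : Measure Plane} [IsProbabilityMeasure μ]
    (hμ : ∀ a, μ ≠ Measure.dirac a) :
    ∃ a₁ a₂ : Plane, a₁ ≠ a₂ ∧ (∀ r, 0 < r → 0 < μ (Metric.ball a₁ r)) ∧
      ∀ r, 0 < r → 0 < μ (Metric.ball a₂ r) := by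
  have hmem : ∀ a ∈ μ.support, ∀ r, 0 < r → 0 < μ (Metric.ball a r) := fun a ha r hr =>
    Measure.mem_support_iff_forall a |>.1 ha _ (Metric.ball_mem_nhds a hr)
  obtain ⟨a, ha⟩ := Measure.nonempty_support (IsProbabilityMeasure.ne_zero μ)
  by_cases h : ∃ a' ∈ μ.support, a ≠ a'
  · obtain ⟨a', ha', hne⟩ := h
    exact ⟨a, a', hne, hmem a ha, hmem a' ha'⟩
  · push Not at h
    exfalso
    refine hμ a ?_
    have hae : ∀ᵐ v ∂μ, v = a := by
      filter_upwards [Measure.support_mem_ae (μ := μ)] with v hv using (h v hv).symm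
    ext s hs
    rw [Measure.dirac_apply' _ hs]
    by_cases has : a ∈ s
    · rw [indicator_of_mem has, Pi.one_apply]
      refine (prob_compl_eq_zero_iff hs).1 (measure_mono_null ?_ hae)
      exact fun v hv (hva : v = a) => hv (hva ▸ has)
    · rw [indicator_of_notMem has]
      refine measure_mono_null ?_ hae
      intro v hv (hva : v = a)
      exact has (hva ▸ hv)

theorem affineForm_eq_zero_of_support {μ : Measure Plane} {p q c : ℝ}
    (hline : ∀ᵐ v ∂μ, affineForm p q c v = 0) {a : Plane}
    (ha : ∀ r, 0 < r → 0 < μ (Metric.ball a r)) : affineForm p q c a = 0 := by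
  by_contra h
  obtain ⟨r, hr, hball⟩ := Metric.mem_nhds_iff.1
    ((continuous_affineForm (p := p) (q := q) (c := c)).continuousAt.eventually_ne h)
  exact (ha r hr).ne' (measure_mono_null (fun v hv => hball hv) hline)

/-! ### Mass away from lines, with constants depending on the initial law only. -/

section Uniform

variable {γ ν : ℝ} {b : ℝ → ℝ}

/-- The Lipschitz constant in time of the integrals of `1`-Lipschitz functions. -/
noncomputable def speed (b : ℝ → ℝ) (μ : Measure Plane) : ℝ :=
  firstMoment b * (1 + 4 * ∫ v, ‖v‖ ^ 2 ∂μ)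

theorem speed_nonneg (hb : CrossSection ν b) (μ : Measure Plane) : 0 ≤ speed b μ :=
  mul_nonneg (firstMoment_nonneg hb)
    (by have := integral_nonneg (μ := μ) (f := fun v : Plane => ‖v‖ ^ 2)
          (fun v => by positivity)
        linarith)

theorem IsWeakSolution.abs_sub_le_speed {T : ℝ} {f : ℝ → Measure Plane}
    (hf : IsWeakSolution γ b T f) (hγ : γ ∈ Ioo (0 : ℝ) 1)
    (hν : ν ∈ Ioo (0 : ℝ) 1) (hb : CrossSection ν b) {ψ : Plane → ℝ} {K : ℝ≥0}
    (hψ : LipschitzWith K ψ) {s t : ℝ} (hs : s ∈ Icc 0 T) (ht : t ∈ Icc 0 T) :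
    |(∫ v, ψ v ∂(f s)) - ∫ v, ψ v ∂(f t)| ≤ K * speed b (f 0) * |s - t| := by
  have := hf.abs_sub_le hγ hν hb hψ hs ht
  rwa [mul_assoc (K : ℝ)] at this

/-- A lower bound at one time for the mass away from lines propagates to a time interval. -/
theorem exists_window_of_time (hγ : γ ∈ Ioo (0 : ℝ) 1) (hν : ν ∈ Ioo (0 : ℝ) 1)
    (hb : CrossSection ν b) {μ : Measure Plane} {t₀ s₁ κ : ℝ} (hs₁ : 0 ≤ s₁) (hst : s₁ < t₀)
    (hκ : 0 < κ)
    (h : ∀ (T : ℝ) (f : ℝ → Measure Plane), IsWeakSolution γ b T f → f 0 = μ → s₁ ≤ T →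
      ∀ p q c : ℝ, p ^ 2 + q ^ 2 = 1 → κ ≤ ∫ v, min 1 |affineForm p q c v| ∂(f s₁)) :
    ∃ s₁ s₂ κ : ℝ, 0 ≤ s₁ ∧ s₁ < s₂ ∧ s₂ ≤ t₀ ∧ 0 < κ ∧
      ∀ (T : ℝ) (f : ℝ → Measure Plane), IsWeakSolution γ b T f → f 0 = μ → s₂ ≤ T →
      ∀ s ∈ Icc s₁ s₂, ∀ p q c : ℝ, p ^ 2 + q ^ 2 = 1 →
        κ ≤ ∫ v, min 1 |affineForm p q c v| ∂(f s) := by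
  have hK := speed_nonneg hb μ
  set K := speed b μ
  set ℓ := min (t₀ - s₁) (κ / (2 * (K + 1))) with hℓ
  have hℓ0 : 0 < ℓ := lt_min (by linarith) (by positivity)
  have hℓ1 : ℓ ≤ t₀ - s₁ := min_le_left _ _
  refine ⟨s₁, s₁ + ℓ, κ / 2, hs₁, by linarith, by linarith, by positivity, ?_⟩
  intro T f hf hf0 hT s hs p q c hpq
  have h1 := h T f hf hf0 (by linarith) p q c hpq
  have h2 := hf.abs_sub_le_speed hγ hν hb (lipschitzWith_min_abs_affineForm (c := c) hpq)
    (s := s) (t := s₁) ⟨by linarith [hs.1], by linarith [hs.2]⟩ ⟨hs₁, by linarith⟩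
  rw [hf0, abs_of_nonneg (sub_nonneg.2 hs.1), NNReal.coe_one, one_mul] at h2
  have h3 : K * (s - s₁) ≤ κ / 2 := by
    calc K * (s - s₁) ≤ (K + 1) * (κ / (2 * (K + 1))) := by
          have : s - s₁ ≤ κ / (2 * (K + 1)) := by
            linarith [hs.2, min_le_right (t₀ - s₁) (κ / (2 * (K + 1)))]
          apply mul_le_mul _ this (sub_nonneg.2 hs.1) (by linarith)
          linarith
      _ = κ / 2 := by field_simp
  have h4 := (abs_le.1 h2).1
  linarith

theorem one_sub_le_min_abs_affineForm {p q c R : ℝ} (hpq : p ^ 2 + q ^ 2 = 1) (hR : 0 < R)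
    (hc : R + 1 < |c|) (v : Plane) : 1 - ‖v‖ ^ 2 / R ^ 2 ≤ min 1 |affineForm p q c v| := by
  by_cases hv : ‖v‖ ≤ R
  · have h1 := abs_dot_le hpq v
    have h2 : 1 ≤ |affineForm p q c v| := by
      have h3 := abs_sub_abs_le_abs_sub c (p * v 0 + q * v 1)
      rw [abs_sub_comm] at h3
      unfold affineForm
      linarith
    rw [min_eq_left h2]
    have : 0 ≤ ‖v‖ ^ 2 / R ^ 2 := by positivity
    linarith
  · push Not at hv
    refine le_trans ?_ (min_abs_nonneg _)
    have : 1 ≤ ‖v‖ ^ 2 / R ^ 2 := by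
      rw [le_div_iff₀ (by positivity), one_mul]; exact pow_le_pow_left₀ hR.le hv.le 2
    linarith

/-- The integral is continuous in (p, q, c) and positive, hence bounded below on the compact set of
lines with |c| ≤ R + 1. A line farther away misses a ball which carries at least half of the mass by
Chebyshev. -/
theorem exists_mass_off_lines {μ : Measure Plane} [IsProbabilityMeasure μ]
    (hE : Integrable (fun v : Plane => ‖v‖ ^ 2) μ)
    (h : ∀ p q c : ℝ, p ^ 2 + q ^ 2 = 1 → ¬ ∀ᵐ v ∂μ, affineForm p q c v = 0) :
    ∃ κ : ℝ, 0 < κ ∧ ∀ p q c : ℝ, p ^ 2 + q ^ 2 = 1 →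
      κ ≤ ∫ v, min 1 |affineForm p q c v| ∂μ := by
  set E := ∫ v, ‖v‖ ^ 2 ∂μ with hEdef
  have hE0 : 0 ≤ E := integral_nonneg fun v => by positivity
  -- Chosen so that E/R² ≤ 1/2, with R positive even when E = 0.
  set R := √(2 * E + 1) with hR
  have hR2 : R ^ 2 = 2 * E + 1 := Real.sq_sqrt (by positivity)
  have hR0 : 0 ≤ R := Real.sqrt_nonneg _
  have hcont : Continuous fun x : ℝ × ℝ × ℝ =>
      ∫ v, min 1 |affineForm x.1 x.2.1 x.2.2 v| ∂μ := by
    refine continuous_of_dominated (bound := fun _ => 1) (fun x =>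
      (measurable_min_abs_affineForm _ _ _).aestronglyMeasurable) (fun x => ?_)
      (integrable_const _) (Filter.Eventually.of_forall fun v => ?_)
    · refine Filter.Eventually.of_forall fun v => ?_
      rw [Real.norm_of_nonneg (min_abs_nonneg _)]
      exact min_le_left _ _
    · unfold affineForm; fun_prop
  have hclosed : IsClosed {x : ℝ × ℝ × ℝ | x.1 ^ 2 + x.2.1 ^ 2 = 1} :=
    isClosed_eq (by fun_prop) continuous_const
  have hcomp : IsCompact ((Icc (-1) 1 ×ˢ Icc (-1) 1 ×ˢ Icc (-(R + 1)) (R + 1)) ∩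
      {x : ℝ × ℝ × ℝ | x.1 ^ 2 + x.2.1 ^ 2 = 1}) :=
    (isCompact_Icc.prod (isCompact_Icc.prod isCompact_Icc)).inter_right hclosed
  have hmem : ((1, 0, 0) : ℝ × ℝ × ℝ) ∈
      (Icc (-1) 1 ×ˢ Icc (-1) 1 ×ˢ Icc (-(R + 1)) (R + 1) : Set (ℝ × ℝ × ℝ)) ∩
        {x : ℝ × ℝ × ℝ | x.1 ^ 2 + x.2.1 ^ 2 = 1} := by
    refine ⟨⟨⟨by norm_num, le_rfl⟩, ⟨by norm_num, by norm_num⟩, ⟨?_, ?_⟩⟩, ?_⟩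
    · change -(R + 1) ≤ 0; linarith
    · change 0 ≤ R + 1; linarith
    · change (1 : ℝ) ^ 2 + 0 ^ 2 = 1; norm_num
  obtain ⟨x, hx, hmin⟩ := hcomp.exists_isMinOn ⟨_, hmem⟩ hcont.continuousOn
  have hpos : 0 < ∫ v, min 1 |affineForm x.1 x.2.1 x.2.2 v| ∂μ := by
    refine lt_of_le_of_ne (integral_nonneg fun v => min_abs_nonneg _) fun h0 => ?_
    rw [eq_comm, integral_eq_zero_iff_of_nonneg (fun v => min_abs_nonneg _)
      (integrable_min_abs_affineForm μ _ _ _)] at h0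
    refine h x.1 x.2.1 x.2.2 hx.2 ?_
    filter_upwards [h0] with v hv
    by_contra hne
    have : 0 < min 1 |affineForm x.1 x.2.1 x.2.2 v| := lt_min one_pos (abs_pos.2 hne)
    exact this.ne' hv
  refine ⟨min (1 / 2) (∫ v, min 1 |affineForm x.1 x.2.1 x.2.2 v| ∂μ),
    lt_min (by norm_num) hpos, fun p q c hpq => ?_⟩
  by_cases hc : |c| ≤ R + 1
  · refine (min_le_right _ _).trans ?_
    have := hmin (a := (p, q, c)) ⟨⟨abs_le.1 (abs_le_of_sq_le_sq (by nlinarith) zero_le_one),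
      abs_le.1 (abs_le_of_sq_le_sq (by nlinarith) zero_le_one), abs_le.1 hc⟩, hpq⟩
    exact this
  · push Not at hc
    refine (min_le_left _ _).trans ?_
    have hRp : 0 < R := Real.sqrt_pos.2 (by positivity)
    have hlow : ∫ v, (1 - ‖v‖ ^ 2 / R ^ 2) ∂μ ≤ ∫ v, min 1 |affineForm p q c v| ∂μ := by
      refine integral_mono ((integrable_const _).sub (hE.div_const _))
        (integrable_min_abs_affineForm μ _ _ _) fun v => ?_
      exact one_sub_le_min_abs_affineForm hpq hRp hc v
    refine le_trans ?_ hlow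
    rw [integral_sub (integrable_const _) (hE.div_const _), integral_div, ← hEdef, hR2]
    simp only [integral_const, probReal_univ, smul_eq_mul, mul_one]
    have : E / (2 * E + 1) ≤ 1 / 2 := by rw [div_le_div_iff₀ (by positivity) (by norm_num)]; linarith
    linarith

/-- Splitting at r = M separates the drift error into a part proportional to the truncated distance
m and an energy tail. The tail coefficient M^(γ-1) tends to 0 because γ < 1. -/
theorem rpow_mul_self_mul_le (hγ : γ ∈ Ioo (0 : ℝ) 1) {r m M : ℝ} (hr : 0 ≤ r) (hm : 0 ≤ m)
    (hm1 : m ≤ 1) (hM : 1 ≤ M) : r ^ γ * r * m ≤ M ^ 2 * m + M ^ (γ - 1) * r ^ 2 := by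
  have hM0 : 0 < M := by linarith
  rcases le_total r M with h | h
  · have h1 : r ^ γ ≤ M := by
      calc r ^ γ ≤ M ^ γ := Real.rpow_le_rpow hr h hγ.1.le
        _ ≤ M ^ (1 : ℝ) := Real.rpow_le_rpow_of_exponent_le hM hγ.2.le
        _ = M := Real.rpow_one M
    have h2 : r ^ γ * r ≤ M ^ 2 := by
      rw [sq]; exact mul_le_mul h1 h hr hM0.le
    have h3 : 0 ≤ M ^ (γ - 1) * r ^ 2 := by positivity
    nlinarith
  · have hr0 : 0 < r := hM0.trans_le h
    have h1 : r ^ (γ - 1) ≤ M ^ (γ - 1) :=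
      Real.rpow_le_rpow_of_nonpos hM0 h (by linarith [hγ.2])
    have h2 : r ^ γ * r = r ^ (γ - 1) * r ^ 2 := by
      rw [← Real.rpow_natCast r 2, ← Real.rpow_add hr0]
      nth_rewrite 2 [← Real.rpow_one r]
      rw [← Real.rpow_add hr0]
      congr 1; push_cast; ring
    rw [h2]
    have h3 : 0 ≤ M ^ 2 * m := by positivity
    have h4 : r ^ (γ - 1) * r ^ 2 * m ≤ r ^ (γ - 1) * r ^ 2 :=
      mul_le_of_le_one_right (by positivity) hm1
    have h5 : r ^ (γ - 1) * r ^ 2 ≤ M ^ (γ - 1) * r ^ 2 := by gcongr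
    linarith

theorem integral_tent_pos {μ : Measure Plane} [IsProbabilityMeasure μ] {a : Plane}
    (ha : ∀ r, 0 < r → 0 < μ (Metric.ball a r)) {r : ℝ} (hr : 0 < r) :
    0 < ∫ v, tent a r v ∂μ := by
  have hi : Integrable (tent a r) μ := by
    refine (integrable_const (1 : ℝ)).mono' (lipschitzWith_tent a hr).continuous.aestronglyMeasurable
      (Filter.Eventually.of_forall fun v => ?_)
    rw [Real.norm_of_nonneg (tent_nonneg _ _ _)]
    exact tent_le_one a hr v
  refine lt_of_lt_of_le ?_ (integral_mono
    ((integrable_const (1 / 2 : ℝ)).indicator Metric.isOpen_ball.measurableSet) hi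
    (half_indicator_le_tent a hr))
  rw [integral_indicator Metric.isOpen_ball.measurableSet, setIntegral_const, smul_eq_mul]
  have : 0 < μ.real (Metric.ball a (r / 2)) :=
    ENNReal.toReal_pos (ha _ (by positivity)).ne' (measure_ne_top _ _)
  positivity

/-- If the initial condition is carried by a line, the solution leaves this line at a positive
speed. -/
theorem exists_lineDefect_growth (hγ : γ ∈ Ioo (0 : ℝ) 1) (hν : ν ∈ Ioo (0 : ℝ) 1)
    (hb : CrossSection ν b) {μ : Measure Plane} [IsProbabilityMeasure μ]
    {p q c : ℝ} (hpq : p ^ 2 + q ^ 2 = 1)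
    (hline : ∀ᵐ v ∂μ, affineForm p q c v = 0) {a₁ a₂ : Plane} (ha : a₁ ≠ a₂)
    (ha₁ : ∀ r, 0 < r → 0 < μ (Metric.ball a₁ r)) (ha₂ : ∀ r, 0 < r → 0 < μ (Metric.ball a₂ r)) :
    ∃ β u : ℝ, 0 < β ∧ 0 < u ∧ ∀ (T : ℝ) (f : ℝ → Measure Plane), IsWeakSolution γ b T f →
      f 0 = μ → ∀ s ∈ Icc 0 T, s ≤ u → β * s ≤ ∫ v, lineDefect p q c v ∂(f s) := by
  obtain ⟨κ, hκ, hgen⟩ := exists_generator_lineDefect_ge hν hb hpq ha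
    (affineForm_eq_zero_of_support hline ha₁) (affineForm_eq_zero_of_support hline ha₂) hγ.1
  have hD : 0 < ‖a₁ - a₂‖ := norm_pos_iff.2 (sub_ne_zero.2 ha)
  set r := ‖a₁ - a₂‖ / 8 with hr
  have hr0 : 0 < r := by positivity
  have hm₁ := integral_tent_pos ha₁ hr0
  have hm₂ := integral_tent_pos ha₂ hr0
  set m₁ := ∫ v, tent a₁ r v ∂μ
  set m₂ := ∫ v, tent a₂ r v ∂μ
  have hK := speed_nonneg hb μ
  set K := speed b μ with hKdef
  have hF := firstMoment_nonneg hb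
  set F := firstMoment b
  set E := ∫ v, ‖v‖ ^ 2 ∂μ with hE
  have hE0 : 0 ≤ E := integral_nonneg fun v => by positivity
  -- If each tent keeps at least half of its initial mass, the gain is at least κ(m₁/2)(m₂/2) = 2β.
  -- The energy tail and the distance term will each cost at most β/2, leaving β.
  set β := κ * (m₁ * m₂) / 8 with hβ
  have hβ0 : 0 < β := by positivity
  -- choice of the truncation level
  obtain ⟨M, hM1, hM⟩ : ∃ M : ℝ, 1 ≤ M ∧ F * (M ^ (γ - 1) * (1 + 4 * E)) ≤ β / 2 := by
    have ht : Filter.Tendsto (fun M : ℝ => F * (M ^ (γ - 1) * (1 + 4 * E))) Filter.atTop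
        (nhds (F * (0 * (1 + 4 * E)))) := by
      have : Filter.Tendsto (fun M : ℝ => M ^ (γ - 1)) Filter.atTop (nhds 0) := by
        have := tendsto_rpow_neg_atTop (y := 1 - γ) (by linarith [hγ.2])
        simpa using this
      exact (this.mul_const _).const_mul _
    have hev := ht.eventually (gt_mem_nhds (show F * (0 * (1 + 4 * E)) < β / 2 by
      rw [zero_mul, mul_zero]; positivity))
    obtain ⟨M, hM⟩ := (hev.and (Filter.eventually_ge_atTop 1)).exists
    exact ⟨M, hM.2, hM.1.le⟩
  -- The first bound preserves half of the tent masses, whose Lipschitz constant is 1/r; the second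
  -- keeps F M² K t ≤ β/2, where K t bounds the mean truncated distance to the initial line.
  set u := min (r * min m₁ m₂ / (2 * (K + 1))) (β / (2 * (F * M ^ 2 * K + 1))) with hu
  have hu0 : 0 < u := by
    have : 0 < min m₁ m₂ := lt_min hm₁ hm₂
    refine lt_min (by positivity) (by positivity)
  refine ⟨β, u, hβ0, hu0, fun T f hf hf0 s hs hsu => ?_⟩
  have hT : 0 ≤ T := hs.1.trans hs.2
  have h0T : (0 : ℝ) ∈ Icc 0 T := ⟨le_rfl, hT⟩
  have hderiv : ∀ t ∈ Ioo 0 s, β ≤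
      ∫ v, ∫ w, generator γ b (lineDefect p q c) v w ∂(f t) ∂(f t) := by
    intro t ht
    have htT : t ∈ Icc 0 T := ⟨ht.1.le, ht.2.le.trans hs.2⟩
    have htu : t ≤ u := ht.2.le.trans hsu
    have hprob := hf.prob t htT
    have hEt := hf.finite_energy t htT
    have hgi := integrable_generator hγ hν hb (lipschitzWith_lineDefect (c := c) hpq) hEt
    rw [← integral_prod _ hgi]
    have htent : ∀ a : Plane, ∀ m, m = ∫ v, tent a r v ∂μ → min m₁ m₂ ≤ m → 0 < m →
        m / 2 ≤ ∫ v, tent a r v ∂(f t) := by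
      intro a m hm hmm hm0
      have h1 := hf.abs_sub_le_speed hγ hν hb (lipschitzWith_tent a hr0) htT h0T
      rw [hf0, ← hm, ← hKdef, sub_zero, abs_of_pos ht.1, Real.coe_toNNReal _ (by positivity)] at h1
      have h2 : 1 / r * K * t ≤ m / 2 := by
        calc 1 / r * K * t ≤ 1 / r * (K + 1) * (r * m / (2 * (K + 1))) := by
              refine mul_le_mul (mul_le_mul_of_nonneg_left (by linarith) (by positivity))
                (htu.trans ((min_le_left _ _).trans ?_)) ht.1.le (by positivity)
              exact div_le_div_of_nonneg_right (mul_le_mul_of_nonneg_left hmm hr0.le)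
                (by positivity)
          _ = m / 2 := by field_simp
      linarith [(abs_le.1 h1).1]
    have ht₁ := htent a₁ m₁ rfl (min_le_left _ _) hm₁
    have ht₂ := htent a₂ m₂ rfl (min_le_right _ _) hm₂
    have hoff : ∫ v, min 1 |affineForm p q c v| ∂(f t) ≤ K * t := by
      have h1 := hf.abs_sub_le_speed hγ hν hb
        (lipschitzWith_min_abs_affineForm (c := c) hpq) htT h0T
      have h2 : ∫ v, min 1 |affineForm p q c v| ∂μ = 0 := by
        rw [integral_eq_zero_iff_of_nonneg (fun v => min_abs_nonneg _)
          (integrable_min_abs_affineForm μ _ _ _)]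
        filter_upwards [hline] with v hv
        simp [hv]
      rw [hf0, h2, sub_zero, sub_zero, abs_of_pos ht.1, NNReal.coe_one, one_mul] at h1
      exact (le_abs_self _).trans h1
    have htenti : ∀ a : Plane, Integrable (tent a r) (f t) := by
      intro a
      refine (integrable_const (1 : ℝ)).mono'
        (lipschitzWith_tent a hr0).continuous.aestronglyMeasurable
        (Filter.Eventually.of_forall fun v => ?_)
      rw [Real.norm_of_nonneg (tent_nonneg _ _ _)]
      exact tent_le_one a hr0 v
    have hi1 : Integrable (fun x : Plane × Plane => tent a₁ r x.1 * tent a₂ r x.2)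
        ((f t).prod (f t)) := (htenti a₁).mul_prod (htenti a₂)
    have hi2 : Integrable (fun x : Plane × Plane => min 1 |affineForm p q c x.1|)
        ((f t).prod (f t)) :=
      (integrable_min_abs_affineForm (f t) p q c).comp_fst (f t)
    have hi3 := integrable_energy_prod hEt
    have hlow : ∫ x : Plane × Plane, (κ * (tent a₁ r x.1 * tent a₂ r x.2) -
        (F * M ^ 2 * min 1 |affineForm p q c x.1| +
          F * M ^ (γ - 1) * (1 + 2 * ‖x.1‖ ^ 2 + 2 * ‖x.2‖ ^ 2))) ∂((f t).prod (f t)) ≤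
        ∫ x : Plane × Plane, generator γ b (lineDefect p q c) x.1 x.2 ∂((f t).prod (f t)) := by
      refine integral_mono ((hi1.const_mul _).sub ((hi2.const_mul _).add (hi3.const_mul _))) hgi
        fun x => ?_
      refine le_trans ?_ (hgen x.1 x.2)
      have h1 := rpow_mul_self_mul_le hγ (norm_nonneg (x.1 - x.2))
        (min_abs_nonneg (affineForm p q c x.1)) (min_le_left _ _) hM1
      have h2 : ‖x.1 - x.2‖ ^ 2 ≤ 1 + 2 * ‖x.1‖ ^ 2 + 2 * ‖x.2‖ ^ 2 := by
        have := norm_sub_le x.1 x.2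
        nlinarith [norm_nonneg (x.1 - x.2), sq_nonneg (‖x.1‖ - ‖x.2‖)]
      have h3 : M ^ (γ - 1) * ‖x.1 - x.2‖ ^ 2 ≤
          M ^ (γ - 1) * (1 + 2 * ‖x.1‖ ^ 2 + 2 * ‖x.2‖ ^ 2) := by gcongr
      have h4 := mul_le_mul_of_nonneg_left (h1.trans (add_le_add_right h3 _)) hF
      beta_reduce
      linarith
    refine le_trans ?_ hlow
    have hi4 : Integrable (fun x : Plane × Plane => κ * (tent a₁ r x.1 * tent a₂ r x.2))
        ((f t).prod (f t)) := hi1.const_mul _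
    have hi5 : Integrable (fun x : Plane × Plane => F * M ^ 2 * min 1 |affineForm p q c x.1|)
        ((f t).prod (f t)) := hi2.const_mul _
    have hi6 : Integrable (fun x : Plane × Plane =>
        F * M ^ (γ - 1) * (1 + 2 * ‖x.1‖ ^ 2 + 2 * ‖x.2‖ ^ 2)) ((f t).prod (f t)) :=
      hi3.const_mul _
    have hsum : Integrable (fun x : Plane × Plane => F * M ^ 2 * min 1 |affineForm p q c x.1| +
        F * M ^ (γ - 1) * (1 + 2 * ‖x.1‖ ^ 2 + 2 * ‖x.2‖ ^ 2)) ((f t).prod (f t)) := hi5.add hi6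
    rw [integral_sub hi4 hsum, integral_add hi5 hi6, integral_const_mul,
      integral_const_mul, integral_const_mul, integral_prod_mul, integral_energy_prod hEt,
      integral_fun_fst (fun v : Plane => min 1 |affineForm p q c v|), hf.energy t htT, hf0]
    simp only [probReal_univ, smul_eq_mul, one_mul]
    have hprodle : m₁ / 2 * (m₂ / 2) ≤ (∫ v, tent a₁ r v ∂(f t)) * ∫ v, tent a₂ r v ∂(f t) := by
      exact mul_le_mul ht₁ ht₂ (by positivity) (integral_nonneg fun v => tent_nonneg _ _ _)
    have hterm1 : κ * (m₁ / 2 * (m₂ / 2)) ≤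
        κ * ((∫ v, tent a₁ r v ∂(f t)) * ∫ v, tent a₂ r v ∂(f t)) := by gcongr
    have hterm2 : F * M ^ 2 * (∫ v, min 1 |affineForm p q c v| ∂(f t)) ≤ β / 2 := by
      calc F * M ^ 2 * (∫ v, min 1 |affineForm p q c v| ∂(f t)) ≤ F * M ^ 2 * (K * t) := by gcongr
        _ = F * M ^ 2 * K * t := by ring
        _ ≤ (F * M ^ 2 * K + 1) * (β / (2 * (F * M ^ 2 * K + 1))) := by
            apply mul_le_mul _ (htu.trans (min_le_right _ _)) ht.1.le (by positivity)
            linarith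
        _ = β / 2 := by field_simp
    have e1 : κ * (m₁ / 2 * (m₂ / 2)) = 2 * β := by rw [hβ]; ring
    have e2 : F * M ^ (γ - 1) * (1 + 4 * E) = F * (M ^ (γ - 1) * (1 + 4 * E)) := by ring
    linarith
  have hD' : ∀ t ∈ Icc 0 T, HasDerivWithinAt (fun s => ∫ v, lineDefect p q c v ∂(f s))
      (∫ v, ∫ w, generator γ b (lineDefect p q c) v w ∂(f t) ∂(f t)) (Icc 0 T) t :=
    fun t ht => hf.hasDerivWithinAt (lipschitzWith_lineDefect (c := c) hpq) ht
  have hat : ∀ t ∈ Ioo 0 s, HasDerivAt (fun s => ∫ v, lineDefect p q c v ∂(f s))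
      (∫ v, ∫ w, generator γ b (lineDefect p q c) v w ∂(f t) ∂(f t)) t := fun t ht =>
    (hD' t ⟨ht.1.le, ht.2.le.trans hs.2⟩).hasDerivAt (Icc_mem_nhds ht.1 (ht.2.trans_le hs.2))
  have hmain := (convex_Icc 0 s).mul_sub_le_image_sub_of_le_deriv (C := β)
    (f := fun s => ∫ v, lineDefect p q c v ∂(f s))
    (fun t ht => ((hD' t ⟨ht.1, ht.2.trans hs.2⟩).continuousWithinAt).mono
      (Icc_subset_Icc_right hs.2))
    (by rw [interior_Icc]
        exact fun t ht => (hat t ht).differentiableAt.differentiableWithinAt)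
    (by rw [interior_Icc]; exact fun t ht => by rw [(hat t ht).deriv]; exact hderiv t ht)
    0 ⟨le_rfl, hs.1⟩ s ⟨hs.1, le_rfl⟩ hs.1
  have hzero : ∫ v, lineDefect p q c v ∂(f 0) = 0 := by
    rw [hf0]
    have : lineDefect p q c =ᵐ[μ] fun _ => 0 := by
      filter_upwards [hline] with v hv
      simp [lineDefect, hv]
    rw [integral_congr_ae this, integral_zero]
  simp only [hzero, sub_zero] at hmain
  exact hmain

end Uniform

/-! ### Leaving the initial line prevents concentration near every line. -/

theorem lineDefect_le_abs (p q c : ℝ) (v : Plane) : lineDefect p q c v ≤ |affineForm p q c v| := by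
  unfold lineDefect
  rw [sub_le_iff_le_add, Real.sqrt_le_left (by positivity)]
  nlinarith [sq_abs (affineForm p q c v), abs_nonneg (affineForm p q c v)]

theorem lineDefect_le_sq (p q c : ℝ) (v : Plane) : lineDefect p q c v ≤ affineForm p q c v ^ 2 := by
  unfold lineDefect
  rw [sub_le_iff_le_add, Real.sqrt_le_left (by positivity)]
  nlinarith [sq_nonneg (affineForm p q c v)]

/-- Some point of the ball that lies on the line does no worse than the average. It produces, near
each chosen point of the support, an exact point of the first line where the second form is small.
-/
theorem exists_mem_ball_min_abs_le {μ : Measure Plane} [IsProbabilityMeasure μ] {p q c : ℝ}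
    (hline : ∀ᵐ v ∂μ, affineForm p q c v = 0) {a : Plane} {r : ℝ}
    (ha : 0 < μ (Metric.ball a r)) (p' q' c' : ℝ) :
    ∃ v ∈ Metric.ball a r, affineForm p q c v = 0 ∧
      μ.real (Metric.ball a r) * min 1 |affineForm p' q' c' v| ≤
        ∫ v, min 1 |affineForm p' q' c' v| ∂μ := by
  set s := Metric.ball a r ∩ {v | affineForm p q c v = 0} with hs
  have hms : μ s = μ (Metric.ball a r) := by
    apply measure_congr
    filter_upwards [hline] with v hv
    apply propext
    exact ⟨fun h => h.1, fun h => ⟨h, hv⟩⟩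
  have hi := integrable_min_abs_affineForm μ p' q' c'
  obtain ⟨v, hv, hle⟩ := exists_le_setAverage (μ := μ) (s := s) (by rw [hms]; exact ha.ne')
    (measure_ne_top _ _) hi.integrableOn
  refine ⟨v, hv.1, hv.2, ?_⟩
  have hreal : μ.real s = μ.real (Metric.ball a r) := by simp [Measure.real, hms]
  have hpos : 0 < μ.real (Metric.ball a r) := ENNReal.toReal_pos ha.ne' (measure_ne_top _ _)
  rw [setAverage_eq, hreal, smul_eq_mul] at hle
  calc μ.real (Metric.ball a r) * min 1 |affineForm p' q' c' v|
      ≤ μ.real (Metric.ball a r) * ((μ.real (Metric.ball a r))⁻¹ *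
          ∫ v in s, min 1 |affineForm p' q' c' v| ∂μ) := by gcongr
    _ = ∫ v in s, min 1 |affineForm p' q' c' v| ∂μ := by field_simp
    _ ≤ _ := setIntegral_le_integral hi (Filter.Eventually.of_forall fun v => min_abs_nonneg _)

/-- If an affine form is small at two distant points of a line, then it is close to a multiple of
the form defining this line. -/
theorem abs_affineForm_le_of_small {p q c p' q' c' D A e : ℝ} (hpq : p ^ 2 + q ^ 2 = 1)
    (hpq' : p' ^ 2 + q' ^ 2 = 1) {v₁ v₂ : Plane} (h₁ : affineForm p q c v₁ = 0)
    (h₂ : affineForm p q c v₂ = 0) (hD : 0 < D) (hd : D / 2 ≤ ‖v₂ - v₁‖) (hA : ‖v₁‖ ≤ A)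
    (he₁ : |affineForm p' q' c' v₁| ≤ e) (he₂ : |affineForm p' q' c' v₂| ≤ e)
    (heD : 4 * e / D ≤ 1 / 2) (v : Plane) :
    |affineForm p q c v| ≤ 2 * |affineForm p' q' c' v| +
      2 * (1 + 4 * (1 + A) / D) * e * (1 + ‖v‖) := by
  have he0 : 0 ≤ e := (abs_nonneg _).trans he₁
  have hA0 : 0 ≤ A := (norm_nonneg _).trans hA
  set d := v₂ - v₁ with hd'
  have hd0 : p * d 0 + q * d 1 = 0 := by
    rw [hd', ← affineForm_sub (c := c), h₁, h₂, sub_zero]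
  have hd1 : p' * d 0 + q' * d 1 = affineForm p' q' c' v₂ - affineForm p' q' c' v₁ := by
    rw [hd', ← affineForm_sub (c := c')]
  -- Sine (τ) and cosine (σ) of the angle between the two unit normals. The second form varies by at
  -- most 2e between two points of the first line at distance at least D/2, so |τ| ≤ 4e/D and σ is
  -- bounded away from 0.
  set τ := q' * p - p' * q with hτ
  set σ := p' * p + q' * q with hσ
  have hcross : |p * d 1 - q * d 0| = ‖d‖ := by
    rw [← abs_of_nonneg (norm_nonneg d), ← sq_eq_sq_iff_abs_eq_abs, plane_norm_sq]
    linear_combination (d 0 ^ 2 + d 1 ^ 2) * hpq - (p * d 0 + q * d 1) * hd0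
  have hτd : τ * (p * d 1 - q * d 0) = p' * d 0 + q' * d 1 := by
    rw [hτ]
    linear_combination (p' * d 0 + q' * d 1) * hpq - (p * p' + q * q') * hd0
  have hτ1 : |τ| ≤ 4 * e / D := by
    rw [le_div_iff₀ hD]
    have h5 : |τ| * ‖d‖ ≤ 2 * e := by
      rw [← hcross, ← abs_mul, hτd, hd1]
      exact (abs_sub _ _).trans (by linarith)
    nlinarith [abs_nonneg τ]
  have hστ : σ ^ 2 + τ ^ 2 = 1 := by
    rw [hσ, hτ]; linear_combination hpq' + (p' ^ 2 + q' ^ 2) * hpq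
  have hσ1 : 1 / 2 ≤ |σ| := by
    have : |τ| ≤ 1 / 2 := hτ1.trans heD
    have h6 : τ ^ 2 ≤ 1 / 4 := by rw [← sq_abs]; nlinarith [abs_nonneg τ]
    by_contra hcon
    push Not at hcon
    have : σ ^ 2 < 1 / 4 := by rw [← sq_abs]; nlinarith [abs_nonneg σ]
    linarith
  have hdecomp : σ * affineForm p q c v = affineForm p' q' c' v - affineForm p' q' c' v₁ -
      τ * (p * (v - v₁) 1 - q * (v - v₁) 0) := by
    rw [affineForm_sub]
    have h7 : affineForm p q c v = p * (v - v₁) 0 + q * (v - v₁) 1 := by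
      rw [← affineForm_sub (c := c), h₁, sub_zero]
    rw [h7, hσ, hτ]
    linear_combination (p' * (v - v₁) 0 + q' * (v - v₁) 1) * hpq
  have hcr2 : |p * (v - v₁) 1 - q * (v - v₁) 0| ≤ ‖v‖ + A := by
    rw [abs_sub_comm]
    exact (abs_cross_le hpq _).trans ((norm_sub_le _ _).trans (by linarith))
  have h8 : |σ| * |affineForm p q c v| ≤ |affineForm p' q' c' v| + e + 4 * e / D * (‖v‖ + A) := by
    rw [← abs_mul, hdecomp]
    refine (abs_sub _ _).trans (add_le_add ((abs_sub _ _).trans (by linarith)) ?_)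
    rw [abs_mul]
    exact mul_le_mul hτ1 hcr2 (abs_nonneg _) ((abs_nonneg _).trans hτ1)
  have h9 : 1 / 2 * |affineForm p q c v| ≤ |σ| * |affineForm p q c v| := by gcongr
  have h10 : e + 4 * e / D * (‖v‖ + A) ≤ (1 + 4 * (1 + A) / D) * e * (1 + ‖v‖) := by
    have e1 : (1 + 4 * (1 + A) / D) * e * (1 + ‖v‖) =
        e + 4 * e / D * (‖v‖ + A) + (e * ‖v‖ + 4 * e / D * (1 + A * ‖v‖)) := by
      field_simp; ring
    have : 0 ≤ e * ‖v‖ + 4 * e / D * (1 + A * ‖v‖) := by positivity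
    linarith
  linarith

/-- The quadratic bound on the defect is used where the second form is at most 1, and the linear
bound together with 1 + |v| ≤ M + (1 + |v|)²/M elsewhere. What matters is that B enters only through
its square. -/
theorem lineDefect_le_of_abs_le {p q c p' q' c' B M : ℝ} (hpq : p ^ 2 + q ^ 2 = 1) (hM : 0 < M)
    {v : Plane} (h : |affineForm p q c v| ≤ 2 * |affineForm p' q' c' v| + B * (1 + ‖v‖)) :
    lineDefect p q c v ≤ (8 + (1 + |c|) * M) * min 1 |affineForm p' q' c' v| +
      ((1 + |c|) / M + 2 * B ^ 2) * (1 + ‖v‖) ^ 2 := by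
  have hc := abs_nonneg c
  set y := |affineForm p' q' c' v| with hy
  have hy0 : 0 ≤ y := abs_nonneg _
  rcases le_total y 1 with h1 | h1
  · rw [min_eq_right h1]
    have h2 := lineDefect_le_sq p q c v
    have h3 : affineForm p q c v ^ 2 ≤ 8 * y ^ 2 + 2 * (B * (1 + ‖v‖)) ^ 2 := by
      rw [← sq_abs]
      calc |affineForm p q c v| ^ 2 ≤ (2 * y + B * (1 + ‖v‖)) ^ 2 := by gcongr
        _ ≤ _ := by nlinarith [sq_nonneg (2 * y - B * (1 + ‖v‖))]
    have h4 : y ^ 2 ≤ y := by nlinarith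
    have h5 : 0 ≤ (1 + |c|) * M * y := by positivity
    have h6 : 0 ≤ (1 + |c|) / M * (1 + ‖v‖) ^ 2 := by positivity
    nlinarith
  · rw [min_eq_left h1]
    have h2 := lineDefect_le_abs p q c v
    have h3 : |affineForm p q c v| ≤ (1 + |c|) * (1 + ‖v‖) := by
      have h4 := abs_dot_le hpq v
      have h5 := abs_sub (p * v 0 + q * v 1) c
      unfold affineForm
      nlinarith [norm_nonneg v]
    have h6 : 1 + ‖v‖ ≤ M + (1 + ‖v‖) ^ 2 / M := by
      have : M + (1 + ‖v‖) ^ 2 / M - (1 + ‖v‖) =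
          ((M - (1 + ‖v‖) / 2) ^ 2 + 3 / 4 * (1 + ‖v‖) ^ 2) / M := by field_simp; ring
      have h7 : 0 ≤ ((M - (1 + ‖v‖) / 2) ^ 2 + 3 / 4 * (1 + ‖v‖) ^ 2) / M := by positivity
      linarith
    have h8 : (1 + |c|) * (1 + ‖v‖) ≤ (1 + |c|) * (M + (1 + ‖v‖) ^ 2 / M) := by gcongr
    have h9 : 0 ≤ 2 * B ^ 2 * (1 + ‖v‖) ^ 2 := by positivity
    have h10 : (1 + |c|) * (M + (1 + ‖v‖) ^ 2 / M) =
      (1 + |c|) * M + (1 + |c|) / M * (1 + ‖v‖) ^ 2 := by field_simp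
    linarith

section

variable {γ ν : ℝ} {b : ℝ → ℝ}

theorem integral_one_add_norm_sq_le {μ : Measure Plane} [IsProbabilityMeasure μ]
    (h : Integrable (fun v : Plane => ‖v‖ ^ 2) μ) :
    Integrable (fun v : Plane => (1 + ‖v‖) ^ 2) μ ∧
    ∫ v, (1 + ‖v‖) ^ 2 ∂μ ≤ 2 * (1 + ∫ v, ‖v‖ ^ 2 ∂μ) := by
  have h1 : Integrable (fun v : Plane => 2 * (1 + ‖v‖ ^ 2)) μ :=
    ((integrable_const (1 : ℝ)).add h).const_mul 2
  have h2 : ∀ v : Plane, (1 + ‖v‖) ^ 2 ≤ 2 * (1 + ‖v‖ ^ 2) := fun v => by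
    nlinarith [sq_nonneg (1 - ‖v‖)]
  have h3 : Integrable (fun v : Plane => (1 + ‖v‖) ^ 2) μ := by
    refine h1.mono' (by fun_prop) (Filter.Eventually.of_forall fun v => ?_)
    rw [Real.norm_of_nonneg (by positivity)]
    exact h2 v
  refine ⟨h3, (integral_mono h3 h1 h2).trans ?_⟩
  rw [integral_const_mul, integral_add (integrable_const _) h]
  simp

/-- Suppose the solution is nearly carried by a second line at a small time s. By Lipschitz
continuity the initial law is O(s)-close to that line, so the second line is O(s)-close to the first
one near the support. Then the mean defect at time s is at most small constants times s plus O(s²),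
which contradicts the linear growth βs of `exists_lineDefect_growth`. -/
theorem exists_mass_off_lines_of_line (hγ : γ ∈ Ioo (0 : ℝ) 1) (hν : ν ∈ Ioo (0 : ℝ) 1)
    (hb : CrossSection ν b) {μ : Measure Plane} [IsProbabilityMeasure μ]
    (hμ : ∀ a, μ ≠ Measure.dirac a) {p q c : ℝ} (hpq : p ^ 2 + q ^ 2 = 1)
    (hline : ∀ᵐ v ∂μ, affineForm p q c v = 0) {t₀ : ℝ} (ht₀ : 0 < t₀) :
    ∃ s κ : ℝ, 0 ≤ s ∧ s < t₀ ∧ 0 < κ ∧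
      ∀ (T : ℝ) (f : ℝ → Measure Plane), IsWeakSolution γ b T f → f 0 = μ → s ≤ T →
      ∀ p' q' c' : ℝ, p' ^ 2 + q' ^ 2 = 1 → κ ≤ ∫ v, min 1 |affineForm p' q' c' v| ∂(f s) := by
  obtain ⟨a₁, a₂, ha, ha₁, ha₂⟩ := exists_ne_forall_ball_pos hμ
  obtain ⟨β, u, hβ, hu, hgrow⟩ := exists_lineDefect_growth hγ hν hb hpq hline ha ha₁ ha₂
  obtain ⟨D, hDdef⟩ : ∃ x, x = ‖a₁ - a₂‖ := ⟨_, rfl⟩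
  have hD : 0 < D := hDdef ▸ norm_pos_iff.2 (sub_ne_zero.2 ha)
  obtain ⟨w, hw⟩ : ∃ x, x = min (μ.real (Metric.ball a₁ (D / 8))) (μ.real (Metric.ball a₂ (D / 8))) := ⟨_, rfl⟩
  have hw0 : 0 < w := hw ▸ lt_min
    (ENNReal.toReal_pos (ha₁ _ (by positivity)).ne' (measure_ne_top _ _))
    (ENNReal.toReal_pos (ha₂ _ (by positivity)).ne' (measure_ne_top _ _))
  have hK := speed_nonneg hb μ
  obtain ⟨K, hKdef⟩ : ∃ x, x = speed b μ + 1 := ⟨_, rfl⟩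
  have hK0 : 0 < K := by linarith
  obtain ⟨E, hE⟩ : ∃ x, x = ∫ v, ‖v‖ ^ 2 ∂μ := ⟨_, rfl⟩
  have hE0 : 0 ≤ E := hE ▸ integral_nonneg fun v => by positivity
  obtain ⟨E', hE'⟩ : ∃ x, x = 2 * (1 + E) := ⟨_, rfl⟩
  have hE'0 : 0 < E' := by rw [hE']; linarith
  obtain ⟨A, hA⟩ : ∃ x, x = ‖a₁‖ + D / 8 := ⟨_, rfl⟩
  -- `e₁` is the threshold for the mass at time zero
  obtain ⟨e₁, he₁⟩ : ∃ x, x = min (w / 2) (w * D / 8) := ⟨_, rfl⟩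
  have he₁0 : 0 < e₁ := he₁ ▸ lt_min (by positivity) (by positivity)
  obtain ⟨C₁, hC₁⟩ : ∃ x, x = 2 * (1 + 4 * (1 + A) / D) / w := ⟨_, rfl⟩
  have hA0 : 0 ≤ A := by rw [hA]; positivity
  have hC₁0 : 0 < C₁ := by rw [hC₁]; positivity
  -- The constraints are, in order: validity of the linear growth, s < t₀, smallness of the initial
  -- integral η' ≤ 2Ks below e₁, and the quadratic error 8 C₁² K² E' s² being at most βs/4.
  -- Afterwards M makes the energy tail equal to βs/4 and κ bounds the remaining term by βs/4, for a
  -- total of 3βs/4 < βs.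
  obtain ⟨s, hs⟩ : ∃ x, x = min (min u (t₀ / 2)) (min (e₁ / (2 * K)) (β / (32 * C₁ ^ 2 * K ^ 2 * E'))) := ⟨_, rfl⟩
  have hs0 : 0 < s := hs ▸ lt_min (lt_min hu (by positivity)) (lt_min (by positivity) (by positivity))
  have hsu : s ≤ u := hs ▸ (min_le_left _ _).trans (min_le_left _ _)
  have hst : s ≤ t₀ / 2 := hs ▸ (min_le_left _ _).trans (min_le_right _ _)
  have hse : s ≤ e₁ / (2 * K) := hs ▸ (min_le_right _ _).trans (min_le_left _ _)
  have hsβ : s ≤ β / (32 * C₁ ^ 2 * K ^ 2 * E') := hs ▸ (min_le_right _ _).trans (min_le_right _ _)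
  obtain ⟨M, hM⟩ : ∃ x, x = 4 * (1 + |c|) * E' / (β * s) := ⟨_, rfl⟩
  have hM0 : 0 < M := by rw [hM]; positivity
  obtain ⟨κ, hκ⟩ : ∃ x, x = min (K * s) (β * s / (4 * (8 + (1 + |c|) * M))) := ⟨_, rfl⟩
  have hκ0 : 0 < κ := hκ ▸ lt_min (by positivity) (by positivity)
  refine ⟨s, κ, hs0.le, by linarith, hκ0, ?_⟩
  intro T f hf hf0 hsT p' q' c' hpq'
  by_contra hcon
  push Not at hcon
  rw [hκ] at hcon
  have hsT' : s ∈ Icc 0 T := ⟨hs0.le, hsT⟩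
  have h0T : (0 : ℝ) ∈ Icc 0 T := ⟨le_rfl, hs0.le.trans hsT⟩
  have := hf.prob s hsT'
  have hEs := hf.finite_energy s hsT'
  have hFs := hgrow T f hf hf0 s hsT' hsu
  set η := ∫ v, min 1 |affineForm p' q' c' v| ∂(f s) with hη
  have hη0 : 0 ≤ η := integral_nonneg fun v => min_abs_nonneg _
  set η' := ∫ v, min 1 |affineForm p' q' c' v| ∂μ with hη'
  have hη'0 : 0 ≤ η' := integral_nonneg fun v => min_abs_nonneg _
  have hηη' : η' ≤ 2 * (K * s) := by
    have h1 := hf.abs_sub_le_speed hγ hν hb (lipschitzWith_min_abs_affineForm (c := c') hpq')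
      hsT' h0T
    rw [hf0, ← hη, ← hη', sub_zero, abs_of_pos hs0, NNReal.coe_one, one_mul] at h1
    have h2 := (abs_le.1 h1).1
    have h3 : speed b μ * s ≤ K * s := mul_le_mul_of_nonneg_right (by linarith) hs0.le
    have h4 : η < K * s := hcon.trans_le (min_le_left _ _)
    linarith
  have hη'e : η' ≤ e₁ := by
    refine hηη'.trans ?_
    clear he₁
    rw [le_div_iff₀ (by positivity)] at hse
    linarith
  have hpoint : ∀ a : Plane, (∀ r, 0 < r → 0 < μ (Metric.ball a r)) →
      w ≤ μ.real (Metric.ball a (D / 8)) → ∃ v ∈ Metric.ball a (D / 8),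
        affineForm p q c v = 0 ∧ |affineForm p' q' c' v| ≤ η' / w := by
    intro a haa hwa
    obtain ⟨v, hv, hv0, hvle⟩ := exists_mem_ball_min_abs_le hline (haa (D / 8) (by positivity))
      p' q' c'
    refine ⟨v, hv, hv0, ?_⟩
    have h1 : w * min 1 |affineForm p' q' c' v| ≤ η' :=
      (mul_le_mul_of_nonneg_right hwa (min_abs_nonneg _)).trans hvle
    have h2 : min 1 |affineForm p' q' c' v| ≤ η' / w := by
      rw [le_div_iff₀ hw0]; linarith
    have h3 : η' / w ≤ 1 / 2 := by
      rw [div_le_iff₀ hw0]; linarith [min_le_left (w / 2) (w * D / 8)]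
    rcases le_total 1 |affineForm p' q' c' v| with h4 | h4
    · rw [min_eq_left h4] at h2; linarith
    · rwa [min_eq_right h4] at h2
  obtain ⟨v₁, hv₁, hv₁0, hv₁e⟩ := hpoint a₁ ha₁ (hw ▸ min_le_left _ _)
  obtain ⟨v₂, hv₂, hv₂0, hv₂e⟩ := hpoint a₂ ha₂ (hw ▸ min_le_right _ _)
  rw [Metric.mem_ball, dist_eq_norm] at hv₁ hv₂
  have hd : D / 2 ≤ ‖v₂ - v₁‖ := by
    have h1 : a₁ - a₂ = (v₂ - a₂) - (v₁ - a₁) - (v₂ - v₁) := by abel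
    have h2 : D ≤ ‖v₂ - a₂‖ + ‖v₁ - a₁‖ + ‖v₂ - v₁‖ := by
      rw [hDdef, h1]
      exact (norm_sub_le _ _).trans (add_le_add_left (norm_sub_le _ _) _)
    linarith
  have hvA : ‖v₁‖ ≤ A := by
    have := norm_le_norm_add_norm_sub a₁ v₁
    rw [norm_sub_rev] at hv₁
    linarith
  have heD : 4 * (η' / w) / D ≤ 1 / 2 := by
    rw [div_le_iff₀ hD, ← mul_div_assoc, div_le_iff₀ hw0]
    linarith [min_le_right (w / 2) (w * D / 8)]
  have hpt : ∀ v, lineDefect p q c v ≤ (8 + (1 + |c|) * M) * min 1 |affineForm p' q' c' v| +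
      ((1 + |c|) / M + 2 * (C₁ * η') ^ 2) * (1 + ‖v‖) ^ 2 := fun v => by
    refine lineDefect_le_of_abs_le hpq hM0 ?_
    have h1 := abs_affineForm_le_of_small hpq hpq' hv₁0 hv₂0 hD hd hvA hv₁e hv₂e heD v
    refine h1.trans (le_of_eq ?_)
    rw [hC₁]; ring
  obtain ⟨hi2, hE2⟩ := integral_one_add_norm_sq_le hEs
  rw [hf.energy s hsT', hf0, ← hE, ← hE'] at hE2
  have hi1 := integrable_min_abs_affineForm (f s) p' q' c'
  have hi3 : Integrable (lineDefect p q c) (f s) := by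
    refine (((integrable_norm_of_sq hEs).add (integrable_const |c|))).mono'
      (lipschitzWith_lineDefect hpq).continuous.aestronglyMeasurable
      (Filter.Eventually.of_forall fun v => ?_)
    have h0 : 0 ≤ lineDefect p q c v := by
      unfold lineDefect
      linarith [Real.one_le_sqrt.2 (show 1 ≤ 1 + affineForm p q c v ^ 2 by
        linarith [sq_nonneg (affineForm p q c v)])]
    rw [Real.norm_of_nonneg h0]
    refine (lineDefect_le_abs p q c v).trans ?_
    exact (abs_sub _ _).trans (add_le_add_left (abs_dot_le hpq v) _)
  have hint : ∫ v, lineDefect p q c v ∂(f s) ≤ (8 + (1 + |c|) * M) * η +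
      ((1 + |c|) / M + 2 * (C₁ * η') ^ 2) * E' := by
    refine (integral_mono hi3 ((hi1.const_mul _).add (hi2.const_mul _)) hpt).trans ?_
    have h5 := integral_add (hi1.const_mul (8 + (1 + |c|) * M))
      (hi2.const_mul ((1 + |c|) / M + 2 * (C₁ * η') ^ 2))
    rw [integral_const_mul, integral_const_mul] at h5
    refine (le_of_eq h5).trans ?_
    gcongr
  have hb1 : (8 + (1 + |c|) * M) * η ≤ β * s / 4 := by
    have h6 : η ≤ β * s / (4 * (8 + (1 + |c|) * M)) := hcon.le.trans (min_le_right _ _)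
    have h7 : 0 < 8 + (1 + |c|) * M := by positivity
    rw [le_div_iff₀ (by positivity)] at h6
    linarith
  have hb2 : (1 + |c|) / M * E' = β * s / 4 := by
    rw [hM]
    have : 0 < 1 + |c| := by positivity
    field_simp
  have hb3 : 2 * (C₁ * η') ^ 2 * E' ≤ β * s / 4 := by
    calc 2 * (C₁ * η') ^ 2 * E' ≤ 2 * (C₁ * (2 * (K * s))) ^ 2 * E' := by gcongr
      _ = (32 * C₁ ^ 2 * K ^ 2 * E') * s * s / 4 := by ring
      _ ≤ β * s / 4 := by
        rw [le_div_iff₀ (by positivity)] at hsβ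
        have := mul_le_mul_of_nonneg_right hsβ hs0.le
        linarith
  have hb0 : 0 < β * s := by positivity
  linarith

/-- Solutions starting from a measure which is not a Dirac mass are not concentrated near lines on
some time interval which depends on the initial condition only. -/
theorem exists_window (hγ : γ ∈ Ioo (0 : ℝ) 1) (hν : ν ∈ Ioo (0 : ℝ) 1)
    (hb : CrossSection ν b) {μ : Measure Plane} [IsProbabilityMeasure μ]
    (hE : Integrable (fun v : Plane => ‖v‖ ^ 2) μ)
    (hμ : ∀ a, μ ≠ Measure.dirac a) {t₀ : ℝ} (ht₀ : 0 < t₀) :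
    ∃ s₁ s₂ κ : ℝ, 0 ≤ s₁ ∧ s₁ < s₂ ∧ s₂ ≤ t₀ ∧ 0 < κ ∧
      ∀ (T : ℝ) (f : ℝ → Measure Plane), IsWeakSolution γ b T f → f 0 = μ → s₂ ≤ T →
      ∀ s ∈ Icc s₁ s₂, ∀ p q c : ℝ, p ^ 2 + q ^ 2 = 1 →
        κ ≤ ∫ v, min 1 |affineForm p q c v| ∂(f s) := by
  by_cases h : ∀ p q c : ℝ, p ^ 2 + q ^ 2 = 1 → ¬ ∀ᵐ v ∂μ, affineForm p q c v = 0
  · obtain ⟨κ, hκ, hlow⟩ := exists_mass_off_lines hE h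
    refine exists_window_of_time hγ hν hb le_rfl ht₀ hκ ?_
    intro T f _ hf0 _ p q c hpq
    rw [hf0]
    exact hlow p q c hpq
  · push Not at h
    obtain ⟨p, q, c, hpq, hline⟩ := h
    obtain ⟨s, κ, hs, hst, hκ, hlow⟩ :=
      exists_mass_off_lines_of_line hγ hν hb hμ hpq hline ht₀
    exact exists_window_of_time hγ hν hb hs hst hκ hlow

end

/-! ### Complex notation and the contraction factor of a jump. -/

/-- The identification of the plane with `ℂ`. -/
def toC (x : Plane) : ℂ := ⟨x 0, x 1⟩

@[simp] theorem toC_re (x : Plane) : (toC x).re = x 0 := rfl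
@[simp] theorem toC_im (x : Plane) : (toC x).im = x 1 := rfl

theorem toC_add (x y : Plane) : toC (x + y) = toC x + toC y := by
  apply Complex.ext <;> simp

theorem toC_sub (x y : Plane) : toC (x - y) = toC x - toC y := by
  apply Complex.ext <;> simp

theorem toC_smul (r : ℝ) (x : Plane) : toC (r • x) = r * toC x := by
  apply Complex.ext <;> simp

theorem norm_toC (x : Plane) : ‖toC x‖ = ‖x‖ := by
  rw [← sq_eq_sq₀ (norm_nonneg _) (norm_nonneg _), plane_norm_sq, Complex.sq_norm,
    Complex.normSq_apply, toC_re, toC_im]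
  ring

theorem measurable_toC : Measurable toC :=
  Complex.measurableEquivRealProd.symm.measurable.comp
    (f := fun x : Plane => (x 0, x 1)) (by fun_prop)

/-- The complex number `(e^{iθ} - 1) / 2` representing the matrix `A(θ)`. -/
noncomputable def collideC (θ : ℝ) : ℂ := (Complex.exp (θ * Complex.I) - 1) / 2

theorem collideC_re (θ : ℝ) : (collideC θ).re = (Real.cos θ - 1) / 2 := by
  simp [collideC, Complex.exp_ofReal_mul_I_re]

theorem collideC_im (θ : ℝ) : (collideC θ).im = Real.sin θ / 2 := by
  simp [collideC, Complex.exp_ofReal_mul_I_im]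

theorem toC_collide (θ : ℝ) (x : Plane) : toC (collide θ x) = collideC θ * toC x := by
  apply Complex.ext
  · rw [toC_re, collide_apply_zero, Complex.mul_re, collideC_re, collideC_im, toC_re, toC_im]; ring
  · rw [toC_im, collide_apply_one, Complex.mul_im, collideC_re, collideC_im, toC_re, toC_im]; ring

theorem continuous_collideC : Continuous collideC := by
  unfold collideC; fun_prop

theorem hasDerivAt_collideC (θ : ℝ) :
    HasDerivAt collideC (Complex.I / 2 * Complex.exp (θ * Complex.I)) θ := by
  have h1 : HasDerivAt (fun θ : ℝ => (θ : ℂ) * Complex.I) (1 * Complex.I) θ :=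
    (Complex.ofRealCLM.hasDerivAt (x := θ)).mul_const _
  have h2 := ((h1.cexp).sub_const 1).div_const 2
  exact HasDerivAt.congr_deriv h2 (by ring)

/-- The factor `1 + s (e^{iθ} - 1) / 2` by which a jump contracts differences of velocities. -/
noncomputable def contraction (s θ : ℝ) : ℂ := 1 + s * collideC θ

theorem norm_contraction_sq (s θ : ℝ) :
    ‖contraction s θ‖ ^ 2 = 1 - (s - s ^ 2 / 2) * (1 - Real.cos θ) := by
  rw [Complex.sq_norm, Complex.normSq_apply]
  simp only [contraction, Complex.add_re, Complex.one_re, Complex.add_im, Complex.one_im,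
    Complex.re_ofReal_mul, Complex.im_ofReal_mul, collideC_re, collideC_im]
  linear_combination s ^ 2 / 4 * Real.sin_sq_add_cos_sq θ

theorem norm_contraction_le_one {s θ : ℝ} (hs : s ∈ Icc (0 : ℝ) 1) : ‖contraction s θ‖ ≤ 1 := by
  apply le_of_sq_le_sq _ zero_le_one
  rw [norm_contraction_sq]
  have h1 : 0 ≤ s - s ^ 2 / 2 := by nlinarith [hs.1, hs.2]
  have h2 := Real.cos_le_one θ
  nlinarith

theorem norm_contraction_sq_ge (s θ : ℝ) :
    1 - θ ^ 2 / 4 ≤ ‖contraction s θ‖ ^ 2 := by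
  rw [norm_contraction_sq]
  have h1 : s - s ^ 2 / 2 ≤ 1 / 2 := by nlinarith [sq_nonneg (1 - s)]
  have h2 := Real.one_sub_sq_div_two_le_cos (x := θ)
  have h3 := Real.cos_le_one θ
  nlinarith

theorem third_le_norm_contraction_sq {s θ : ℝ}
    (hθ : |θ| ≤ Real.pi / 2) : 1 / 3 ≤ ‖contraction s θ‖ ^ 2 := by
  refine le_trans ?_ (norm_contraction_sq_ge s θ)
  have h1 : θ ^ 2 ≤ (Real.pi / 2) ^ 2 := by rw [← sq_abs]; gcongr
  have h2 := Real.pi_lt_d2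
  nlinarith [Real.pi_pos]

theorem contraction_ne_zero {s θ : ℝ}
    (hθ : |θ| ≤ Real.pi / 2) : contraction s θ ≠ 0 := by
  intro h
  have := third_le_norm_contraction_sq (s := s) hθ
  rw [h] at this
  norm_num at this

/-- The squared modulus is at least 1 - θ²/4 and at least 1/3 for |θ| ≤ π/2, so minus its logarithm
is O(θ²). The excess over 1 being quadratic in θ is what makes it integrable in z, uniformly in ζ.
-/
theorem norm_contraction_rpow_neg_le {s θ r : ℝ}
    (hθ : |θ| ≤ Real.pi / 2) (hr : 0 ≤ r) :
    ‖contraction s θ‖ ^ (-r) ≤ 1 + r * Real.exp (3 * r) * θ ^ 2 := by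
  have h3 := third_le_norm_contraction_sq (s := s) hθ
  have h4 := norm_contraction_sq_ge s θ
  set y := ‖contraction s θ‖ ^ 2 with hy
  have hy0 : 0 < y := by linarith
  have e1 : ‖contraction s θ‖ ^ (-r) = Real.exp (-(r / 2) * Real.log y) := by
    have : ‖contraction s θ‖ = y ^ (1 / 2 : ℝ) := by
      rw [← Real.sqrt_eq_rpow, hy, Real.sqrt_sq (norm_nonneg _)]
    rw [this, ← Real.rpow_mul hy0.le, Real.rpow_def_of_pos hy0]
    congr 1; ring
  rw [e1]
  have h5 : -Real.log y ≤ 3 / 4 * θ ^ 2 := by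
    have h6 := Real.one_sub_inv_le_log_of_pos hy0
    have h7 : y⁻¹ - 1 ≤ 3 / 4 * θ ^ 2 := by
      have : y⁻¹ ≤ 3 := by
        rw [inv_le_comm₀ hy0 (by norm_num)]; linarith
      have h8 : y⁻¹ - 1 = y⁻¹ * (1 - y) := by field_simp
      rw [h8]
      rcases le_total 0 (1 - y) with h9 | h9
      · calc y⁻¹ * (1 - y) ≤ 3 * (θ ^ 2 / 4) := by gcongr; linarith
          _ = _ := by ring
      · have : 0 < y⁻¹ := inv_pos.2 hy0
        nlinarith [sq_nonneg θ]
    linarith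
  have h10 : θ ^ 2 ≤ 4 := by
    have : |θ| ≤ 2 := by linarith [Real.pi_le_four]
    rw [← sq_abs]; nlinarith [abs_nonneg θ]
  set w := r * θ ^ 2 with hw
  have hw0 : 0 ≤ w := by positivity
  have h11 : Real.exp (-(r / 2) * Real.log y) ≤ Real.exp (3 / 8 * w) := by
    apply Real.exp_le_exp.2
    rw [hw]
    nlinarith
  refine h11.trans ?_
  have h12 : Real.exp (3 / 8 * w) - 1 ≤ 3 / 8 * w * Real.exp (3 / 8 * w) := by
    have h13 := Real.add_one_le_exp (-(3 / 8 * w))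
    have h14 : Real.exp (3 / 8 * w) * Real.exp (-(3 / 8 * w)) = 1 := by
      rw [← Real.exp_add]; simp
    nlinarith [Real.exp_pos (3 / 8 * w)]
  have h15 : Real.exp (3 / 8 * w) ≤ Real.exp (3 * r) := by
    apply Real.exp_le_exp.2
    rw [hw]; nlinarith
  have h16 : 3 / 8 * w * Real.exp (3 / 8 * w) ≤ w * Real.exp (3 * r) := by
    apply mul_le_mul (by linarith) h15 (Real.exp_pos _).le hw0
  rw [hw] at h16
  linarith

/-- Since (1 + e^{iθ})/2 = cos(θ/2) e^{iθ/2}, the quotient is e^{iθ/2}/cos(θ/2). Its real part is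
exactly 1 and its imaginary part has the sign of θ, which allows cancellations to be avoided later
by choosing the sign of the mark. -/
theorem exp_div_contraction {θ : ℝ} (hθ : |θ| < Real.pi) :
    Complex.exp (θ * Complex.I) / contraction 1 θ = 1 + Real.tan (θ / 2) * Complex.I := by
  have hc : Real.cos (θ / 2) ≠ 0 := by
    apply ne_of_gt
    have := abs_lt.1 hθ
    apply Real.cos_pos_of_mem_Ioo
    constructor <;> linarith
  have hcC : (Real.cos (θ / 2) : ℂ) ≠ 0 := by exact_mod_cast hc
  have h1 : Complex.exp (θ * Complex.I) = Complex.exp (((θ / 2 : ℝ) : ℂ) * Complex.I) ^ 2 := by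
    rw [← Complex.exp_nat_mul]; congr 1; push_cast; ring
  have h2 : Complex.exp (((θ / 2 : ℝ) : ℂ) * Complex.I) =
      Real.cos (θ / 2) + Real.sin (θ / 2) * Complex.I := by
    rw [Complex.exp_mul_I, Complex.ofReal_cos, Complex.ofReal_sin]
  have h3 : (Real.cos (θ / 2) : ℂ) ^ 2 + (Real.sin (θ / 2) : ℂ) ^ 2 = 1 := by
    exact_mod_cast Real.cos_sq_add_sin_sq (θ / 2)
  set c : ℂ := (Real.cos (θ / 2) : ℂ)
  set d : ℂ := (Real.sin (θ / 2) : ℂ) with hd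
  have hne : c + d * Complex.I ≠ 0 := by
    rw [← h2]; exact Complex.exp_ne_zero _
  have h4 : contraction 1 θ = c * (c + d * Complex.I) := by
    unfold contraction collideC
    rw [h1, h2]
    push_cast
    linear_combination (-1 / 2) * h3 + d ^ 2 / 2 * Complex.I_sq
  have h5 : ((Real.tan (θ / 2) : ℝ) : ℂ) = d / c := by
    rw [Real.tan_eq_sin_div_cos, Complex.ofReal_div]
  rw [h4, h5, h1, h2]
  field_simp

/-! ### The jump chain and the derivatives of its position. -/

/-- The state of the regularized process: position, contraction since time `0`, and the two sums
`∑ |d_k|²` and `∑ d_k²` which determine the covariance matrix. -/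
abbrev ChainState : Type := Plane × ℂ × ℝ × ℂ

section Chain

variable (b I U : ℝ → ℝ) (v : ℝ → ℝ → Plane)

/-- The normalized Malliavin derivative contributed by a jump at time `t` with mark `y`. -/
noncomputable def jumpDirection (t : ℝ) (s : ChainState) (y : ℝ × ℝ) : ℂ :=
  s.2.1⁻¹ * (1 + Real.tan (angle b y.2 / 2) * Complex.I) *
    (Complex.I / 2 * (U y.2 * deriv (angle b) y.2 : ℝ)) * toC (s.1 - v t y.1)

/-- The transition of the state at a jump. -/
noncomputable def chainStep (t : ℝ) (s : ChainState) (y : ℝ × ℝ) : ChainState :=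
  (s.1 + I y.2 • collide (angle b y.2) (s.1 - v t y.1),
    s.2.1 * contraction (I y.2) (angle b y.2),
    s.2.2.1 + ‖jumpDirection b U v t s y‖ ^ 2,
    s.2.2.2 + jumpDirection b U v t s y ^ 2)

/-- The state after `k` jumps. -/
noncomputable def chain (x : Plane) (τ ρ : ℕ → ℝ) (z : ℤ → ℝ) : ℕ → ChainState
  | 0 => (x, 1, 0, 0)
  | k + 1 => chainStep b I U v (τ (k + 1)) (chain x τ ρ z k) (ρ (k + 1), z (k + 1))

variable {b I U v} {x : Plane} {τ ρ : ℕ → ℝ} {z : ℤ → ℝ}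

theorem chain_fst (k : ℕ) : (chain b I U v x τ ρ z k).1 = position b I v x τ ρ z k := by
  induction k with
  | zero => rfl
  | succ k ih => simp only [chain, chainStep, position, ih]

theorem position_update_of_lt {k : ℤ} {y : ℝ} (j : ℕ) (hj : (j : ℤ) < k) :
    position b I v x τ ρ (Function.update z k y) j = position b I v x τ ρ z j := by
  induction j with
  | zero => rfl
  | succ j ih =>
    push_cast at hj
    have hne : (j : ℤ) + 1 ≠ k := by omega
    simp only [position, Function.update_of_ne hne, ih (by omega)]

theorem toC_position_succ (z : ℤ → ℝ) (k : ℕ) :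
    toC (position b I v x τ ρ z (k + 1)) = toC (position b I v x τ ρ z k) +
      I (z (k + 1)) * collideC (angle b (z (k + 1))) *
        (toC (position b I v x τ ρ z k) - toC (v (τ (k + 1)) (ρ (k + 1)))) := by
  simp only [position]
  rw [toC_add, toC_smul, toC_collide, toC_sub, mul_assoc]

/-- Two trajectories that use the same marks after jump k + 1 differ by a vector which each later
jump multiplies by its contraction factor. The identity is written without division so that the
induction needs no nonvanishing. -/
theorem position_update_sub {y : ℝ} (k J : ℕ) (hJ : k + 1 ≤ J) :
    (chain b I U v x τ ρ z (k + 1)).2.1 *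
      (toC (position b I v x τ ρ (Function.update z (k + 1) y) J) -
        toC (position b I v x τ ρ z J)) =
    (chain b I U v x τ ρ z J).2.1 *
      (toC (position b I v x τ ρ (Function.update z (k + 1) y) (k + 1)) -
        toC (position b I v x τ ρ z (k + 1))) := by
  induction J, hJ using Nat.le_induction with
  | base => rfl
  | succ J hJ ih =>
    have hne : (J : ℤ) + 1 ≠ (k : ℤ) + 1 := by omega
    rw [toC_position_succ, toC_position_succ, Function.update_of_ne hne]
    have hs : (chain b I U v x τ ρ z (J + 1)).2.1 = (chain b I U v x τ ρ z J).2.1 *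
        (1 + I (z (J + 1)) * collideC (angle b (z (J + 1)))) := rfl
    rw [hs]
    linear_combination (1 + I (z (J + 1)) * collideC (angle b (z (J + 1)))) * ih

theorem chain_contraction_ne_zero
    (hθ : ∀ z, |angle b z| ≤ Real.pi / 2) (k : ℕ) : (chain b I U v x τ ρ z k).2.1 ≠ 0 := by
  induction k with
  | zero => exact one_ne_zero
  | succ k ih => exact mul_ne_zero ih (contraction_ne_zero (hθ _))

theorem norm_chain_contraction_le_one (hI : ∀ z, I z ∈ Icc (0 : ℝ) 1) (k : ℕ) :
    ‖(chain b I U v x τ ρ z k).2.1‖ ≤ 1 := by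
  induction k with
  | zero => simp [chain]
  | succ k ih =>
    simp only [chain, chainStep, norm_mul]
    exact mul_le_one₀ ih (norm_nonneg _) (norm_contraction_le_one (hI _))

theorem norm_chain_sq_sum_le (k : ℕ) :
    ‖(chain b I U v x τ ρ z k).2.2.2‖ ≤ (chain b I U v x τ ρ z k).2.2.1 := by
  induction k with
  | zero => simp [chain]
  | succ k ih =>
    simp only [chain, chainStep]
    refine (norm_add_le _ _).trans (add_le_add ih ?_)
    rw [norm_pow]

/-- The derivative of the final position with respect to the mark of a jump. -/
theorem hasDerivAt_toC_position {ν ζ : ℝ} (hν : 0 < ν) (hb : CrossSection ν b)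
    (hI : IsAngularCutoff b ζ I) {k J : ℕ} (hJ : k + 1 ≤ J)
    (hz0 : z (k + 1) ≠ 0) (hz : |z (k + 1)| < angG b ζ) :
    HasDerivAt (fun y => toC (position b I v x τ ρ (Function.update z (k + 1) y) J))
      ((chain b I U v x τ ρ z J).2.1 * ((chain b I U v x τ ρ z k).2.1⁻¹ *
        (1 + Real.tan (angle b (z (k + 1)) / 2) * Complex.I) *
        (Complex.I / 2 * (deriv (angle b) (z (k + 1)) : ℝ)) *
          toC ((chain b I U v x τ ρ z k).1 - v (τ (k + 1)) (ρ (k + 1))))) (z (k + 1)) := by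
  have hθ : ∀ z, |angle b z| ≤ Real.pi / 2 := fun z => (abs_angle_lt hν hb z).le
  set X := toC (position b I v x τ ρ z k) - toC (v (τ (k + 1)) (ρ (k + 1))) with hX
  have hY := chain_contraction_ne_zero (I := I) (U := U) (v := v) (x := x) (τ := τ) (ρ := ρ) (z := z)
    hθ (k + 1)
  have hYk := chain_contraction_ne_zero (I := I) (U := U) (v := v) (x := x) (τ := τ) (ρ := ρ) (z := z)
    hθ k
  have hI1 : I (z (k + 1)) = 1 := hI.eq_one _ hz.le
  have hYsucc : (chain b I U v x τ ρ z (k + 1)).2.1 =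
      (chain b I U v x τ ρ z k).2.1 * contraction 1 (angle b (z (k + 1))) := by
    simp only [chain, chainStep, hI1]
  have hcne : contraction 1 (angle b (z (k + 1))) ≠ 0 :=
    contraction_ne_zero (hθ _)
  -- Near the mark the cutoff is identically 1, so the final position is locally an affine function
  -- of `collideC (angle b y)` and the derivative of the cutoff never appears.
  have heq : (fun y => toC (position b I v x τ ρ (Function.update z (k + 1) y) J)) =ᶠ[nhds
      (z (k + 1))] fun y => toC (position b I v x τ ρ z J) +
        (chain b I U v x τ ρ z J).2.1 / (chain b I U v x τ ρ z (k + 1)).2.1 *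
          ((collideC (angle b y) - collideC (angle b (z (k + 1)))) * X) := by
    filter_upwards [continuous_abs.continuousAt.eventually_lt continuousAt_const hz] with y hy
    have h1 := position_update_sub (b := b) (I := I) (U := U) (v := v) (x := x) (τ := τ) (ρ := ρ)
      (z := z) (y := y) k J hJ
    have h2 : toC (position b I v x τ ρ (Function.update z (k + 1) y) (k + 1)) -
        toC (position b I v x τ ρ z (k + 1)) =
        (collideC (angle b y) - collideC (angle b (z (k + 1)))) * X := by
      rw [toC_position_succ, toC_position_succ, Function.update_self,
        position_update_of_lt k (by omega), hI1, hI.eq_one y hy.le]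
      push_cast
      ring
    rw [h2] at h1
    rw [div_mul_eq_mul_div, ← h1]
    field_simp
    ring
  have hder := (hasDerivAt_collideC (angle b (z (k + 1)))).scomp (z (k + 1))
    (hasDerivAt_angle hν hb hz0)
  have hder2 := (((hder.sub_const (collideC (angle b (z (k + 1))))).mul_const X).const_mul
    ((chain b I U v x τ ρ z J).2.1 / (chain b I U v x τ ρ z (k + 1)).2.1)).const_add
      (toC (position b I v x τ ρ z J))
  refine (hder2.congr_of_eventuallyEq heq).congr_deriv ?_
  have hlt : |angle b (z (k + 1))| < Real.pi := by
    have := abs_angle_lt hν hb (z (k + 1)); linarith [Real.pi_pos]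
  rw [(hasDerivAt_angle hν hb hz0).deriv, ← exp_div_contraction hlt, hYsucc, chain_fst, toC_sub,
    ← hX, Complex.real_smul]
  field_simp

end Chain

theorem sum_int_Icc_neg_one {M : Type*} [AddCommMonoid M] (g : ℤ → M) (h1 : g (-1) = 0)
    (h0 : g 0 = 0) (J : ℕ) :
    ∑ k ∈ Finset.Icc (-1 : ℤ) J, g k = ∑ k ∈ Finset.range J, g (k + 1) := by
  induction J with
  | zero =>
    have : Finset.Icc (-1 : ℤ) ((0 : ℕ) : ℤ) = {-1, 0} := by decide
    rw [this, Finset.sum_pair (by decide), h1, h0]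
    simp
  | succ J ih =>
    have : Finset.Icc (-1 : ℤ) ((J + 1 : ℕ) : ℤ) =
        insert ((J : ℤ) + 1) (Finset.Icc (-1 : ℤ) (J : ℤ)) := by
      ext k; simp only [Finset.mem_Icc, Finset.mem_insert]; push_cast; omega
    rw [this, Finset.sum_insert (by simp), ih, Finset.sum_range_succ, add_comm]

/-! ### The covariance determinant as a function of the state. -/

section Covariance

variable {b I U : ℝ → ℝ} {v : ℝ → ℝ → Plane} {x : Plane} {τ ρ : ℕ → ℝ} {z : ℤ → ℝ}

/-- The normalized Malliavin derivative along the chain. -/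
noncomputable def chainDirection (b I U : ℝ → ℝ) (v : ℝ → ℝ → Plane) (x : Plane) (τ ρ : ℕ → ℝ)
    (z : ℤ → ℝ) (k : ℕ) : ℂ :=
  jumpDirection b U v (τ (k + 1)) (chain b I U v x τ ρ z k) (ρ (k + 1), z (k + 1))

theorem chain_sum_norm_sq (J : ℕ) : (chain b I U v x τ ρ z J).2.2.1 =
    ∑ k ∈ Finset.range J, ‖chainDirection b I U v x τ ρ z k‖ ^ 2 := by
  induction J with
  | zero => rfl
  | succ J ih => rw [Finset.sum_range_succ, ← ih]; rfl

theorem chain_sum_sq (J : ℕ) : (chain b I U v x τ ρ z J).2.2.2 =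
    ∑ k ∈ Finset.range J, chainDirection b I U v x τ ρ z k ^ 2 := by
  induction J with
  | zero => rfl
  | succ J ih => rw [Finset.sum_range_succ, ← ih]; rfl

theorem malliavinDeriv_position {ν ζ : ℝ} (hν : 0 < ν) (hb : CrossSection ν b)
    (hI : IsAngularCutoff b ζ I) (hU : IsWeight b ζ U) {k J : ℕ} (hk : k < J) :
    malliavinDeriv U (fun y => position b I v x τ ρ y J 0) z (k + 1) =
        ((chain b I U v x τ ρ z J).2.1 * chainDirection b I U v x τ ρ z k).re ∧
      malliavinDeriv U (fun y => position b I v x τ ρ y J 1) z (k + 1) =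
        ((chain b I U v x τ ρ z J).2.1 * chainDirection b I U v x τ ρ z k).im := by
  have hw : weight U z ((k : ℤ) + 1) = U (z (k + 1)) := by
    rw [weight, if_neg (by omega)]
  unfold malliavinDeriv
  rw [hw]
  -- Where the weight vanishes, both sides are 0 whatever the derivative is. Elsewhere 1/2 < |z| <
  -- G(ζ) - 1/2, away from the singularity of ϑ at 0 and from the region where the cutoff varies.
  by_cases hUz : U (z (k + 1)) = 0
  · have : chainDirection b I U v x τ ρ z k = 0 := by
      simp [chainDirection, jumpDirection, hUz]
    rw [this, hUz]
    simp
  have hz0 : z (k + 1) ≠ 0 := fun h => hUz (hU.eq_zero_of_le _ (by rw [h]; norm_num))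
  have hz : |z (k + 1)| < angG b ζ := by
    by_contra hcon
    push Not at hcon
    exact hUz (hU.eq_zero_of_ge _ (by linarith))
  have hd := hasDerivAt_toC_position (U := U) (v := v) (x := x) (τ := τ) (ρ := ρ) (z := z) hν hb hI
    (Nat.succ_le_of_lt hk) hz0 hz
  set W := (chain b I U v x τ ρ z J).2.1 * ((chain b I U v x τ ρ z k).2.1⁻¹ *
        (1 + Real.tan (angle b (z (k + 1)) / 2) * Complex.I) *
        (Complex.I / 2 * (deriv (angle b) (z (k + 1)) : ℝ)) *
          toC ((chain b I U v x τ ρ z k).1 - v (τ (k + 1)) (ρ (k + 1)))) with hW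
  have hE : (chain b I U v x τ ρ z J).2.1 * chainDirection b I U v x τ ρ z k =
      U (z (k + 1)) * W := by
    rw [hW]
    simp only [chainDirection, jumpDirection]
    push_cast
    ring
  have hre : HasDerivAt (fun y => position b I v x τ ρ (Function.update z (k + 1) y) J 0) W.re
      (z (k + 1)) := Complex.reCLM.hasFDerivAt.comp_hasDerivAt _ hd
  have him : HasDerivAt (fun y => position b I v x τ ρ (Function.update z (k + 1) y) J 1) W.im
      (z (k + 1)) := Complex.imCLM.hasFDerivAt.comp_hasDerivAt _ hd
  rw [hre.deriv, him.deriv, hE, Complex.re_ofReal_mul, Complex.im_ofReal_mul]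
  exact ⟨rfl, rfl⟩

theorem malliavinDeriv_position_of_nonpos {k : ℤ} (hk : k ≤ 0) (J : ℕ) (i : Fin 2) :
    malliavinDeriv U (fun y => position b I v x τ ρ y J i) z k = 0 := by
  have hconst : ∀ (y : ℝ) (j : ℕ), position b I v x τ ρ (Function.update z k y) j =
      position b I v x τ ρ z j := by
    intro y j
    induction j with
    | zero => rfl
    | succ j ih =>
      have hne : (j : ℤ) + 1 ≠ k := by omega
      simp only [position, Function.update_of_ne hne, ih]
  simp [malliavinDeriv, hconst]

/-- The determinant of the regularized covariance matrix as a function of the state. -/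
noncomputable def covDet (u : ℝ) (s : ChainState) : ℝ :=
  u ^ 2 + u * (‖s.2.1‖ ^ 2 * s.2.2.1) +
    ‖s.2.1‖ ^ 4 * ((s.2.2.1 ^ 2 - ‖s.2.2.2‖ ^ 2) / 4)

/-- With P, Q the diagonal sums and R the off-diagonal one, |Y|²∑|d|² = P + Q and Y²∑d² = (P - Q) +
2iR, so 4(PQ - R²) is the difference of the squared moduli of these two numbers. -/
theorem det_add_sum_sq {ι : Type*} (t : Finset ι) (d : ι → ℂ) (Y : ℂ) (u : ℝ) :
    (u + ∑ k ∈ t, (Y * d k).re * (Y * d k).re) * (u + ∑ k ∈ t, (Y * d k).im * (Y * d k).im) -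
      (∑ k ∈ t, (Y * d k).re * (Y * d k).im) * (∑ k ∈ t, (Y * d k).im * (Y * d k).re) =
    u ^ 2 + u * (‖Y‖ ^ 2 * ∑ k ∈ t, ‖d k‖ ^ 2) +
      ‖Y‖ ^ 4 * (((∑ k ∈ t, ‖d k‖ ^ 2) ^ 2 - ‖∑ k ∈ t, d k ^ 2‖ ^ 2) / 4) := by
  set P := ∑ k ∈ t, (Y * d k).re * (Y * d k).re
  set Q := ∑ k ∈ t, (Y * d k).im * (Y * d k).im
  set R := ∑ k ∈ t, (Y * d k).re * (Y * d k).im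
  have hR : ∑ k ∈ t, (Y * d k).im * (Y * d k).re = R :=
    Finset.sum_congr rfl fun k _ => mul_comm _ _
  have h1 : ‖Y‖ ^ 2 * ∑ k ∈ t, ‖d k‖ ^ 2 = P + Q := by
    rw [Finset.mul_sum, ← Finset.sum_add_distrib]
    refine Finset.sum_congr rfl fun k _ => ?_
    rw [← mul_pow, ← norm_mul, Complex.sq_norm, Complex.normSq_apply]
  have h2 : Y ^ 2 * ∑ k ∈ t, d k ^ 2 = ⟨P - Q, 2 * R⟩ := by
    have e : Y ^ 2 * ∑ k ∈ t, d k ^ 2 = ∑ k ∈ t, (Y * d k) ^ 2 := by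
      rw [Finset.mul_sum]; exact Finset.sum_congr rfl fun k _ => by ring
    rw [e]
    apply Complex.ext
    · rw [Complex.re_sum, ← Finset.sum_sub_distrib]
      exact Finset.sum_congr rfl fun k _ => by rw [sq, Complex.mul_re]
    · rw [Complex.im_sum]
      simp only
      rw [Finset.mul_sum]
      exact Finset.sum_congr rfl fun k _ => by rw [sq, Complex.mul_im]; ring
  have h3 : ‖Y‖ ^ 4 * ‖∑ k ∈ t, d k ^ 2‖ ^ 2 = (P - Q) ^ 2 + (2 * R) ^ 2 := by
    have e : ‖Y‖ ^ 4 * ‖∑ k ∈ t, d k ^ 2‖ ^ 2 = ‖Y ^ 2 * ∑ k ∈ t, d k ^ 2‖ ^ 2 := by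
      rw [norm_mul, norm_pow]; ring
    rw [e, h2, Complex.sq_norm, Complex.normSq_apply]
    ring
  rw [hR]
  have h4 : ‖Y‖ ^ 4 * (((∑ k ∈ t, ‖d k‖ ^ 2) ^ 2 - ‖∑ k ∈ t, d k ^ 2‖ ^ 2) / 4) =
      ((‖Y‖ ^ 2 * ∑ k ∈ t, ‖d k‖ ^ 2) ^ 2 - ‖Y‖ ^ 4 * ‖∑ k ∈ t, d k ^ 2‖ ^ 2) / 4 := by ring
  rw [h4, h3, h1]
  ring

theorem det_processCov {ν ζ : ℝ} (hν : 0 < ν) (hb : CrossSection ν b)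
    (hI : IsAngularCutoff b ζ I) (hU : IsWeight b ζ U) (u t : ℝ) :
    (u • (1 : Matrix (Fin 2) (Fin 2) ℝ) + processCov b I U v x τ ρ z t).det =
      covDet u (chain b I U v x τ ρ z (jumpCount τ t)) := by
  set J := jumpCount τ t with hJ
  set Y := (chain b I U v x τ ρ z J).2.1
  set d := chainDirection b I U v x τ ρ z
  have hsum : ∀ i j : Fin 2, processCov b I U v x τ ρ z t i j = ∑ k ∈ Finset.range J,
      malliavinDeriv U (fun y => position b I v x τ ρ y J i) z (k + 1) *
        malliavinDeriv U (fun y => position b I v x τ ρ y J j) z (k + 1) := by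
    intro i j
    simp only [processCov, malliavinCov, Matrix.of_apply]
    rw [← hJ]
    exact sum_int_Icc_neg_one (fun k => malliavinDeriv U (fun y => position b I v x τ ρ y J i) z k *
        malliavinDeriv U (fun y => position b I v x τ ρ y J j) z k)
      (by rw [malliavinDeriv_position_of_nonpos (by norm_num), zero_mul])
      (by rw [malliavinDeriv_position_of_nonpos (by norm_num), zero_mul]) J
  have h0 : ∀ k ∈ Finset.range J, malliavinDeriv U (fun y => position b I v x τ ρ y J 0) z (k + 1) =
      (Y * d k).re := fun k hk =>
    (malliavinDeriv_position hν hb hI hU (Finset.mem_range.1 hk)).1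
  have h1 : ∀ k ∈ Finset.range J, malliavinDeriv U (fun y => position b I v x τ ρ y J 1) z (k + 1) =
      (Y * d k).im := fun k hk =>
    (malliavinDeriv_position hν hb hI hU (Finset.mem_range.1 hk)).2
  rw [Matrix.det_fin_two]
  simp only [Matrix.add_apply, Matrix.smul_apply, Matrix.one_apply_eq, smul_eq_mul, mul_one,
    Matrix.one_apply_ne (show (0 : Fin 2) ≠ 1 by decide),
    Matrix.one_apply_ne (show (1 : Fin 2) ≠ 0 by decide), mul_zero, zero_add, hsum]
  have e : ∀ g g' c c' : ℕ → ℝ, (∀ k ∈ Finset.range J, g k = c k) →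
      (∀ k ∈ Finset.range J, g' k = c' k) →
      ∑ k ∈ Finset.range J, g k * g' k = ∑ k ∈ Finset.range J, c k * c' k :=
    fun g g' c c' h h' => Finset.sum_congr rfl fun k hk => by rw [h k hk, h' k hk]
  rw [e _ _ _ _ h0 h0, e _ _ _ _ h1 h1, e _ _ _ _ h0 h1, e _ _ _ _ h1 h0, det_add_sum_sq,
    covDet, chain_sum_norm_sq, chain_sum_sq]

/-- The determinant of the covariance matrix is controlled by its analogue for the normalized
derivatives. -/
theorem pow_mul_le_covDet {u : ℝ} (hu : 0 ≤ u) {s : ChainState} (hY : ‖s.2.1‖ ≤ 1)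
    (hB : ‖s.2.2.2‖ ≤ s.2.2.1) :
    ‖s.2.1‖ ^ 4 * (u ^ 2 + u * s.2.2.1 + (s.2.2.1 ^ 2 - ‖s.2.2.2‖ ^ 2) / 4) ≤ covDet u s := by
  have hA : 0 ≤ s.2.2.1 := (norm_nonneg _).trans hB
  have h2 : ‖s.2.1‖ ^ 2 ≤ 1 := pow_le_one₀ (norm_nonneg _) hY
  have h4 : ‖s.2.1‖ ^ 4 ≤ 1 := pow_le_one₀ (norm_nonneg _) hY
  have h42 : ‖s.2.1‖ ^ 4 ≤ ‖s.2.1‖ ^ 2 := by nlinarith [sq_nonneg ‖s.2.1‖]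
  unfold covDet
  have e1 : ‖s.2.1‖ ^ 4 * u ^ 2 ≤ u ^ 2 := mul_le_of_le_one_left (sq_nonneg u) h4
  have e2 : u * (‖s.2.1‖ ^ 4 * s.2.2.1) ≤ u * (‖s.2.1‖ ^ 2 * s.2.2.1) := by gcongr
  linarith

end Covariance

/-! ### Multiplicative functionals of Poisson arrival times. -/

section Renewal

variable {Ω : Type*} [MeasurableSpace Ω] {P : Measure Ω} [IsProbabilityMeasure P]
  {τ : ℕ → Ω → ℝ} {lam : ℝ} {r e : ℝ → ℝ≥0∞}

/-- The arrival times of a renewal process as functions of the first `n` gaps. -/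
noncomputable def partialTime (n k : ℕ) (g : Finset.range n → ℝ) : ℝ :=
  ∑ i : Finset.range n, if (i : ℕ) < k then g i else 0

theorem measurable_partialTime (n k : ℕ) : Measurable (partialTime n k) := by
  unfold partialTime
  refine Finset.measurable_sum _ fun i _ => ?_
  by_cases h : (i : ℕ) < k
  · simp only [h, if_true]; fun_prop
  · simp only [h, if_false]; fun_prop

theorem partialTime_gaps (h0 : ∀ ω, τ 0 ω = 0) {n k : ℕ} (hk : k ≤ n) (ω : Ω) :
    partialTime n k (fun i : Finset.range n => τ (i + 1) ω - τ i ω) = τ k ω := by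
  unfold partialTime
  rw [Finset.sum_coe_sort (Finset.range n)
    (fun i => if i < k then τ (i + 1) ω - τ i ω else 0), ← Finset.sum_filter]
  have : (Finset.range n).filter (fun i => i < k) = Finset.range k := by
    ext i; simp only [Finset.mem_filter, Finset.mem_range]; omega
  rw [this, Finset.sum_range_sub (fun i => τ i ω), h0, sub_zero]

/-- Supersolutions of the renewal equation control multiplicative functionals of the arrival
times. -/
theorem lintegral_prod_arrival_le (hm : ∀ k, Measurable (τ k)) (h0 : ∀ ω, τ 0 ω = 0)
    (hlaw : ∀ k, P.map (fun ω => τ (k + 1) ω - τ k ω) = expMeasure lam)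
    (hind : iIndepFun (fun k ω => τ (k + 1) ω - τ k ω) P)
    (hr : Measurable r) (he : Measurable e)
    (hsuper : ∀ x, 0 ≤ x → ∫⁻ s, r (x + s) * e (x + s) ∂(expMeasure lam) ≤ e x)
    (hpos : ∀ᵐ ω ∂P, ∀ k, 0 ≤ τ k ω) (n : ℕ) :
    ∫⁻ ω, (∏ k ∈ Finset.range n, r (τ (k + 1) ω)) * e (τ n ω) ∂P ≤ e 0 := by
  induction n with
  | zero => simp [h0]
  | succ n ih =>
    have hgm : ∀ k, Measurable fun ω => τ (k + 1) ω - τ k ω := fun k => (hm _).sub (hm _)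
    -- The first n gaps determine τ₁, …, τ_n and are independent of the next gap. Integrating that
    -- gap first and applying the supersolution property at x = τ_n reduces n + 1 to n.
    set X : Ω → (Finset.range n → ℝ) := fun ω i => τ (i + 1) ω - τ i ω with hX
    have hXm : Measurable X := measurable_pi_lambda _ fun i => hgm i
    have hindep : IndepFun X (fun ω => τ (n + 1) ω - τ n ω) P := by
      have h1 := hind.indepFun_finset (Finset.range n) {n} (by simp) hgm
      have h2 : Measurable fun g : ({n} : Finset ℕ) → ℝ => g ⟨n, by simp⟩ := measurable_pi_apply _
      exact h1.comp measurable_id h2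
    have hmap := (indepFun_iff_map_prod_eq_prod_map_map hXm.aemeasurable
      (hgm n).aemeasurable).1 hindep
    have hprob : IsProbabilityMeasure (expMeasure lam) := by
      rw [← hlaw n]; exact Measure.isProbabilityMeasure_map (hgm n).aemeasurable
    rw [hlaw n] at hmap
    set W : (Finset.range n → ℝ) → ℝ≥0∞ := fun g =>
      ∏ k ∈ Finset.range n, r (partialTime n (k + 1) g) with hW
    have hWm : Measurable W :=
      Finset.measurable_prod _ fun k _ => hr.comp (measurable_partialTime n (k + 1))
    have hWX : ∀ ω, W (X ω) = ∏ k ∈ Finset.range n, r (τ (k + 1) ω) := fun ω =>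
      Finset.prod_congr rfl fun k hk => by
        rw [partialTime_gaps h0 (Nat.succ_le_of_lt (Finset.mem_range.1 hk))]
    have hTX : ∀ ω, partialTime n n (X ω) = τ n ω := fun ω => partialTime_gaps h0 le_rfl ω
    set H : (Finset.range n → ℝ) × ℝ → ℝ≥0∞ := fun p =>
      W p.1 * (r (partialTime n n p.1 + p.2) * e (partialTime n n p.1 + p.2)) with hH
    have hHm : Measurable H := by
      have hT : Measurable fun p : (Finset.range n → ℝ) × ℝ => partialTime n n p.1 + p.2 :=
        ((measurable_partialTime n n).comp measurable_fst).add measurable_snd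
      exact (hWm.comp measurable_fst).mul ((hr.comp hT).mul (he.comp hT))
    have e1 : ∫⁻ ω, (∏ k ∈ Finset.range (n + 1), r (τ (k + 1) ω)) * e (τ (n + 1) ω) ∂P =
        ∫⁻ ω, H (X ω, τ (n + 1) ω - τ n ω) ∂P := by
      refine lintegral_congr fun ω => ?_
      simp only [hH, hWX, hTX]
      rw [Finset.prod_range_succ, add_sub_cancel, mul_assoc]
    rw [e1, ← lintegral_map (f := H) hHm (hXm.prodMk (hgm n)), hmap, lintegral_prod _ hHm.aemeasurable,
      lintegral_map (hHm.lintegral_prod_right' (ν := expMeasure lam)) hXm]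
    refine le_trans (lintegral_mono_ae ?_) ih
    filter_upwards [hpos] with ω hω
    simp only [hH]
    rw [lintegral_const_mul]
    · rw [hWX, hTX]
      gcongr
      exact hsuper _ (hω n)
    · have hT : Measurable fun s : ℝ => partialTime n n (X ω) + s := by fun_prop
      exact (hr.comp hT).mul (he.comp hT)

theorem lintegral_expMeasure {g : ℝ → ℝ≥0∞} (hg : Measurable g) :
    ∫⁻ s, g s ∂(expMeasure lam) =
      ∫⁻ s in Ioi 0, ENNReal.ofReal (lam * Real.exp (-(lam * s))) * g s := by
  have hdef : expMeasure lam = volume.withDensity (exponentialPDF lam) := rfl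
  have hmeas : Measurable (exponentialPDF lam) := (measurable_exponentialPDFReal lam).ennreal_ofReal
  rw [hdef, lintegral_withDensity_eq_lintegral_mul _ hmeas hg, ← lintegral_indicator measurableSet_Ioi]
  have hne : ∀ᵐ s : ℝ, s ≠ 0 := by simp [ae_iff, measure_singleton]
  refine lintegral_congr_ae ?_
  filter_upwards [hne] with s hs
  rw [Pi.mul_apply]
  rcases lt_or_gt_of_ne hs with h | h
  · rw [exponentialPDF_of_neg h, indicator_of_notMem (by simp [h.le]), zero_mul]
  · rw [exponentialPDF_of_nonneg h.le, indicator_of_mem (by simpa using h)]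

/-- An exact solution of the renewal equation. -/
theorem lintegral_expMeasure_of_hasDerivAt (hlam : 0 < lam) {ρ E : ℝ → ℝ} (hρ : Continuous ρ)
    (hρ0 : ∀ x, 0 ≤ ρ x) (hE0 : ∀ x, 0 ≤ E x)
    (hE : ∀ x, HasDerivAt E (lam * (1 - ρ x) * E x) x) {B C : ℝ} (hB : ∀ x, B ≤ x → E x ≤ C)
    (x : ℝ) :
    ∫⁻ s, ENNReal.ofReal (ρ (x + s)) * ENNReal.ofReal (E (x + s)) ∂(expMeasure lam) ≤
      ENNReal.ofReal (E x) := by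
  have hEc : Continuous E := continuous_iff_continuousAt.2 fun x => (hE x).continuousAt
  rw [lintegral_expMeasure (by fun_prop)]
  -- The equation for E is what makes the integrand an exact derivative; the boundary term at
  -- infinity vanishes because E is eventually bounded.
  have hder : ∀ s ∈ Ici (0 : ℝ), HasDerivAt (fun s => -(Real.exp (-(lam * s)) * E (x + s)))
      (lam * Real.exp (-(lam * s)) * (ρ (x + s) * E (x + s))) s := by
    intro s _
    have h1 : HasDerivAt (fun s => Real.exp (-(lam * s))) (Real.exp (-(lam * s)) * (-(lam * 1))) s :=
      (((hasDerivAt_id s).const_mul lam).neg).exp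
    have h2 : HasDerivAt (fun s => E (x + s)) (lam * (1 - ρ (x + s)) * E (x + s)) s :=
      (hE (x + s)).comp_const_add x s
    exact (h1.mul h2).neg.congr_deriv (by ring)
  have hnn : ∀ s ∈ Ioi (0 : ℝ), 0 ≤ lam * Real.exp (-(lam * s)) * (ρ (x + s) * E (x + s)) :=
    fun s _ => mul_nonneg (by positivity) (mul_nonneg (hρ0 _) (hE0 _))
  have hlim : Filter.Tendsto (fun s => -(Real.exp (-(lam * s)) * E (x + s))) Filter.atTop
      (nhds 0) := by
    have h3 : Filter.Tendsto (fun s : ℝ => Real.exp (-(lam * s)) * C) Filter.atTop (nhds 0) := by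
      have : Filter.Tendsto (fun s : ℝ => Real.exp (-(lam * s))) Filter.atTop (nhds 0) :=
        Real.tendsto_exp_neg_atTop_nhds_zero.comp (Filter.tendsto_id.const_mul_atTop hlam)
      simpa using this.mul_const C
    have h4 : Filter.Tendsto (fun s => Real.exp (-(lam * s)) * E (x + s)) Filter.atTop (nhds 0) := by
      refine squeeze_zero' (Filter.Eventually.of_forall fun s =>
        mul_nonneg (Real.exp_pos _).le (hE0 _)) ?_ h3
      filter_upwards [Filter.eventually_ge_atTop (B - x)] with s hs
      exact mul_le_mul_of_nonneg_left (hB _ (by linarith)) (Real.exp_pos _).le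
    simpa using h4.neg
  have hint := integrableOn_Ioi_deriv_of_nonneg' hder hnn hlim
  have hval := integral_Ioi_of_hasDerivAt_of_nonneg' hder hnn hlim
  have e1 : ∀ s : ℝ, ENNReal.ofReal (lam * Real.exp (-(lam * s))) *
      (ENNReal.ofReal (ρ (x + s)) * ENNReal.ofReal (E (x + s))) =
      ENNReal.ofReal (lam * Real.exp (-(lam * s)) * (ρ (x + s) * E (x + s))) := fun s => by
    rw [← ENNReal.ofReal_mul (hρ0 _), ← ENNReal.ofReal_mul (by positivity)]
  simp_rw [e1]
  rw [← ofReal_integral_eq_lintegral_ofReal hint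
    ((ae_restrict_mem measurableSet_Ioi).mono fun s hs => hnn s hs), hval]
  simp

theorem ae_lt_arrival (hm : ∀ k, Measurable (τ k))
    (hlaw : ∀ k, P.map (fun ω => τ (k + 1) ω - τ k ω) = expMeasure lam) :
    ∀ᵐ ω ∂P, ∀ k, τ k ω < τ (k + 1) ω := by
  rw [ae_all_iff]
  intro k
  have hgm : Measurable fun ω => τ (k + 1) ω - τ k ω := (hm _).sub (hm _)
  have h1 : expMeasure lam (Iic 0) = 0 := by
    rw [← lintegral_indicator_one measurableSet_Iic, lintegral_expMeasure
      (measurable_one.indicator measurableSet_Iic)]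
    rw [setLIntegral_congr_fun (g := fun _ => 0) measurableSet_Ioi]
    · simp
    · intro s hs
      have : s ∉ Iic (0 : ℝ) := fun h => absurd (mem_Ioi.1 hs) (not_lt.2 h)
      simp [this]
  rw [← hlaw k, Measure.map_apply hgm measurableSet_Iic] at h1
  rw [ae_iff]
  refine measure_mono_null ?_ h1
  intro ω (hω : ¬ _)
  simp only [mem_preimage, mem_Iic]
  push Not at hω
  linarith

/-- Non-explosion: E(x) = e^{-x} solves the renewal equation with constant factor q = (λ+1)/λ > 1,
so qⁿ E[e^{-τ_n}] ≤ 1, and an event on which all arrivals stay below t has probability at most e^t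
q^{-n} for every n. -/
theorem ae_exists_arrival_gt (hlam : 0 < lam) (hm : ∀ k, Measurable (τ k)) (h0 : ∀ ω, τ 0 ω = 0)
    (hlaw : ∀ k, P.map (fun ω => τ (k + 1) ω - τ k ω) = expMeasure lam)
    (hind : iIndepFun (fun k ω => τ (k + 1) ω - τ k ω) P)
    (hpos : ∀ᵐ ω ∂P, ∀ k, 0 ≤ τ k ω) (t : ℝ) : ∀ᵐ ω ∂P, ∃ n, t < τ n ω := by
  set q := (lam + 1) / lam with hq
  have hq1 : 1 < q := by rw [hq, lt_div_iff₀ hlam]; linarith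
  have hsup : ∀ x : ℝ, 0 ≤ x → ∫⁻ s, ENNReal.ofReal ((fun _ => q) (x + s)) *
      ENNReal.ofReal (Real.exp (-(x + s))) ∂(expMeasure lam) ≤ ENNReal.ofReal (Real.exp (-x)) :=
    fun x _ => lintegral_expMeasure_of_hasDerivAt (E := fun x => Real.exp (-x)) hlam
      continuous_const (fun _ => by linarith) (fun _ => (Real.exp_pos _).le) (fun y => by
        have h1 := (hasDerivAt_neg y).exp
        refine h1.congr_deriv ?_
        rw [hq]; field_simp; ring) (B := 0) (C := 1)
      (fun y hy => Real.exp_le_one_iff.2 (by linarith)) x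
  have hbd : ∀ n : ℕ, ENNReal.ofReal q ^ n * P {ω | ∀ n, τ n ω ≤ t} ≤
      ENNReal.ofReal (Real.exp t) := by
    intro n
    have h1 := lintegral_prod_arrival_le (r := fun _ => ENNReal.ofReal q)
      (e := fun x => ENNReal.ofReal (Real.exp (-x))) hm h0 hlaw hind measurable_const
      (by fun_prop) hsup hpos n
    simp only [Finset.prod_const, Finset.card_range, neg_zero, Real.exp_zero,
      ENNReal.ofReal_one] at h1
    have hmeas : MeasurableSet {ω | ∀ n, τ n ω ≤ t} := by
      rw [Set.ofPred_forall]
      exact MeasurableSet.iInter fun n => measurableSet_le (hm n) measurable_const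
    have h2 : ENNReal.ofReal q ^ n * ENNReal.ofReal (Real.exp (-t)) * P {ω | ∀ n, τ n ω ≤ t} ≤ 1 := by
      rw [← setLIntegral_const]
      refine le_trans (setLIntegral_mono' hmeas fun ω hω => ?_)
        ((setLIntegral_le_lintegral _ _).trans h1)
      gcongr
      exact hω n
    have h3 : ENNReal.ofReal (Real.exp t) * ENNReal.ofReal (Real.exp (-t)) = 1 := by
      rw [← ENNReal.ofReal_mul (Real.exp_pos _).le, ← Real.exp_add]; simp
    calc ENNReal.ofReal q ^ n * P {ω | ∀ n, τ n ω ≤ t}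
        = ENNReal.ofReal (Real.exp t) * (ENNReal.ofReal q ^ n * ENNReal.ofReal (Real.exp (-t)) *
            P {ω | ∀ n, τ n ω ≤ t}) := by
          rw [← one_mul (ENNReal.ofReal q ^ n * P _), ← h3]; ring
      _ ≤ ENNReal.ofReal (Real.exp t) * 1 := by gcongr
      _ = _ := mul_one _
  have hzero : P {ω | ∀ n, τ n ω ≤ t} = 0 := by
    by_contra hne
    have hfin : P {ω | ∀ n, τ n ω ≤ t} ≠ ∞ := measure_ne_top _ _
    have hp : 0 < (P {ω | ∀ n, τ n ω ≤ t}).toReal := ENNReal.toReal_pos hne hfin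
    obtain ⟨n, hn⟩ := pow_unbounded_of_one_lt (Real.exp t / (P {ω | ∀ n, τ n ω ≤ t}).toReal) hq1
    have h1 := hbd n
    rw [← ENNReal.ofReal_toReal hfin, ← ENNReal.ofReal_pow (by linarith), ← ENNReal.ofReal_mul
      (by positivity), ENNReal.ofReal_le_ofReal_iff (Real.exp_pos _).le] at h1
    rw [div_lt_iff₀ hp] at hn
    linarith
  rw [ae_iff]
  simpa using hzero

end Renewal

/-! ### Measurability of the chain and dependence on past marks only. -/

section Measurability

variable {b I U : ℝ → ℝ} {v : ℝ → ℝ → Plane}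

theorem measurable_jumpDirection (hang : Measurable (angle b)) (hU : Measurable U)
    (hv : Measurable (Function.uncurry v)) :
    Measurable fun p : ℝ × ChainState × ℝ × ℝ => jumpDirection b U v p.1 p.2.1 p.2.2 := by
  unfold jumpDirection
  have h1 : Measurable fun p : ℝ × ChainState × ℝ × ℝ => angle b p.2.2.2 :=
    hang.comp (by fun_prop)
  have h2 : Measurable fun p : ℝ × ChainState × ℝ × ℝ => Real.tan (angle b p.2.2.2 / 2) := by
    simp_rw [Real.tan_eq_sin_div_cos]
    exact (Real.measurable_sin.comp (h1.div_const 2)).div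
      (Real.measurable_cos.comp (h1.div_const 2))
  have h3 : Measurable fun p : ℝ × ChainState × ℝ × ℝ => U p.2.2.2 * deriv (angle b) p.2.2.2 :=
    (hU.comp (by fun_prop)).mul ((measurable_deriv _).comp (by fun_prop))
  have h4 : Measurable fun p : ℝ × ChainState × ℝ × ℝ => v p.1 p.2.2.1 :=
    hv.comp (f := fun p : ℝ × ChainState × ℝ × ℝ => (p.1, p.2.2.1)) (by fun_prop)
  have h5 : Measurable fun p : ℝ × ChainState × ℝ × ℝ => toC (p.2.1.1 - v p.1 p.2.2.1) :=
    measurable_toC.comp (Measurable.sub (by fun_prop) h4)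
  have h6 : Measurable fun p : ℝ × ChainState × ℝ × ℝ => (p.2.1.2.1)⁻¹ :=
    Measurable.inv (by fun_prop)
  refine ((h6.mul ?_).mul ?_).mul h5
  · exact ((Complex.measurable_ofReal.comp h2).mul_const _).const_add _
  · exact (Complex.measurable_ofReal.comp h3).const_mul _

theorem measurable_chainStep (hang : Measurable (angle b)) (hI : Measurable I) (hU : Measurable U)
    (hv : Measurable (Function.uncurry v)) :
    Measurable fun p : ℝ × ChainState × ℝ × ℝ => chainStep b I U v p.1 p.2.1 p.2.2 := by
  unfold chainStep
  have hd := measurable_jumpDirection hang hU hv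
  have h1 : Measurable fun p : ℝ × ChainState × ℝ × ℝ => angle b p.2.2.2 :=
    hang.comp (by fun_prop)
  have h2 : Measurable fun p : ℝ × ChainState × ℝ × ℝ => I p.2.2.2 :=
    hI.comp (by fun_prop)
  have h4 : Measurable fun p : ℝ × ChainState × ℝ × ℝ => v p.1 p.2.2.1 :=
    hv.comp (f := fun p : ℝ × ChainState × ℝ × ℝ => (p.1, p.2.2.1)) (by fun_prop)
  refine Measurable.prodMk ?_ (Measurable.prodMk ?_ (Measurable.prodMk ?_ ?_))
  · refine Measurable.add (by fun_prop) (h2.smul ?_)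
    exact continuous_collide.measurable.comp
      (f := fun p : ℝ × ChainState × ℝ × ℝ => (angle b p.2.2.2, p.2.1.1 - v p.1 p.2.2.1))
      (h1.prodMk (Measurable.sub (by fun_prop) h4))
  · refine Measurable.mul (by fun_prop) ?_
    unfold contraction
    exact ((Complex.measurable_ofReal.comp h2).mul
      (continuous_collideC.measurable.comp h1)).const_add _
  · exact Measurable.add (by fun_prop) (hd.norm.pow_const 2)
  · exact Measurable.add (by fun_prop) (hd.pow_const 2)

theorem measurable_chain (hang : Measurable (angle b)) (hI : Measurable I) (hU : Measurable U)
    (hv : Measurable (Function.uncurry v)) {α : Type*} [MeasurableSpace α] {x : α → Plane}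
    {τ ρ : ℕ → α → ℝ} {z : ℤ → α → ℝ} (hx : Measurable x) (hτ : ∀ k, Measurable (τ k))
    (hρ : ∀ k, Measurable (ρ k)) (hz : ∀ k, Measurable (z k)) (k : ℕ) :
    Measurable fun a => chain b I U v (x a) (fun j => τ j a) (fun j => ρ j a) (fun j => z j a) k := by
  induction k with
  | zero => exact hx.prodMk measurable_const
  | succ k ih =>
    exact (measurable_chainStep hang hI hU hv).comp ((hτ _).prodMk (ih.prodMk
      ((hρ _).prodMk (hz _))))

theorem chain_congr {x : Plane} {τ ρ ρ' : ℕ → ℝ} {z z' : ℤ → ℝ} (k : ℕ)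
    (hρ : ∀ j < k, ρ (j + 1) = ρ' (j + 1)) (hz : ∀ j : ℕ, j < k → z (j + 1) = z' (j + 1)) :
    chain b I U v x τ ρ z k = chain b I U v x τ ρ' z' k := by
  induction k with
  | zero => rfl
  | succ k ih =>
    simp only [chain]
    rw [ih (fun j hj => hρ j (by omega)) (fun j hj => hz j (by omega)), hρ k (by omega),
      hz k (by omega)]

end Measurability

theorem jumpCount_eq {τ : ℕ → ℝ} (hτ : StrictMono τ) {t : ℝ} {n : ℕ} (h1 : τ n ≤ t)
    (h2 : t < τ (n + 1)) : jumpCount τ t = n := by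
  have : {k : ℕ | 1 ≤ k ∧ τ k ≤ t} = (Finset.Icc 1 n : Finset ℕ) := by
    ext k
    simp only [Finset.coe_Icc, mem_Icc]
    refine and_congr_right fun _ => ⟨fun h => ?_, fun h => (hτ.monotone h).trans h1⟩
    have := hτ.lt_iff_lt.1 (lt_of_le_of_lt h h2)
    omega
  rw [jumpCount, this, Set.ncard_coe_finset, Nat.card_Icc]
  omega

theorem arrival_bounds {τ : ℕ → ℝ} (hτ : StrictMono τ) {t : ℝ} (h0 : τ 0 ≤ t)
    (h : ∃ n, t < τ n) : τ (jumpCount τ t) ≤ t ∧ t < τ (jumpCount τ t + 1) := by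
  classical
  have hs := Nat.find_spec h
  have hm := fun m => Nat.find_min h (m := m)
  obtain ⟨N, hN⟩ : ∃ N, N = Nat.find h := ⟨_, rfl⟩
  rw [← hN] at hs hm
  rcases N with _ | n
  · linarith
  · have h1 : τ n ≤ t := not_lt.1 (hm n (by omega))
    rw [jumpCount_eq hτ h1 hs]
    exact ⟨h1, hs⟩

/-! ### From one-step conditional bounds to bounds at a fixed time. -/

section Markov

variable {Ω : Type*} [MeasurableSpace Ω] {P : Measure Ω} [IsProbabilityMeasure P]
  {γ : ℝ} {b χ χ₁ I U : ℝ → ℝ} {f : ℝ → Measure Plane} {v : ℝ → ℝ → Plane} {T η₀ ε ζ : ℝ}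
  {V₀ : Ω → Plane} {τ R : ℕ → Ω → ℝ} {Z : ℤ → Ω → ℝ}

variable (b I U v V₀ τ R Z) in
/-- The random state of the chain after `k` jumps. -/
noncomputable def stateAfter (k : ℕ) (ω : Ω) : ChainState :=
  chain b I U v (V₀ ω) (fun j => τ j ω) (fun j => R j ω) (fun j => Z j ω) k

variable (τ) in
/-- The indicator of the event that exactly `n` jumps occur up to time `t`. -/
noncomputable def countIndicator (t : ℝ) (n : ℕ) (ω : Ω) : ℝ≥0∞ :=
  indicator {g : ℕ → ℝ | g n ≤ t ∧ t < g (n + 1)} 1 (fun j => τ j ω)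

theorem measurableSet_count (t : ℝ) (n : ℕ) :
    MeasurableSet {g : ℕ → ℝ | g n ≤ t ∧ t < g (n + 1)} :=
  (measurableSet_le (measurable_pi_apply n) measurable_const).inter
    (measurableSet_lt measurable_const (measurable_pi_apply (n + 1)))

/-- One step of the chain, conditionally on the past. -/
theorem lintegral_stateAfter_succ_le
    (hS : IsRegularizedSystem P γ b χ χ₁ I f v T η₀ ε ζ V₀ τ R Z)
    (hang : Measurable (angle b)) (hθ : ∀ z, |angle b z| ≤ Real.pi / 2)
    (hI : Measurable I) (hI1 : ∀ z, I z ∈ Icc (0 : ℝ) 1) (hU : Measurable U)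
    (hv : Measurable (Function.uncurry v)) (hpos : ∀ᵐ ω ∂P, ∀ k, 0 ≤ τ k ω)
    {Ψ : ChainState → ℝ≥0∞} (hΨ : Measurable Ψ) {r : ℝ → ℝ≥0∞} {t : ℝ} (ht : t ≤ T)
    (hstep : ∀ t' ∈ Icc 0 t, ∀ s : ChainState, s.2.1 ≠ 0 → ‖s.2.1‖ ≤ 1 →
      ∫⁻ y in Icc (0 : ℝ) 1 ×ˢ ({0}ᶜ : Set ℝ), Ψ (chainStep b I U v t' s y) *
        ENNReal.ofReal (markDensity γ b χ χ₁ v η₀ ε ζ t' s.1 y.1 y.2) ≤ r t' * Ψ s)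
    (k : ℕ) {F : (ℕ → ℝ) → ℝ≥0∞} (hF : Measurable F) (hFt : ∀ g, F g ≠ ∞)
    (hF0 : ∀ g, F g ≠ 0 → g (k + 1) ≤ t) :
    ∫⁻ ω, Ψ (stateAfter b I U v V₀ τ R Z (k + 1) ω) * F (fun j => τ j ω) ∂P ≤
      ∫⁻ ω, Ψ (stateAfter b I U v V₀ τ R Z k ω) *
        (r (τ (k + 1) ω) * F (fun j => τ j ω)) ∂P := by
  classical
  -- The past in the conditional law records only k marks, indexed from 0, while the chain reads
  -- full sequences indexed from 1. The extension by 0 is harmless because `chain_congr` shows that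
  -- only the indices 1, …, k matter.
  set ext1 : (Fin k → ℝ × ℝ) → ℕ → ℝ := fun h j =>
    if hj : 1 ≤ j ∧ j ≤ k then (h ⟨j - 1, by omega⟩).1 else 0 with hext1
  set ext2 : (Fin k → ℝ × ℝ) → ℤ → ℝ := fun h j =>
    if hj : 1 ≤ j ∧ j ≤ k then (h ⟨(j - 1).toNat, by omega⟩).2 else 0 with hext2
  have hm1 : ∀ j, Measurable fun q : Plane × (ℕ → ℝ) × (Fin k → ℝ × ℝ) => ext1 q.2.2 j := by
    intro j
    simp only [hext1]
    split_ifs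
    · fun_prop
    · fun_prop
  have hm2 : ∀ j, Measurable fun q : Plane × (ℕ → ℝ) × (Fin k → ℝ × ℝ) => ext2 q.2.2 j := by
    intro j
    simp only [hext2]
    split_ifs
    · fun_prop
    · fun_prop
  set S : Plane × (ℕ → ℝ) × (Fin k → ℝ × ℝ) → ChainState := fun q =>
    chain b I U v q.1 (fun j => q.2.1 j) (fun j => ext1 q.2.2 j) (fun j => ext2 q.2.2 j) k with hSdef
  have hSm : Measurable S := measurable_chain
    (τ := fun j (q : Plane × (ℕ → ℝ) × (Fin k → ℝ × ℝ)) => q.2.1 j)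
    (ρ := fun j q => ext1 q.2.2 j) (z := fun j q => ext2 q.2.2 j) hang hI hU hv measurable_fst
    (fun j => by fun_prop) hm1 hm2 k
  set pst : Ω → Plane × (ℕ → ℝ) × (Fin k → ℝ × ℝ) := fun ω =>
    (V₀ ω, fun j => τ j ω, fun i : Fin k => (R (i + 1) ω, Z ((i : ℤ) + 1) ω)) with hpst
  have hSp : ∀ ω, S (pst ω) = stateAfter b I U v V₀ τ R Z k ω := by
    intro ω
    refine chain_congr k (fun j hj => ?_) (fun j hj => ?_)
    · simp only [hext1, hpst]
      rw [dif_pos ⟨by omega, by omega⟩]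
      simp
    · simp only [hext2, hpst]
      rw [dif_pos ⟨by omega, by omega⟩]
      simp
  set ψ : (Plane × (ℕ → ℝ) × (Fin k → ℝ × ℝ)) × (ℝ × ℝ) → ℝ≥0∞ := fun q =>
    F q.1.2.1 * Ψ (chainStep b I U v (q.1.2.1 (k + 1)) (S q.1) q.2) with hψ
  have hψm : Measurable ψ := by
    refine (hF.comp (by fun_prop)).mul (hΨ.comp ?_)
    exact (measurable_chainStep hang hI hU hv).comp
      (f := fun q : (Plane × (ℕ → ℝ) × (Fin k → ℝ × ℝ)) × (ℝ × ℝ) =>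
        (q.1.2.1 (k + 1), S q.1, q.2)) (Measurable.prodMk (by fun_prop)
        ((hSm.comp measurable_fst).prodMk measurable_snd))
  have hlaw := hS.law_mark k ψ hψm
  have hmeasT : MeasurableSet {ω | τ (k + 1) ω ≤ T} :=
    measurableSet_le (hS.measurable_τ _) measurable_const
  have hL : ∫⁻ ω, Ψ (stateAfter b I U v V₀ τ R Z (k + 1) ω) * F (fun j => τ j ω) ∂P =
      ∫⁻ ω in {ω | τ (k + 1) ω ≤ T}, ψ (pst ω, (R (k + 1) ω, Z ((k : ℤ) + 1) ω)) ∂P := by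
    rw [← lintegral_indicator hmeasT]
    refine lintegral_congr fun ω => ?_
    by_cases h : τ (k + 1) ω ≤ T
    · rw [indicator_of_mem (by exact h)]
      simp only [hψ]
      rw [hSp, mul_comm]
      rfl
    · rw [indicator_of_notMem (by exact h)]
      have : F (fun j => τ j ω) = 0 := by
        by_contra h0
        exact h ((hF0 _ h0).trans ht)
      rw [this, mul_zero]
  rw [hL, hlaw, ← lintegral_indicator hmeasT]
  refine lintegral_mono_ae ?_
  filter_upwards [hpos] with ω hω
  by_cases h0 : F (fun j => τ j ω) = 0
  · refine le_trans (le_of_eq ?_) zero_le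
    rw [indicator_apply]
    split_ifs
    · simp only [hψ, h0, zero_mul, lintegral_zero]
    · rfl
  · have h1 := hF0 _ h0
    rw [indicator_of_mem (by exact h1.trans ht)]
    have h2 := hstep (τ (k + 1) ω) ⟨hω _, h1⟩ (stateAfter b I U v V₀ τ R Z k ω)
      (chain_contraction_ne_zero hθ k) (norm_chain_contraction_le_one hI1 k)
    have h3 : (stateAfter b I U v V₀ τ R Z k ω).1 =
        position b I v (V₀ ω) (fun j => τ j ω) (fun j => R j ω) (fun j => Z j ω) k := chain_fst k
    rw [h3] at h2
    simp only [hψ]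
    change ∫⁻ y in Icc (0 : ℝ) 1 ×ˢ ({0}ᶜ : Set ℝ), F (fun j => τ j ω) *
      Ψ (chainStep b I U v (τ (k + 1) ω) (S (pst ω)) y) * _ ≤ _
    simp_rw [hSp, mul_assoc]
    calc _ = F (fun j => τ j ω) * _ := lintegral_const_mul' _ _ (hFt _)
      _ ≤ F (fun j => τ j ω) * (r (τ (k + 1) ω) * Ψ (stateAfter b I U v V₀ τ R Z k ω)) := by
        gcongr
      _ = _ := by ring

/-- Jumps are peeled off from the last one. Marks are conditioned on all arrival times, including
future ones, so the weight F may depend on the whole sequence of times and can absorb the factor r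
produced at each step; this is why the induction is over all F. -/
theorem lintegral_stateAfter_le
    (hS : IsRegularizedSystem P γ b χ χ₁ I f v T η₀ ε ζ V₀ τ R Z)
    (hang : Measurable (angle b)) (hθ : ∀ z, |angle b z| ≤ Real.pi / 2)
    (hI : Measurable I) (hI1 : ∀ z, I z ∈ Icc (0 : ℝ) 1) (hU : Measurable U)
    (hv : Measurable (Function.uncurry v)) (hpos : ∀ᵐ ω ∂P, ∀ k, 0 ≤ τ k ω)
    (hmono : ∀ᵐ ω ∂P, ∀ k, τ k ω < τ (k + 1) ω)
    {Ψ : ChainState → ℝ≥0∞} (hΨ : Measurable Ψ) (hΨ0 : ∀ x, Ψ (x, 1, 0, 0) ≤ 1)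
    {r : ℝ → ℝ≥0∞} (hr : Measurable r) (hrt : ∀ x, r x ≠ ∞) {t : ℝ} (ht : t ≤ T)
    (hstep : ∀ t' ∈ Icc 0 t, ∀ s : ChainState, s.2.1 ≠ 0 → ‖s.2.1‖ ≤ 1 →
      ∫⁻ y in Icc (0 : ℝ) 1 ×ˢ ({0}ᶜ : Set ℝ), Ψ (chainStep b I U v t' s y) *
        ENNReal.ofReal (markDensity γ b χ χ₁ v η₀ ε ζ t' s.1 y.1 y.2) ≤ r t' * Ψ s)
    (n : ℕ) {F : (ℕ → ℝ) → ℝ≥0∞} (hF : Measurable F) (hFt : ∀ g, F g ≠ ∞)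
    (hF0 : ∀ g, F g ≠ 0 → g n ≤ t) :
    ∫⁻ ω, Ψ (stateAfter b I U v V₀ τ R Z n ω) * F (fun j => τ j ω) ∂P ≤
      ∫⁻ ω, (∏ k ∈ Finset.range n, r (τ (k + 1) ω)) * F (fun j => τ j ω) ∂P := by
  induction n generalizing F with
  | zero =>
    refine lintegral_mono fun ω => ?_
    rw [Finset.prod_range_zero]
    gcongr
    exact hΨ0 _
  | succ n ih =>
    refine (lintegral_stateAfter_succ_le hS hang hθ hI hI1 hU hv hpos hΨ ht hstep n hF hFt
      hF0).trans ?_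
    have hM : MeasurableSet {g : ℕ → ℝ | g n < g (n + 1)} :=
      measurableSet_lt (measurable_pi_apply n) (measurable_pi_apply (n + 1))
    have hr1 : Measurable fun g : ℕ → ℝ => r (g (n + 1)) := hr.comp (measurable_pi_apply _)
    -- The induction needs the support condition for every sequence, not only for increasing ones.
    -- The indicator, almost surely equal to 1 along the arrival times, passes from g (n + 1) ≤ t to
    -- g n ≤ t.
    have h1 := ih (F := {g : ℕ → ℝ | g n < g (n + 1)}.indicator fun g => r (g (n + 1)) * F g)
      ((hr1.mul hF).indicator hM)
      (fun g => by
        rw [indicator_apply]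
        split_ifs
        · exact ENNReal.mul_ne_top (hrt _) (hFt _)
        · simp)
      (fun g hg => by
        have h2 := indicator_apply_ne_zero.1 hg
        have h3 : g n < g (n + 1) := h2.1
        have h4 : F g ≠ 0 := right_ne_zero_of_mul h2.2
        exact h3.le.trans (hF0 _ h4))
    have h5 : ∀ᵐ ω ∂P, {g : ℕ → ℝ | g n < g (n + 1)}.indicator (fun g => r (g (n + 1)) * F g)
        (fun j => τ j ω) = r (τ (n + 1) ω) * F (fun j => τ j ω) := by
      filter_upwards [hmono] with ω hω
      rw [indicator_of_mem (by exact hω n)]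
    refine (lintegral_congr_ae (h5.mono fun ω hω => ?_)).trans_le (h1.trans_eq
      (lintegral_congr_ae (h5.mono fun ω hω => ?_)))
    · rw [hω]
    · beta_reduce; rw [hω, Finset.prod_range_succ, mul_assoc]

/-- Replaces evaluation at the random index J_t by a sum over fixed indices, with one null set for
all g, so that g may itself depend on ω. -/
theorem ae_tsum_countIndicator (hmono : ∀ᵐ ω ∂P, ∀ k, τ k ω < τ (k + 1) ω)
    (h0 : ∀ ω, τ 0 ω = 0) {t : ℝ} (ht : 0 ≤ t) (hex : ∀ᵐ ω ∂P, ∃ n, t < τ n ω) :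
    ∀ᵐ ω ∂P, ∀ g : ℕ → ℝ≥0∞,
      g (jumpCount (fun k => τ k ω) t) = ∑' n, g n * countIndicator τ t n ω := by
  filter_upwards [hmono, hex] with ω h1 h2 g
  have hs : StrictMono fun k => τ k ω := strictMono_nat_of_lt_succ h1
  have hb := arrival_bounds hs (t := t) (by rw [h0]; exact ht) h2
  rw [tsum_eq_single (jumpCount (fun k => τ k ω) t)]
  · rw [countIndicator, indicator_of_mem (by exact hb)]
    simp
  · intro n hn
    rw [countIndicator, indicator_of_notMem, mul_zero]
    intro h
    exact hn (jumpCount_eq hs h.1 h.2).symm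

theorem measurable_countIndicator (hm : ∀ k, Measurable (τ k)) (t : ℝ) (n : ℕ) :
    Measurable (countIndicator τ t n) :=
  (measurable_one.indicator (measurableSet_count t n)).comp
    (measurable_pi_lambda _ fun k => hm k)

theorem measurable_stateAfter (hS : IsRegularizedSystem P γ b χ χ₁ I f v T η₀ ε ζ V₀ τ R Z)
    (hang : Measurable (angle b)) (hI : Measurable I) (hU : Measurable U)
    (hv : Measurable (Function.uncurry v)) (n : ℕ) :
    Measurable (stateAfter b I U v V₀ τ R Z n) :=
  measurable_chain hang hI hU hv hS.measurable_V₀ hS.measurable_τ hS.measurable_R hS.measurable_Z n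

/-- If each jump at time `t'` multiplies the conditional expectation of `Ψ` by at most
`1 + c θ(t')`, then the expectation of `Ψ` after the jumps is at most `exp (λ c ∫ θ)`. -/
theorem lintegral_stateAfter_jumpCount_le
    (hS : IsRegularizedSystem P γ b χ χ₁ I f v T η₀ ε ζ V₀ τ R Z)
    (hlam : 0 < rate γ b η₀ ε ζ)
    (hang : Measurable (angle b)) (hθ : ∀ z, |angle b z| ≤ Real.pi / 2)
    (hI : Measurable I) (hI1 : ∀ z, I z ∈ Icc (0 : ℝ) 1) (hU : Measurable U)
    (hv : Measurable (Function.uncurry v))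
    {Ψ : ChainState → ℝ≥0∞} (hΨ : Measurable Ψ) (hΨ0 : ∀ x, Ψ (x, 1, 0, 0) ≤ 1)
    {t : ℝ} (ht0 : 0 ≤ t) (ht : t ≤ T) {c B : ℝ} {θ : ℝ → ℝ} (hθc : Continuous θ)
    (hc : ∀ x, 0 ≤ 1 + c * θ x) (hct : ∀ x, t < x → 0 ≤ c * θ x) (hB : ∀ x, B ≤ x → θ x = 0)
    (hstep : ∀ t' ∈ Icc 0 t, ∀ s : ChainState, s.2.1 ≠ 0 → ‖s.2.1‖ ≤ 1 →
      ∫⁻ y in Icc (0 : ℝ) 1 ×ˢ ({0}ᶜ : Set ℝ), Ψ (chainStep b I U v t' s y) *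
        ENNReal.ofReal (markDensity γ b χ χ₁ v η₀ ε ζ t' s.1 y.1 y.2) ≤
          ENNReal.ofReal (1 + c * θ t') * Ψ s) :
    ∫⁻ ω, Ψ (stateAfter b I U v V₀ τ R Z (jumpCount (fun k => τ k ω) t) ω) ∂P ≤
      ENNReal.ofReal (Real.exp (rate γ b η₀ ε ζ * c * ∫ x in (0 : ℝ)..B, θ x)) := by
  set lam := rate γ b η₀ ε ζ with hlamdef
  have hmono := ae_lt_arrival hS.measurable_τ hS.law_gap
  have hpos : ∀ᵐ ω ∂P, ∀ k, 0 ≤ τ k ω := by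
    filter_upwards [hmono] with ω hω k
    rw [← hS.τ_zero ω]
    exact (strictMono_nat_of_lt_succ (f := fun k => τ k ω) hω).monotone (Nat.zero_le k)
  have hex := fun t => ae_exists_arrival_gt hlam hS.measurable_τ hS.τ_zero hS.law_gap hS.indep_gap
    hpos t
  set r : ℝ → ℝ≥0∞ := fun x => ENNReal.ofReal (1 + c * θ x) with hr
  have hrm : Measurable r := by fun_prop
  -- Solution of E' = λ(1 - r)E with r = 1 + cθ, equal to 1 beyond B. Continuity of θ is used here,
  -- to differentiate the integral at every point.
  set E : ℝ → ℝ := fun x => Real.exp (lam * c * ∫ y in x..B, θ y) with hE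
  have hEd : ∀ x, HasDerivAt E (lam * (1 - (1 + c * θ x)) * E x) x := by
    intro x
    have h1 : HasDerivAt (fun x => ∫ y in x..B, θ y) (-θ x) x :=
      intervalIntegral.integral_hasDerivAt_left (hθc.intervalIntegrable _ _)
        (hθc.stronglyMeasurableAtFilter _ _) hθc.continuousAt
    exact (h1.const_mul (lam * c)).exp.congr_deriv (by ring)
  have hE1 : ∀ x, B ≤ x → E x = 1 := by
    intro x hx
    have : ∫ y in x..B, θ y = 0 := by
      rw [intervalIntegral.integral_congr (g := fun _ => (0 : ℝ))]
      · simp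
      · intro y hy
        rw [uIcc_of_ge hx] at hy
        exact hB y hy.1
    simp only [hE, this, mul_zero, Real.exp_zero]
  have hEc : Continuous E := continuous_iff_continuousAt.2 fun x => (hEd x).continuousAt
  set e : ℝ → ℝ≥0∞ := fun x => ENNReal.ofReal (E x) with he
  have hem : Measurable e := by fun_prop
  have hren := fun n => lintegral_prod_arrival_le (r := r) (e := e) hS.measurable_τ hS.τ_zero
    hS.law_gap hS.indep_gap hrm hem
    (fun x _ => lintegral_expMeasure_of_hasDerivAt hlam (ρ := fun x => 1 + c * θ x) (by fun_prop) hc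
      (fun x => (Real.exp_pos _).le) hEd (B := B) (C := 1) (fun x hx => (hE1 x hx).le) x) hpos n
  have hJ := ae_tsum_countIndicator hmono hS.τ_zero ht0 (hex t)
  have hcm := measurable_countIndicator hS.measurable_τ t
  have hsm := measurable_stateAfter hS hang hI hU hv
  calc ∫⁻ ω, Ψ (stateAfter b I U v V₀ τ R Z (jumpCount (fun k => τ k ω) t) ω) ∂P
      = ∫⁻ ω, ∑' n, Ψ (stateAfter b I U v V₀ τ R Z n ω) * countIndicator τ t n ω ∂P :=
        lintegral_congr_ae (hJ.mono fun ω hω => hω fun n => Ψ (stateAfter b I U v V₀ τ R Z n ω))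
    _ = ∑' n, ∫⁻ ω, Ψ (stateAfter b I U v V₀ τ R Z n ω) * countIndicator τ t n ω ∂P :=
        lintegral_tsum fun n => ((hΨ.comp (hsm n)).mul (hcm n)).aemeasurable
    _ ≤ ∑' n, ∫⁻ ω, (∏ k ∈ Finset.range n, r (τ (k + 1) ω)) * countIndicator τ t n ω ∂P := by
        refine ENNReal.tsum_le_tsum fun n => ?_
        refine lintegral_stateAfter_le hS hang hθ hI hI1 hU hv hpos hmono hΨ hΨ0 hrm
          (fun x => ENNReal.ofReal_ne_top) ht hstep n
          (measurable_one.indicator (measurableSet_count t n)) (fun g => ?_) fun g hg => ?_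
        · rw [indicator_apply]; split_ifs <;> simp
        · exact (mem_of_indicator_ne_zero hg).1
    _ = ∫⁻ ω, ∑' n, (∏ k ∈ Finset.range n, r (τ (k + 1) ω)) * countIndicator τ t n ω ∂P :=
        (lintegral_tsum fun n => ((Finset.measurable_prod _ fun k _ =>
          hrm.comp (hS.measurable_τ _)).mul (hcm n)).aemeasurable).symm
    _ = ∫⁻ ω, ∏ k ∈ Finset.range (jumpCount (fun k => τ k ω) t), r (τ (k + 1) ω) ∂P :=
        lintegral_congr_ae (hJ.mono fun ω hω =>
          (hω fun n => ∏ k ∈ Finset.range n, r (τ (k + 1) ω)).symm)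
    -- Factors attached to jumps after t are at least 1, and e(τ_n) = 1 once τ_n exceeds B. The
    -- product over the jumps before t is thus eventually dominated by the renewal functional, and
    -- Fatou's lemma applies.
    _ ≤ ∫⁻ ω, Filter.liminf (fun n => (∏ k ∈ Finset.range n, r (τ (k + 1) ω)) * e (τ n ω))
          Filter.atTop ∂P := by
        refine lintegral_mono_ae ?_
        filter_upwards [hmono, hex t, hex B] with ω h1 h2 h3
        have hs : StrictMono fun k => τ k ω := strictMono_nat_of_lt_succ h1
        have hb := arrival_bounds hs (t := t) (by rw [hS.τ_zero]; exact ht0) h2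
        obtain ⟨N, hN⟩ := h3
        refine Filter.le_liminf_of_le (by isBoundedDefault) ?_
        filter_upwards [Filter.eventually_ge_atTop N,
          Filter.eventually_ge_atTop (jumpCount (fun k => τ k ω) t)] with n h4 h5
        have h6 : e (τ n ω) = 1 := by
          simp only [he]
          rw [hE1 _ (hN.le.trans (hs.monotone h4)), ENNReal.ofReal_one]
        rw [h6, mul_one, ← Finset.prod_range_mul_prod_Ico _ h5]
        refine le_mul_of_one_le_right zero_le (Finset.one_le_prod' fun k hk => ?_)
        have h7 : t < τ (k + 1) ω := hb.2.trans_le (hs.monotone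
          (Nat.succ_le_succ (Finset.mem_Ico.1 hk).1))
        simp only [hr]
        rw [← ENNReal.ofReal_one]
        exact ENNReal.ofReal_le_ofReal (by linarith [hct _ h7])
    _ ≤ Filter.liminf (fun n => ∫⁻ ω, (∏ k ∈ Finset.range n, r (τ (k + 1) ω)) * e (τ n ω) ∂P)
          Filter.atTop := by
        refine lintegral_liminf_le fun n => ?_
        exact (Finset.measurable_prod _ fun k _ => hrm.comp (hS.measurable_τ _)).mul
          (hem.comp (hS.measurable_τ _))
    _ ≤ e 0 := by
        refine Filter.liminf_le_of_frequently_le' (Filter.Frequently.of_forall hren)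

end Markov

/-! ### Bounds for the regularized modulus φ_ε. -/

section Mollified

variable {χ : ℝ → ℝ} {η₀ ε : ℝ}

theorem IsEvenMollifier.integrable (hχ : IsEvenMollifier χ) : Integrable χ := by
  by_contra h
  have := hχ.integral
  rw [integral_undef h] at this
  norm_num at this

theorem integrable_mollifier_scaled (hχ : IsEvenMollifier χ) (hε : 0 < ε) (x : ℝ) :
    Integrable fun y => χ ((x - y) / ε) / ε :=
  ((hχ.integrable.comp_div hε.ne').comp_sub_left x).div_const ε

theorem integral_mollifier_scaled (hχ : IsEvenMollifier χ) (hε : 0 < ε) (x : ℝ) :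
    ∫ y, χ ((x - y) / ε) / ε = 1 := by
  rw [integral_div, integral_sub_left_eq_self (fun y => χ (y / ε)) volume x,
    Measure.integral_comp_div, hχ.integral, abs_of_pos hε]
  simp [hε.ne']

theorem integrable_phi (hχ : IsEvenMollifier χ) (hε : 0 < ε) (hΓ : 0 ≤ Gam η₀ ε) (x : ℝ) :
    Integrable fun y => min (max y (2 * ε)) (Gam η₀ ε) * (χ ((x - y) / ε) / ε) := by
  refine (integrable_mollifier_scaled hχ hε x).bdd_mul (c := Gam η₀ ε)
    (by fun_prop) (Filter.Eventually.of_forall fun y => ?_)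
  rw [Real.norm_eq_abs, abs_of_nonneg]
  · exact min_le_right _ _
  · exact le_min (le_max_of_le_right (by positivity)) hΓ

theorem phi_le (hχ : IsEvenMollifier χ) (hε : 0 < ε) (hΓ : 0 ≤ Gam η₀ ε) (x : ℝ) :
    phi χ η₀ ε x ≤ Gam η₀ ε := by
  calc phi χ η₀ ε x ≤ ∫ y, Gam η₀ ε * (χ ((x - y) / ε) / ε) := by
        refine integral_mono (integrable_phi hχ hε hΓ x)
          ((integrable_mollifier_scaled hχ hε x).const_mul _) fun y => ?_
        exact mul_le_mul_of_nonneg_right (min_le_right _ _) (div_nonneg (hχ.nonneg _) hε.le)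
    _ = Gam η₀ ε := by rw [integral_const_mul, integral_mollifier_scaled hχ hε, mul_one]

theorem le_phi (hχ : IsEvenMollifier χ) (hε : 0 < ε) (hΓ : 0 ≤ Gam η₀ ε) (x : ℝ) :
    min (max (x - ε) (2 * ε)) (Gam η₀ ε) ≤ phi χ η₀ ε x := by
  calc min (max (x - ε) (2 * ε)) (Gam η₀ ε)
      = ∫ y, min (max (x - ε) (2 * ε)) (Gam η₀ ε) * (χ ((x - y) / ε) / ε) := by
        rw [integral_const_mul, integral_mollifier_scaled hχ hε, mul_one]
    _ ≤ phi χ η₀ ε x := by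
        refine integral_mono ((integrable_mollifier_scaled hχ hε x).const_mul _)
          (integrable_phi hχ hε hΓ x) fun y => ?_
        by_cases h : χ ((x - y) / ε) = 0
        · simp [h]
        · have h1 := (hχ.support h).2
          rw [div_lt_one hε] at h1
          refine mul_le_mul_of_nonneg_right ?_ (div_nonneg (hχ.nonneg _) hε.le)
          gcongr
          linarith

theorem phi_nonneg (hχ : IsEvenMollifier χ) (hε : 0 < ε) (hΓ : 0 ≤ Gam η₀ ε) (x : ℝ) :
    0 ≤ phi χ η₀ ε x :=
  (le_min (le_max_of_le_right (by positivity)) hΓ).trans (le_phi hχ hε hΓ x)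

/-- If a ≤ 2ε the floor of the truncation suffices; otherwise the mollification moves x by less than
ε ≤ a/2. The bound is thus uniform in ε. -/
theorem le_phi_of_le (hχ : IsEvenMollifier χ) (hε : 0 < ε) {a x : ℝ} (hΓ : a ≤ Gam η₀ ε)
    (hΓ0 : 0 ≤ Gam η₀ ε) (hx : 3 / 2 * a ≤ x) : a ≤ phi χ η₀ ε x := by
  refine le_trans (le_min ?_ hΓ) (le_phi hχ hε hΓ0 x)
  rcases le_total a (2 * ε) with h | h
  · exact le_max_of_le_right h
  · exact le_max_of_le_left (by linarith)

theorem measurable_phi (hχ : IsEvenMollifier χ) : Measurable (phi χ η₀ ε) := by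
  have hc : Measurable χ := hχ.smooth.continuous.measurable
  have h1 : Measurable (Function.uncurry fun x y : ℝ =>
      min (max y (2 * ε)) (Gam η₀ ε) * (χ ((x - y) / ε) / ε)) := by
    unfold Function.uncurry
    fun_prop
  exact h1.stronglyMeasurable.integral_prod_right.measurable

end Mollified

/-! ### The law of one mark and the moments of the contraction. -/

section Marks

variable {γ ν η₀ ε ζ t : ℝ} {b χ χ₁ I U : ℝ → ℝ} {v : ℝ → ℝ → Plane} {w : Plane}

theorem IsBumpDensity.lintegral (hχ₁ : IsBumpDensity χ₁) (a : ℝ) :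
    ∫⁻ z, ENNReal.ofReal (χ₁ (z - a)) = 1 := by
  have hint : Integrable χ₁ := by
    by_contra h
    have := hχ₁.integral
    rw [integral_undef h] at this
    norm_num at this
  rw [lintegral_sub_right_eq_self (fun z => ENNReal.ofReal (χ₁ z)) a,
    ← ofReal_integral_eq_lintegral_ofReal hint
      (Filter.Eventually.of_forall fun z => (hχ₁.mem_Icc z).1), hχ₁.integral, ENNReal.ofReal_one]

variable (hγ : 0 < γ) (hχ : IsEvenMollifier χ) (hχ₁ : IsBumpDensity χ₁) (hε : 0 < ε)
  (hΓ : 1 ≤ Gam η₀ ε) (hG : 0 ≤ angG b ζ) (hv : Measurable (Function.uncurry v))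

include hγ hχ hε hΓ in
theorem phi_rpow_mem (x : ℝ) : phi χ η₀ ε x ^ γ ∈ Icc 0 (Gam η₀ ε ^ γ) := by
  have h0 := phi_nonneg hχ hε (zero_le_one.trans hΓ) x
  exact ⟨Real.rpow_nonneg h0 _,
    Real.rpow_le_rpow h0 (phi_le hχ hε (zero_le_one.trans hΓ) x) hγ.le⟩

include hχ hv in
theorem measurable_phi_rpow (t : ℝ) (w : Plane) :
    Measurable fun ρ => phi χ η₀ ε ‖w - v t ρ‖ ^ γ := by
  have h1 : Measurable (v t) := hv.comp (f := fun ρ : ℝ => (t, ρ)) (by fun_prop)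
  exact ((measurable_phi hχ).comp ((h1.const_sub w).norm)).pow_const γ

include hγ hχ hε hΓ hv in
theorem integrable_phi_rpow (t : ℝ) (w : Plane) :
    Integrable (fun ρ => phi χ η₀ ε ‖w - v t ρ‖ ^ γ) (volume.restrict (Icc (0 : ℝ) 1)) := by
  refine Integrable.of_bound (measurable_phi_rpow hχ hv t w).aestronglyMeasurable (Gam η₀ ε ^ γ)
    (Filter.Eventually.of_forall fun ρ => ?_)
  have := phi_rpow_mem hγ hχ hε hΓ ‖w - v t ρ‖
  rw [Real.norm_eq_abs, abs_of_nonneg this.1]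
  exact this.2

include hγ hχ hε hΓ hv in
theorem half_le_fictitiousProb (t : ℝ) (w : Plane) : 1 / 2 ≤ fictitiousProb γ χ v η₀ ε t w := by
  have hg : 0 < Gam η₀ ε ^ γ := Real.rpow_pos_of_pos (by linarith) _
  have h1 : ∫ ρ in Icc (0 : ℝ) 1, phi χ η₀ ε ‖w - v t ρ‖ ^ γ ≤ Gam η₀ ε ^ γ := by
    calc _ ≤ ∫ ρ in Icc (0 : ℝ) 1, Gam η₀ ε ^ γ :=
          integral_mono (integrable_phi_rpow hγ hχ hε hΓ hv t w) (integrable_const _)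
            fun ρ => (phi_rpow_mem hγ hχ hε hΓ _).2
      _ = _ := by simp
  unfold fictitiousProb
  have h2 : 1 / (2 * Gam η₀ ε ^ γ) * ∫ ρ in Icc (0 : ℝ) 1, phi χ η₀ ε ‖w - v t ρ‖ ^ γ ≤
      1 / (2 * Gam η₀ ε ^ γ) * Gam η₀ ε ^ γ := by gcongr
  have h3 : 1 / (2 * Gam η₀ ε ^ γ) * Gam η₀ ε ^ γ = 1 / 2 := by field_simp
  linarith

include hΓ hG in
theorem rate_pos : 0 < rate γ b η₀ ε ζ := by
  have hg : 0 < Gam η₀ ε ^ γ := Real.rpow_pos_of_pos (by linarith) _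
  unfold rate
  positivity

include hχ hχ₁ hv in
theorem measurable_markDensity (t : ℝ) (w : Plane) :
    Measurable fun y : ℝ × ℝ => markDensity γ b χ χ₁ v η₀ ε ζ t w y.1 y.2 := by
  have h2 : Measurable χ₁ := hχ₁.smooth.continuous.measurable
  have h3 : Measurable fun z : ℝ =>
      (Icc (-(angG b ζ + 1)) (angG b ζ + 1)).indicator (fun _ => (1 : ℝ)) z :=
    measurable_const.indicator measurableSet_Icc
  unfold markDensity
  refine Measurable.add (Measurable.const_mul (h2.comp (by fun_prop)) _) (Measurable.mul
    (Measurable.div_const ?_ _) (h3.comp measurable_snd))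
  exact (measurable_phi_rpow (γ := γ) hχ hv t w).comp measurable_fst

include hχ₁ in
-- The fictitious marks lie between G(ζ) + 2 and G(ζ) + 4, disjoint from the range where a jump can
-- act.
theorem markDensity_of_abs_le {z : ℝ} (hz : |z| ≤ angG b ζ + 1) (ρ : ℝ) :
    markDensity γ b χ χ₁ v η₀ ε ζ t w ρ z =
      phi χ η₀ ε ‖w - v t ρ‖ ^ γ / rate γ b η₀ ε ζ := by
  have h1 : χ₁ (z - angG b ζ - 3) = 0 := by
    by_contra h
    have := (hχ₁.support h).1
    linarith [le_abs_self z]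
  rw [markDensity, h1, indicator_of_mem (by exact abs_le.1 hz)]
  ring

include hγ hχ hχ₁ hε hΓ hG hv in
-- With λ = 4(G(ζ)+1)Γ^γ, integrating the second term over an interval of length 2(G(ζ)+1) gives
-- exactly the mass removed from 1 in `fictitiousProb`. Only the upper bound on the total mass is
-- needed.
theorem lintegral_markDensity_le (t : ℝ) (w : Plane) :
    ∫⁻ y in Icc (0 : ℝ) 1 ×ˢ ({0}ᶜ : Set ℝ),
      ENNReal.ofReal (markDensity γ b χ χ₁ v η₀ ε ζ t w y.1 y.2) ≤ 1 := by
  have hg : 0 < Gam η₀ ε ^ γ := Real.rpow_pos_of_pos (by linarith) _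
  have hrate : 0 < rate γ b η₀ ε ζ := rate_pos hΓ hG
  have hf := half_le_fictitiousProb hγ hχ hε hΓ hv t w
  have hm := (measurable_markDensity (γ := γ) (b := b) (η₀ := η₀) (ε := ε) (ζ := ζ) hχ hχ₁ hv t
    w).ennreal_ofReal
  have hinner : ∀ ρ, ∫⁻ z, ENNReal.ofReal (markDensity γ b χ χ₁ v η₀ ε ζ t w ρ z) =
      ENNReal.ofReal (fictitiousProb γ χ v η₀ ε t w) + ENNReal.ofReal
        (1 / (2 * Gam η₀ ε ^ γ) * phi χ η₀ ε ‖w - v t ρ‖ ^ γ) := by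
    intro ρ
    have hφ := (phi_rpow_mem hγ hχ hε hΓ ‖w - v t ρ‖).1
    have e1 : ∀ z, ENNReal.ofReal (markDensity γ b χ χ₁ v η₀ ε ζ t w ρ z) =
        ENNReal.ofReal (fictitiousProb γ χ v η₀ ε t w) *
          ENNReal.ofReal (χ₁ (z - (angG b ζ + 3))) +
        (Icc (-(angG b ζ + 1)) (angG b ζ + 1)).indicator (fun _ =>
          ENNReal.ofReal (phi χ η₀ ε ‖w - v t ρ‖ ^ γ / rate γ b η₀ ε ζ)) z := by
      intro z
      have h1 : z - angG b ζ - 3 = z - (angG b ζ + 3) := by ring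
      rw [markDensity, h1, ENNReal.ofReal_add (mul_nonneg (by linarith) (hχ₁.mem_Icc _).1)
        (mul_nonneg (by positivity) (indicator_nonneg (fun _ _ => zero_le_one) _)),
        ENNReal.ofReal_mul (by linarith)]
      congr 1
      simp only [indicator_apply]
      split_ifs <;> simp
    simp_rw [e1]
    have hχm : Measurable χ₁ := hχ₁.smooth.continuous.measurable
    rw [lintegral_add_left (by fun_prop), lintegral_const_mul _ (by fun_prop), hχ₁.lintegral,
      mul_one, lintegral_indicator_const measurableSet_Icc, Real.volume_Icc,
      ← ENNReal.ofReal_mul (by positivity)]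
    congr 2
    unfold rate
    have : angG b ζ + 1 ≠ 0 := by positivity
    field_simp
    ring
  calc _ ≤ ∫⁻ y in Icc (0 : ℝ) 1 ×ˢ (univ : Set ℝ),
        ENNReal.ofReal (markDensity γ b χ χ₁ v η₀ ε ζ t w y.1 y.2) :=
        lintegral_mono_set (prod_mono_right (subset_univ _))
    _ = ∫⁻ ρ in Icc (0 : ℝ) 1, ∫⁻ z, ENNReal.ofReal (markDensity γ b χ χ₁ v η₀ ε ζ t w ρ z) := by
        rw [Measure.volume_eq_prod, ← Measure.prod_restrict, Measure.restrict_univ,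
          lintegral_prod _ hm.aemeasurable]
    _ = ENNReal.ofReal (fictitiousProb γ χ v η₀ ε t w) + ENNReal.ofReal
        (1 / (2 * Gam η₀ ε ^ γ) * ∫ ρ in Icc (0 : ℝ) 1, phi χ η₀ ε ‖w - v t ρ‖ ^ γ) := by
        simp_rw [hinner]
        rw [lintegral_add_left measurable_const, ← integral_const_mul,
          ofReal_integral_eq_lintegral_ofReal
            ((integrable_phi_rpow hγ hχ hε hΓ hv t w).const_mul _)
            (Filter.Eventually.of_forall fun ρ => mul_nonneg (by positivity)
              (phi_rpow_mem hγ hχ hε hΓ _).1)]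
        simp
    _ ≤ 1 := by
        rw [← ENNReal.ofReal_add (by linarith) (mul_nonneg (by positivity)
          (integral_nonneg fun ρ => (phi_rpow_mem hγ hχ hε hΓ _).1)), ← ENNReal.ofReal_one]
        exact ENNReal.ofReal_le_ofReal (by unfold fictitiousProb; linarith)

/-- Marks beyond the angular cutoff are fictitious. -/
theorem chainStep_of_cutoff (hI : IsAngularCutoff b ζ I) (hU : IsWeight b ζ U) (s : ChainState)
    {y : ℝ × ℝ} (hy : angG b ζ + 1 ≤ |y.2|) : chainStep b I U v t s y = s := by
  have h1 := hI.eq_zero _ hy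
  have h2 := hU.eq_zero_of_ge y.2 (by linarith)
  have h3 : jumpDirection b U v t s y = 0 := by simp [jumpDirection, h2]
  simp [chainStep, h1, h3, contraction]

include hγ hχ hχ₁ hε hΓ hG hv in
/-- One jump increases negative moments of the contraction by a factor `1 + O(Γ ^ γ / λ)`. -/
theorem lintegral_norm_contraction_step_le (hang : Measurable (angle b))
    (hθ : ∀ z, |angle b z| ≤ Real.pi / 2) (hI : IsAngularCutoff b ζ I)
    (hU : IsWeight b ζ U) {K r : ℝ} (hK : 0 ≤ K)
    (hKb : ∫⁻ z, ENNReal.ofReal (angle b z ^ 2) ≤ ENNReal.ofReal K) (hr : 0 ≤ r) (t : ℝ)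
    (s : ChainState) :
    ∫⁻ y in Icc (0 : ℝ) 1 ×ˢ ({0}ᶜ : Set ℝ),
      ENNReal.ofReal (‖(chainStep b I U v t s y).2.1‖ ^ (-r)) *
        ENNReal.ofReal (markDensity γ b χ χ₁ v η₀ ε ζ t s.1 y.1 y.2) ≤
      ENNReal.ofReal (1 + r * Real.exp (3 * r) * K * Gam η₀ ε ^ γ / rate γ b η₀ ε ζ) *
        ENNReal.ofReal (‖s.2.1‖ ^ (-r)) := by
  have hg : 0 < Gam η₀ ε ^ γ := Real.rpow_pos_of_pos (by linarith) _
  have hrate : 0 < rate γ b η₀ ε ζ := rate_pos hΓ hG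
  have hC : 0 ≤ r * Real.exp (3 * r) := by positivity
  obtain ⟨C, hCdef⟩ : ∃ C, C = r * Real.exp (3 * r) := ⟨_, rfl⟩
  rw [← hCdef] at hC ⊢
  -- Bound for the density of the marks that can act. The excess produced by a jump is then at most
  -- C a ∫ϑ², with no dependence on G(ζ) apart from λ.
  obtain ⟨a, ha⟩ : ∃ a, a = Gam η₀ ε ^ γ / rate γ b η₀ ε ζ := ⟨_, rfl⟩
  have ha0 : 0 ≤ a := by rw [ha]; positivity
  have hpt : ∀ y : ℝ × ℝ, ENNReal.ofReal (‖(chainStep b I U v t s y).2.1‖ ^ (-r)) *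
      ENNReal.ofReal (markDensity γ b χ χ₁ v η₀ ε ζ t s.1 y.1 y.2) ≤
      ENNReal.ofReal (‖s.2.1‖ ^ (-r)) * (ENNReal.ofReal (markDensity γ b χ χ₁ v η₀ ε ζ t s.1 y.1 y.2) +
        ENNReal.ofReal (C * a) * ENNReal.ofReal (angle b y.2 ^ 2)) := by
    intro y
    rcases le_total (angG b ζ + 1) |y.2| with h | h
    · rw [chainStep_of_cutoff hI hU s h]
      gcongr
      exact le_self_add
    · have hq := markDensity_of_abs_le (γ := γ) (χ := χ) (η₀ := η₀) (ε := ε) (t := t) (w := s.1)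
        (v := v) hχ₁ h y.1
      have hφ := phi_rpow_mem hγ hχ hε hΓ ‖s.1 - v t y.1‖
      obtain ⟨q, hqdef⟩ : ∃ q, q = markDensity γ b χ χ₁ v η₀ ε ζ t s.1 y.1 y.2 := ⟨_, rfl⟩
      rw [← hqdef] at hq ⊢
      have hq0 : 0 ≤ q := by rw [hq]; exact div_nonneg hφ.1 hrate.le
      have hqa : q ≤ a := by rw [hq, ha]; exact div_le_div_of_nonneg_right hφ.2 hrate.le
      have h1 := norm_contraction_rpow_neg_le (s := I y.2) (hθ y.2) hr
      rw [← hCdef] at h1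
      have h2 : 0 ≤ ‖s.2.1‖ ^ (-r) := Real.rpow_nonneg (norm_nonneg _) _
      simp only [chainStep]
      rw [norm_mul, Real.mul_rpow (norm_nonneg _) (norm_nonneg _), ← ENNReal.ofReal_mul
        (mul_nonneg h2 (Real.rpow_nonneg (norm_nonneg _) _)), ← ENNReal.ofReal_mul (by positivity),
        ← ENNReal.ofReal_add hq0 (by positivity), ← ENNReal.ofReal_mul h2]
      apply ENNReal.ofReal_le_ofReal
      rw [mul_assoc]
      refine mul_le_mul_of_nonneg_left ?_ h2
      calc _ ≤ (1 + C * angle b y.2 ^ 2) * q := by gcongr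
        _ = q + C * angle b y.2 ^ 2 * q := by ring
        _ ≤ q + C * angle b y.2 ^ 2 * a := by gcongr
        _ = _ := by ring
  have hm := (measurable_markDensity (γ := γ) (b := b) (η₀ := η₀) (ε := ε) (ζ := ζ) hχ hχ₁ hv t
    s.1).ennreal_ofReal
  have hang2 : Measurable fun z => ENNReal.ofReal (angle b z ^ 2) := (hang.pow_const 2).ennreal_ofReal
  have hang3 : ∫⁻ y in Icc (0 : ℝ) 1 ×ˢ ({0}ᶜ : Set ℝ), ENNReal.ofReal (angle b y.2 ^ 2) ≤
      ENNReal.ofReal K := by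
    calc _ ≤ ∫⁻ y in Icc (0 : ℝ) 1 ×ˢ (univ : Set ℝ), ENNReal.ofReal (angle b y.2 ^ 2) :=
          lintegral_mono_set (prod_mono_right (subset_univ _))
      _ = ∫⁻ ρ in Icc (0 : ℝ) 1, ∫⁻ z, ENNReal.ofReal (angle b z ^ 2) := by
          rw [Measure.volume_eq_prod, ← Measure.prod_restrict, Measure.restrict_univ,
            lintegral_prod (fun y : ℝ × ℝ => ENNReal.ofReal (angle b y.2 ^ 2))
              (hang2.comp measurable_snd).aemeasurable]
      _ ≤ ENNReal.ofReal K := by simpa using hKb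
  calc _ ≤ ∫⁻ y in Icc (0 : ℝ) 1 ×ˢ ({0}ᶜ : Set ℝ), ENNReal.ofReal (‖s.2.1‖ ^ (-r)) *
        (ENNReal.ofReal (markDensity γ b χ χ₁ v η₀ ε ζ t s.1 y.1 y.2) +
          ENNReal.ofReal (C * a) * ENNReal.ofReal (angle b y.2 ^ 2)) := lintegral_mono hpt
    _ = ENNReal.ofReal (‖s.2.1‖ ^ (-r)) * ((∫⁻ y in Icc (0 : ℝ) 1 ×ˢ ({0}ᶜ : Set ℝ),
          ENNReal.ofReal (markDensity γ b χ χ₁ v η₀ ε ζ t s.1 y.1 y.2)) +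
        ENNReal.ofReal (C * a) * ∫⁻ y in Icc (0 : ℝ) 1 ×ˢ ({0}ᶜ : Set ℝ),
          ENNReal.ofReal (angle b y.2 ^ 2)) := by
        rw [lintegral_const_mul' _ _ ENNReal.ofReal_ne_top, lintegral_add_left hm,
          lintegral_const_mul' _ _ ENNReal.ofReal_ne_top]
    _ ≤ ENNReal.ofReal (‖s.2.1‖ ^ (-r)) * (1 + ENNReal.ofReal (C * a) * ENNReal.ofReal K) := by
        gcongr
        exact lintegral_markDensity_le hγ hχ hχ₁ hε hΓ hG hv t s.1
    _ = _ := by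
        rw [← ENNReal.ofReal_mul (by positivity), ← ENNReal.ofReal_one, ← ENNReal.ofReal_add
          zero_le_one (by positivity), mul_comm, ha]
        congr 3
        ring

end Marks

/-! ### Decrease of the Laplace functional at a jump. -/

/-- The exponential functional of the state whose average over `ξ` controls the determinant. -/
noncomputable def covExp (ξ : ℂ) (s : ChainState) : ℝ :=
  Real.exp (-((‖ξ‖ ^ 2 * s.2.2.1 + ((starRingEnd ℂ) ξ ^ 2 * s.2.2.2).re) / 2))

theorem measurable_covExp (ξ : ℂ) : Measurable (covExp ξ) := by
  unfold covExp
  have : Measurable fun s : ChainState => ((starRingEnd ℂ) ξ ^ 2 * s.2.2.2).re :=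
    Complex.measurable_re.comp (Measurable.const_mul (by fun_prop) _)
  fun_prop

/-- Shows that along the chain `covExp ξ` is exp(-∑(Re(conj(ξ) d_k))²), although it is a function of
the two accumulated sums only. -/
theorem norm_sq_add_re_sq (ξ d : ℂ) :
    ‖ξ‖ ^ 2 * ‖d‖ ^ 2 + ((starRingEnd ℂ) ξ ^ 2 * d ^ 2).re = 2 * ((starRingEnd ℂ) ξ * d).re ^ 2 := by
  rw [Complex.sq_norm, Complex.sq_norm, Complex.normSq_apply, Complex.normSq_apply]
  simp only [pow_two, Complex.mul_re, Complex.mul_im, Complex.conj_re, Complex.conj_im]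
  ring

theorem covExp_chainStep (b I U : ℝ → ℝ) (v : ℝ → ℝ → Plane) (ξ : ℂ) (t : ℝ) (s : ChainState)
    (y : ℝ × ℝ) :
    covExp ξ (chainStep b I U v t s y) =
      Real.exp (-((starRingEnd ℂ) ξ * jumpDirection b U v t s y).re ^ 2) * covExp ξ s := by
  unfold covExp
  simp only [chainStep]
  rw [← Real.exp_add]
  congr 1
  have := norm_sq_add_re_sq ξ (jumpDirection b U v t s y)
  rw [mul_add, mul_add, Complex.add_re]
  linarith

theorem re_conj_mul_jumpDirection (b U : ℝ → ℝ) (v : ℝ → ℝ → Plane) (ξ : ℂ) (t : ℝ)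
    (s : ChainState) (y : ℝ × ℝ) :
    ((starRingEnd ℂ) ξ * jumpDirection b U v t s y).re = U y.2 * deriv (angle b) y.2 / 2 *
      (((starRingEnd ℂ) ξ * s.2.1⁻¹ * Complex.I * toC (s.1 - v t y.1)).re -
        Real.tan (angle b y.2 / 2) *
          ((starRingEnd ℂ) ξ * s.2.1⁻¹ * Complex.I * toC (s.1 - v t y.1)).im) := by
  obtain ⟨W, hW⟩ : ∃ W, W = (starRingEnd ℂ) ξ * s.2.1⁻¹ * Complex.I * toC (s.1 - v t y.1) :=
    ⟨_, rfl⟩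
  have : (starRingEnd ℂ) ξ * jumpDirection b U v t s y =
      ((U y.2 * deriv (angle b) y.2 / 2 : ℝ) : ℂ) *
        ((1 + (Real.tan (angle b y.2 / 2) : ℝ) * Complex.I) * W) := by
    rw [hW, jumpDirection]; push_cast; ring
  rw [this, Complex.re_ofReal_mul, ← hW]
  generalize Real.tan (angle b y.2 / 2) = T
  simp only [Complex.mul_re, Complex.add_re, Complex.add_im, Complex.one_re, Complex.one_im,
    Complex.mul_im, Complex.ofReal_re, Complex.ofReal_im, Complex.I_re, Complex.I_im]
  ring

section Decay

variable {γ ν η₀ ε ζ t : ℝ} {b χ χ₁ I U : ℝ → ℝ} {v : ℝ → ℝ → Plane}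

theorem tan_half_angle_nonneg (hν : 0 < ν) (hb : CrossSection ν b) {z : ℝ} (hz : 0 < z) :
    0 ≤ Real.tan (angle b z / 2) := by
  have h := angle_mem hν hb hz
  refine Real.tan_nonneg_of_nonneg_of_le_pi_div_two (by linarith [h.1]) ?_
  linarith [h.2, Real.pi_pos]

/-- Markov-type inequality: the truncated distance is at most κ/2 plus the indicator of the set
where the distance is at least κ/2. -/
theorem affine_measure_ge {μ : Measure Plane} [IsProbabilityMeasure μ] {κ p q c : ℝ}
    (h : κ ≤ ∫ x, min 1 |affineForm p q c x| ∂μ) :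
    ENNReal.ofReal (κ / 2) ≤ μ {x | κ / 2 ≤ |affineForm p q c x|} := by
  rcases le_or_gt κ 0 with hκ | hκ
  · rw [ENNReal.ofReal_of_nonpos (by linarith)]; exact zero_le
  have hm : Measurable (affineForm p q c) := by unfold affineForm; fun_prop
  have hms : MeasurableSet {x | κ / 2 ≤ |affineForm p q c x|} :=
    measurableSet_le measurable_const (by fun_prop)
  have h1 : ∫ x, min 1 |affineForm p q c x| ∂μ ≤
      ∫ x, (κ / 2 + {x | κ / 2 ≤ |affineForm p q c x|}.indicator (fun _ => (1 : ℝ)) x) ∂μ := by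
    refine integral_mono (integrable_min_abs_affineForm μ p q c)
      ((integrable_const _).add ((integrable_const _).indicator hms)) fun x => ?_
    beta_reduce
    rw [indicator_apply]
    split_ifs with hx
    · linarith [min_le_left 1 |affineForm p q c x|]
    · have : |affineForm p q c x| < κ / 2 := not_le.1 hx
      linarith [min_le_right 1 |affineForm p q c x|]
  rw [integral_add (integrable_const _) ((integrable_const _).indicator hms),
    integral_indicator_const _ hms] at h1
  simp only [integral_const, probReal_univ, smul_eq_mul, mul_one] at h1
  rw [ENNReal.ofReal_le_iff_le_toReal (measure_ne_top _ _)]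
  change _ ≤ μ.real _
  linarith

theorem covExp_step_le
    (hγ : 0 < γ) (hχ : IsEvenMollifier χ)
    (hχ₁ : IsBumpDensity χ₁) (hε : 0 < ε)
    (hΓ : 1 ≤ Gam η₀ ε) (hG : 0 ≤ angG b ζ) (hv : Measurable (Function.uncurry v))
    (t : ℝ) (ξ : ℂ) (s : ChainState) :
    ∫⁻ y in Icc (0 : ℝ) 1 ×ˢ ({0}ᶜ : Set ℝ), ENNReal.ofReal (covExp ξ (chainStep b I U v t s y)) *
        ENNReal.ofReal (markDensity γ b χ χ₁ v η₀ ε ζ t s.1 y.1 y.2) ≤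
      ENNReal.ofReal (covExp ξ s) := by
  calc _ ≤ ∫⁻ y in Icc (0 : ℝ) 1 ×ˢ ({0}ᶜ : Set ℝ), ENNReal.ofReal (covExp ξ s) *
        ENNReal.ofReal (markDensity γ b χ χ₁ v η₀ ε ζ t s.1 y.1 y.2) := by
        refine lintegral_mono fun y => ?_
        gcongr
        rw [covExp_chainStep]
        refine mul_le_of_le_one_left (Real.exp_pos _).le (Real.exp_le_one_iff.2 ?_)
        linarith [sq_nonneg ((starRingEnd ℂ) ξ * jumpDirection b U v t s y).re]
    _ ≤ _ := by
        rw [lintegral_const_mul' _ _ ENNReal.ofReal_ne_top]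
        exact mul_le_of_le_one_right zero_le
          (lintegral_markDensity_le hγ hχ hχ₁ hε hΓ hG hv t s.1)

/-- When `f_t` is not concentrated near a line, one jump decreases the exponential functional. -/
theorem covExp_step_le_of_nondegenerate
    (hγ : 0 < γ) (hν : 0 < ν) (hb : CrossSection ν b) (hχ : IsEvenMollifier χ)
    (hχ₁ : IsBumpDensity χ₁) (hε : 0 < ε)
    (hΓ : 1 ≤ Gam η₀ ε) (hG : 0 ≤ angG b ζ) (hv : Measurable (Function.uncurry v))
    (hU : IsWeight b ζ U) {κ c₀ : ℝ} (hκ : 0 < κ) (hκ1 : κ ≤ 1)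
    (hc₀ : 0 < c₀) (hder : ∀ z, 1 ≤ |z| → c₀ * |z| ^ (-((1 + ν) / ν)) ≤ |deriv (angle b) z|)
    {t : ℝ} {μ : Measure Plane} [IsProbabilityMeasure μ]
    (hlaw : (volume.restrict (Icc (0 : ℝ) 1)).map (v t) = μ)
    (hnd : ∀ p q c, p ^ 2 + q ^ 2 = 1 → κ ≤ ∫ x, min 1 |affineForm p q c x| ∂μ)
    {ξ : ℂ} (hξ : ξ ≠ 0) (s : ChainState) (hs0 : s.2.1 ≠ 0) (hs1 : ‖s.2.1‖ ≤ 1) :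
    ∫⁻ y in Icc (0 : ℝ) 1 ×ˢ ({0}ᶜ : Set ℝ), ENNReal.ofReal (covExp ξ (chainStep b I U v t s y)) *
        ENNReal.ofReal (markDensity γ b χ χ₁ v η₀ ε ζ t s.1 y.1 y.2) ≤
      ENNReal.ofReal (1 - (1 - Real.exp (-(c₀ ^ 2 * κ ^ 2 / 16))) * (κ / 3) ^ γ * (κ / 2) *
        max 0 (min (‖ξ‖ ^ (ν / (1 + ν))) (angG b ζ - 1) - 1) / rate γ b η₀ ε ζ) *
          ENNReal.ofReal (covExp ξ s) := by
  have hrate : 0 < rate γ b η₀ ε ζ := rate_pos hΓ hG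
  have hvt : Measurable (v t) := hv.comp (f := fun ρ : ℝ => (t, ρ)) (by fun_prop)
  obtain ⟨Zm, hZ⟩ : ∃ Z, Z = min (‖ξ‖ ^ (ν / (1 + ν))) (angG b ζ - 1) := ⟨_, rfl⟩
  obtain ⟨a, ha⟩ : ∃ a, a = (1 - Real.exp (-(c₀ ^ 2 * κ ^ 2 / 16))) * (κ / 3) ^ γ /
    rate γ b η₀ ε ζ := ⟨_, rfl⟩
  have hc1 : 0 ≤ 1 - Real.exp (-(c₀ ^ 2 * κ ^ 2 / 16)) := by
    rw [sub_nonneg, Real.exp_le_one_iff]; have : 0 ≤ c₀ ^ 2 * κ ^ 2 / 16 := by positivity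
    linarith
  have ha0 : 0 ≤ a := by rw [ha]; positivity
  obtain ⟨w, hw⟩ : ∃ w, w = (starRingEnd ℂ) ξ * s.2.1⁻¹ * Complex.I := ⟨_, rfl⟩
  have hwn : ‖ξ‖ ≤ ‖w‖ := by
    rw [hw, norm_mul, norm_mul, Complex.norm_I, mul_one, norm_inv, RCLike.norm_conj]
    exact le_mul_of_one_le_right (norm_nonneg _) ((one_le_inv₀ (norm_pos_iff.2 hs0)).2 hs1)
  have hξ0 : 0 < ‖ξ‖ := norm_pos_iff.2 hξ
  have hw0 : 0 < ‖w‖ := hξ0.trans_le hwn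
  have hwsq : w.re ^ 2 + w.im ^ 2 = ‖w‖ ^ 2 := by
    rw [Complex.sq_norm, Complex.normSq_apply]; ring
  -- The line determined by ξ and the current state: it passes through the current position, and the
  -- real part of w times the relative velocity is -|w| times the affine form at v_t(ρ). Since |Y| ≤
  -- 1, |w| is at least |ξ|.
  obtain ⟨p, hp⟩ : ∃ p, p = w.re / ‖w‖ := ⟨_, rfl⟩
  obtain ⟨q, hq⟩ : ∃ q, q = -w.im / ‖w‖ := ⟨_, rfl⟩
  have hpq : p ^ 2 + q ^ 2 = 1 := by
    rw [hp, hq, div_pow, div_pow, neg_sq, ← add_div, hwsq, div_self (by positivity)]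
  obtain ⟨c, hc⟩ : ∃ c, c = p * s.1 0 + q * s.1 1 := ⟨_, rfl⟩
  have hre : ∀ ρ, (w * toC (s.1 - v t ρ)).re = -(‖w‖ * affineForm p q c (v t ρ)) := by
    intro ρ
    have e1 : ‖w‖ * p = w.re := by rw [hp]; field_simp
    have e2 : ‖w‖ * q = -w.im := by rw [hq]; field_simp
    rw [Complex.mul_re, toC_re, toC_im, affineForm, hc]
    simp only [PiLp.sub_apply]
    linear_combination (-(s.1 0) + v t ρ 0) * e1 + (-(s.1 1) + v t ρ 1) * e2
  have hnorm : ∀ ρ, |affineForm p q c (v t ρ)| ≤ ‖s.1 - v t ρ‖ := by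
    intro ρ
    have h1 : ‖w‖ * |affineForm p q c (v t ρ)| ≤ ‖w‖ * ‖s.1 - v t ρ‖ := by
      rw [← abs_of_pos hw0, ← abs_mul, abs_of_pos hw0, ← abs_neg, ← hre, ← norm_toC, ← norm_mul]
      exact Complex.abs_re_le_norm _
    exact le_of_mul_le_mul_left h1 hw0
  -- the good parameters, split according to the sign of the mark that is used
  obtain ⟨D, hD⟩ : ∃ D, D = Icc (0 : ℝ) 1 ∩ {ρ | κ / 2 ≤ |affineForm p q c (v t ρ)|} := ⟨_, rfl⟩
  obtain ⟨Q, hQ⟩ : ∃ Q, Q = {ρ | (w * toC (s.1 - v t ρ)).re * (w * toC (s.1 - v t ρ)).im ≤ 0} :=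
    ⟨_, rfl⟩
  have hmaff : Measurable (affineForm p q c) := by unfold affineForm; fun_prop
  have hDm : MeasurableSet D := by
    rw [hD]
    exact measurableSet_Icc.inter (measurableSet_le measurable_const
      ((hmaff.comp hvt).abs))
  have hQm : MeasurableSet Q := by
    rw [hQ]
    have : Measurable fun ρ => w * toC (s.1 - v t ρ) :=
      (measurable_toC.comp (hvt.const_sub s.1)).const_mul w
    exact measurableSet_le ((Complex.measurable_re.comp this).mul
      (Complex.measurable_im.comp this)) measurable_const
  have hDvol : ENNReal.ofReal (κ / 2) ≤ volume D := by
    refine (affine_measure_ge (hnd p q c hpq)).trans ?_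
    rw [← hlaw, Measure.map_apply hvt (measurableSet_le measurable_const (by fun_prop)),
      Measure.restrict_apply (hvt (measurableSet_le measurable_const (by fun_prop))), hD, inter_comm]
    rfl
  obtain ⟨W, hW⟩ : ∃ W, W = (D ∩ Q) ×ˢ Ioo 1 Zm ∪ (D \ Q) ×ˢ Ioo (-Zm) (-1) := ⟨_, rfl⟩
  have hWm : MeasurableSet W := by
    rw [hW]
    exact ((hDm.inter hQm).prod measurableSet_Ioo).union ((hDm.diff hQm).prod measurableSet_Ioo)
  have hWvol : ENNReal.ofReal (κ / 2) * ENNReal.ofReal (Zm - 1) ≤ volume W := by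
    rw [hW, measure_union (disjoint_left.2 fun y h1 h2 => h2.1.2 h1.1.2)
      ((hDm.diff hQm).prod measurableSet_Ioo), Measure.volume_eq_prod, Measure.prod_prod,
      Measure.prod_prod, Real.volume_Ioo, Real.volume_Ioo,
      show -1 - -Zm = Zm - 1 by ring, ← add_mul, measure_inter_add_sdiff D hQm]
    gcongr
  have hWsub : W ⊆ Icc (0 : ℝ) 1 ×ˢ ({0}ᶜ : Set ℝ) := by
    rw [hW, hD]
    rintro y (h | h)
    · refine ⟨h.1.1.1, fun h0 => ?_⟩
      have h1 : y.2 = 0 := h0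
      linarith [h.2.1]
    · refine ⟨h.1.1.1, fun h0 => ?_⟩
      have h1 : y.2 = 0 := h0
      linarith [h.2.2]
  have hWprop : ∀ y ∈ W, κ / 2 ≤ |affineForm p q c (v t y.1)| ∧ 1 < |y.2| ∧ |y.2| < Zm ∧
      |(w * toC (s.1 - v t y.1)).re| ≤ |(w * toC (s.1 - v t y.1)).re -
        Real.tan (angle b y.2 / 2) * (w * toC (s.1 - v t y.1)).im| := by
    -- For each ρ, the sign of z is chosen so that tan(ϑ(z)/2) times the imaginary part does not
    -- have the sign of the real part; subtracting it can only increase the modulus.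
    have key : ∀ A B : ℝ, A * B ≤ 0 → |A| ≤ |A - B| := by
      intro A B h
      rw [← sq_le_sq]
      nlinarith [sq_nonneg B]
    rw [hW, hD, hQ]
    rintro y (h | h)
    · have hz : 0 < y.2 := by linarith [h.2.1]
      have hT := tan_half_angle_nonneg hν hb hz
      refine ⟨h.1.1.2, ?_, ?_, key _ _ ?_⟩
      · rw [abs_of_pos hz]; exact h.2.1
      · rw [abs_of_pos hz]; exact h.2.2
      · have h3 : (w * toC (s.1 - v t y.1)).re * (w * toC (s.1 - v t y.1)).im ≤ 0 := h.1.2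
        nlinarith
    · have hz : y.2 < 0 := by linarith [h.2.2]
      have hT := tan_half_angle_nonneg hν hb (neg_pos.2 hz)
      rw [angle_neg, neg_div, Real.tan_neg] at hT
      refine ⟨h.1.1.2, ?_, ?_, key _ _ ?_⟩
      · rw [abs_of_neg hz]; linarith [h.2.2]
      · rw [abs_of_neg hz]; linarith [h.2.1]
      · have h3 : 0 < (w * toC (s.1 - v t y.1)).re * (w * toC (s.1 - v t y.1)).im := not_le.1 h.1.2
        nlinarith
  have hpt : ∀ y : ℝ × ℝ, ENNReal.ofReal (covExp ξ (chainStep b I U v t s y)) *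
        ENNReal.ofReal (markDensity γ b χ χ₁ v η₀ ε ζ t s.1 y.1 y.2) +
      W.indicator (fun _ => ENNReal.ofReal (a * covExp ξ s)) y ≤
      ENNReal.ofReal (covExp ξ s) *
        ENNReal.ofReal (markDensity γ b χ χ₁ v η₀ ε ζ t s.1 y.1 y.2) := by
    intro y
    have hE : 0 < covExp ξ s := Real.exp_pos _
    rw [covExp_chainStep]
    by_cases hy : y ∈ W
    · obtain ⟨h1, h2, h3, h4⟩ := hWprop y hy
      rw [indicator_of_mem hy]
      have hZ1 : Zm ≤ ‖ξ‖ ^ (ν / (1 + ν)) := by rw [hZ]; exact min_le_left _ _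
      have hZ2 : Zm ≤ angG b ζ - 1 := by rw [hZ]; exact min_le_right _ _
      have hU1 : U y.2 = 1 := hU.eq_one _ ⟨h2, h3.trans_le hZ2⟩
      have hX : c₀ ^ 2 * κ ^ 2 / 16 ≤ ((starRingEnd ℂ) ξ * jumpDirection b U v t s y).re ^ 2 := by
        rw [re_conj_mul_jumpDirection, ← hw, hU1, one_mul]
        -- The cutoff |z| < |ξ|^{ν/(1+ν)} is exactly what makes the decay |z|^{-(1+ν)/ν} of ϑ'
        -- compensated by |ξ|.
        have e1 : c₀ ≤ |deriv (angle b) y.2| * ‖ξ‖ := by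
          have h5 := hder y.2 h2.le
          have h6 : |y.2| ^ ((1 + ν) / ν) ≤ ‖ξ‖ := by
            calc |y.2| ^ ((1 + ν) / ν) ≤ (‖ξ‖ ^ (ν / (1 + ν))) ^ ((1 + ν) / ν) := by
                  apply Real.rpow_le_rpow (abs_nonneg _) (h3.le.trans hZ1) (by positivity)
              _ = ‖ξ‖ := by
                  rw [← Real.rpow_mul hξ0.le]
                  have : ν / (1 + ν) * ((1 + ν) / ν) = 1 := by field_simp
                  rw [this, Real.rpow_one]
          have hz0 : 0 < |y.2| := by linarith
          have h7 : |y.2| ^ (-((1 + ν) / ν)) * |y.2| ^ ((1 + ν) / ν) = 1 := by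
            rw [← Real.rpow_add hz0]; simp
          calc c₀ = c₀ * |y.2| ^ (-((1 + ν) / ν)) * |y.2| ^ ((1 + ν) / ν) := by
                rw [mul_assoc, h7, mul_one]
            _ ≤ |deriv (angle b) y.2| * ‖ξ‖ :=
                mul_le_mul h5 h6 (by positivity) (abs_nonneg _)
        have e2 : ‖ξ‖ * (κ / 2) ≤ |(w * toC (s.1 - v t y.1)).re -
            Real.tan (angle b y.2 / 2) * (w * toC (s.1 - v t y.1)).im| := by
          refine le_trans ?_ h4
          rw [hre, abs_neg, abs_mul, abs_of_pos hw0]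
          exact mul_le_mul hwn h1 (by positivity) hw0.le
        rw [← sq_abs (_ * _), abs_mul, abs_div, abs_two]
        calc c₀ ^ 2 * κ ^ 2 / 16 = (c₀ * (κ / 2) / 2) ^ 2 := by ring
          _ ≤ (|deriv (angle b) y.2| * ‖ξ‖ * (κ / 2) / 2) ^ 2 := by gcongr
          _ = (|deriv (angle b) y.2| / 2 * (‖ξ‖ * (κ / 2))) ^ 2 := by ring
          _ ≤ _ := by gcongr
      have hzG : |y.2| ≤ angG b ζ + 1 := by linarith
      have hqd := markDensity_of_abs_le (γ := γ) (χ := χ) (η₀ := η₀) (ε := ε) (t := t) (w := s.1)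
        (v := v) hχ₁ hzG y.1
      have hφ : κ / 3 ≤ phi χ η₀ ε ‖s.1 - v t y.1‖ :=
        le_phi_of_le hχ hε (by linarith) (by linarith) (by linarith [hnorm y.1])
      have hqge : (κ / 3) ^ γ / rate γ b η₀ ε ζ ≤ markDensity γ b χ χ₁ v η₀ ε ζ t s.1 y.1 y.2 := by
        rw [hqd]
        have := Real.rpow_le_rpow (by positivity) hφ hγ.le
        exact div_le_div_of_nonneg_right this hrate.le
      obtain ⟨m, hm⟩ : ∃ m, m = markDensity γ b χ χ₁ v η₀ ε ζ t s.1 y.1 y.2 := ⟨_, rfl⟩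
      rw [← hm] at hqge ⊢
      have hm0 : 0 ≤ m := le_trans (by positivity) hqge
      obtain ⟨X, hXd⟩ : ∃ X, X = ((starRingEnd ℂ) ξ * jumpDirection b U v t s y).re ^ 2 := ⟨_, rfl⟩
      rw [← hXd] at hX ⊢
      rw [← ENNReal.ofReal_mul (by positivity), ← ENNReal.ofReal_mul hE.le,
        ← ENNReal.ofReal_add (by positivity) (by positivity)]
      apply ENNReal.ofReal_le_ofReal
      have h8 : Real.exp (-X) ≤ Real.exp (-(c₀ ^ 2 * κ ^ 2 / 16)) := Real.exp_le_exp.2 (by linarith)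
      have h9 : a ≤ (1 - Real.exp (-X)) * m := by
        rw [ha, mul_div_assoc]
        exact mul_le_mul (by linarith) hqge (by positivity) (by linarith)
      have h10 := mul_le_mul_of_nonneg_right h9 hE.le
      linarith
    · rw [indicator_of_notMem hy, add_zero]
      gcongr
      refine mul_le_of_le_one_left hE.le (Real.exp_le_one_iff.2 ?_)
      linarith [sq_nonneg ((starRingEnd ℂ) ξ * jumpDirection b U v t s y).re]
  have hE : 0 < covExp ξ s := Real.exp_pos _
  have hsum := lintegral_mono (μ := volume.restrict (Icc (0 : ℝ) 1 ×ˢ ({0}ᶜ : Set ℝ))) hpt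
  rw [lintegral_add_right _ (measurable_const.indicator hWm),
    lintegral_indicator_const hWm, Measure.restrict_apply hWm,
    inter_eq_self_of_subset_left hWsub, lintegral_const_mul' _ _ ENNReal.ofReal_ne_top] at hsum
  have hsum2 : (∫⁻ y in Icc (0 : ℝ) 1 ×ˢ ({0}ᶜ : Set ℝ),
      ENNReal.ofReal (covExp ξ (chainStep b I U v t s y)) *
        ENNReal.ofReal (markDensity γ b χ χ₁ v η₀ ε ζ t s.1 y.1 y.2)) +
      ENNReal.ofReal (a * covExp ξ s * (κ / 2 * max 0 (Zm - 1))) ≤ ENNReal.ofReal (covExp ξ s) := by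
    refine le_trans ?_ (hsum.trans (mul_le_of_le_one_right zero_le
      (lintegral_markDensity_le hγ hχ hχ₁ hε hΓ hG hv t s.1)))
    gcongr
    rw [ENNReal.ofReal_mul (by positivity)]
    gcongr
    refine le_trans ?_ hWvol
    rw [ENNReal.ofReal_mul (by positivity)]
    refine mul_le_mul_right ?_ _
    rcases le_total (Zm - 1) 0 with h | h
    · rw [max_eq_left h, ENNReal.ofReal_zero]; exact zero_le
    · rw [max_eq_right h]
  refine (ENNReal.le_sub_of_add_le_right ENNReal.ofReal_ne_top hsum2).trans (le_of_eq ?_)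
  rw [← ENNReal.ofReal_sub _ (by positivity), ← ENNReal.ofReal_mul' hE.le, ← hZ, ha]
  congr 1
  ring

end Decay

/-! ### Integrability over frequencies, uniformly in ζ. -/

/-- The regularization and the number of jumps together control high frequencies. -/
theorem rpow_le_regularization_add {ν ζ ρ : ℝ} (hν : 0 < ν) (hζ : ζ ∈ Ioo (0 : ℝ) 1) (hρ : 1 ≤ ρ) :
    ρ ^ (ν / (2 + ν)) ≤ ζ ^ (4 + ν) * ρ ^ 2 ∨ ρ ^ (ν / (2 + ν)) ≤ ζ ^ (-ν) := by
  have hρ0 : 0 < ρ := by linarith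
  rcases le_or_gt (ρ ^ (ν / (2 + ν))) (ζ ^ (-ν)) with h | h
  · exact Or.inr h
  · left
    have h1 : (ρ ^ (-(1 / (2 + ν)))) ≤ ζ := by
      have h2 := Real.rpow_le_rpow_of_nonpos (Real.rpow_pos_of_pos hζ.1 (-ν)) h.le
        (z := -(1 / ν)) (by rw [neg_nonpos]; positivity)
      rw [← Real.rpow_mul hρ0.le, ← Real.rpow_mul hζ.1.le] at h2
      have e1 : ν / (2 + ν) * -(1 / ν) = -(1 / (2 + ν)) := by field_simp
      have e2 : -ν * -(1 / ν) = 1 := by field_simp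
      rwa [e1, e2, Real.rpow_one] at h2
    calc ρ ^ (ν / (2 + ν)) = (ρ ^ (-(1 / (2 + ν)))) ^ (4 + ν) * ρ ^ (2 : ℝ) := by
          rw [← Real.rpow_mul hρ0.le, ← Real.rpow_add hρ0]
          congr 1
          field_simp
          ring
      _ ≤ ζ ^ (4 + ν) * ρ ^ 2 := by
          rw [Real.rpow_two]
          gcongr

/-- For ρ > 1 the exponential is bounded below by a single term xᴺ/N! of its series with Nβ ≥ k + 3.
The power -3 is enough for integrability in dimension 2. -/
theorem exists_rpow_mul_exp_neg_le {c β k : ℝ} (hc : 0 < c) (hβ : 0 < β) (hk : 0 ≤ k) :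
    ∃ C : ℝ, 0 ≤ C ∧ ∀ ρ : ℝ, 0 ≤ ρ →
      ρ ^ k * Real.exp (-(c * ρ ^ β)) ≤ C * (1 + ρ) ^ (-(3 : ℝ)) := by
  obtain ⟨N, hN⟩ := exists_nat_ge ((k + 3) / β)
  rw [div_le_iff₀ hβ] at hN
  obtain ⟨M, hM⟩ : ∃ M : ℝ, M = max 1 (N.factorial / c ^ N) := ⟨_, rfl⟩
  have hM1 : 1 ≤ M := by rw [hM]; exact le_max_left _ _
  have hM2 : N.factorial / c ^ N ≤ M := by rw [hM]; exact le_max_right _ _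
  refine ⟨M * 8, by positivity, fun ρ hρ => ?_⟩
  have h8 : (2 : ℝ) ^ (-(3 : ℝ)) = 1 / 8 := by
    rw [Real.rpow_neg (by norm_num)]; norm_num
  rcases le_or_gt ρ 1 with h | h
  · have h1 : ρ ^ k ≤ 1 := Real.rpow_le_one hρ h hk
    have h2 : Real.exp (-(c * ρ ^ β)) ≤ 1 :=
      Real.exp_le_one_iff.2 (by have : 0 ≤ c * ρ ^ β := by positivity
                                linarith)
    have h3 : (1 / 8 : ℝ) ≤ (1 + ρ) ^ (-(3 : ℝ)) := by
      rw [← h8]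
      exact Real.rpow_le_rpow_of_nonpos (by linarith) (by linarith) (by norm_num)
    calc _ ≤ (1 : ℝ) * 1 := mul_le_mul h1 h2 (Real.exp_pos _).le zero_le_one
      _ ≤ M * 8 * (1 / 8) := by linarith
      _ ≤ _ := by gcongr
  · have hρ0 : 0 < ρ := by linarith
    have h1 : ρ ^ k * Real.exp (-(c * ρ ^ β)) ≤ M * ρ ^ (-(3 : ℝ)) := by
      have h2 := Real.pow_div_factorial_le_exp (x := c * ρ ^ β) (by positivity) N
      have h3 : ρ ^ (k + 3) ≤ (ρ ^ β) ^ N := by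
        rw [← Real.rpow_mul_natCast hρ0.le]
        exact Real.rpow_le_rpow_of_exponent_le h.le (by linarith)
      have h4 : ρ ^ (k + 3) ≤ M * Real.exp (c * ρ ^ β) := by
        calc ρ ^ (k + 3) ≤ (ρ ^ β) ^ N := h3
          _ = N.factorial / c ^ N * ((c * ρ ^ β) ^ N / N.factorial) := by
            have : (N.factorial : ℝ) ≠ 0 := by positivity
            rw [mul_pow]; field_simp
          _ ≤ M * Real.exp (c * ρ ^ β) := mul_le_mul hM2 h2 (by positivity) (by linarith)
      rw [Real.rpow_add hρ0] at h4
      rw [Real.exp_neg, Real.rpow_neg hρ, ← div_eq_mul_inv, ← div_eq_mul_inv,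
        div_le_div_iff₀ (Real.exp_pos _) (by positivity)]
      exact h4
    have h5 : ρ ^ (-(3 : ℝ)) ≤ 8 * (1 + ρ) ^ (-(3 : ℝ)) := by
      have h6 : (2 * ρ) ^ (-(3 : ℝ)) ≤ (1 + ρ) ^ (-(3 : ℝ)) :=
        Real.rpow_le_rpow_of_nonpos (by linarith) (by linarith) (by norm_num)
      rw [Real.mul_rpow (by norm_num) hρ, h8] at h6
      linarith
    calc _ ≤ M * ρ ^ (-(3 : ℝ)) := h1
      _ ≤ M * (8 * (1 + ρ) ^ (-(3 : ℝ))) := by gcongr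
      _ = _ := by ring

/-- If the minimum is the power of ρ, it dominates ρ^{ν/(2+ν)} directly. If it is g - 1, then g is
at least of order ζ^{-ν}, and `rpow_le_regularization_add` leaves either this term or the Gaussian
exponent to dominate. The constant m is small enough for every case. -/
theorem exists_regularized_exp_le {ν : ℝ} (hν : 0 < ν) {t₀ c c' K : ℝ} (ht₀ : 0 < t₀) (hc : 0 < c)
    (hc' : 0 < c') (hK : 0 ≤ K) {k : ℝ} (hk : 0 ≤ k) :
    ∃ C : ℝ, 0 ≤ C ∧ ∀ ζ ∈ Ioo (0 : ℝ) 1, ∀ t g ρ : ℝ, t₀ ≤ t → c' * ζ ^ (-ν) - K ≤ g → 0 ≤ ρ →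
      ρ ^ k * Real.exp (-(t * ζ ^ (4 + ν) * ρ ^ 2)) *
        Real.exp (-(c * max 0 (min (ρ ^ (ν / (1 + ν))) (g - 1) - 1))) ≤
      C * (1 + ρ) ^ (-(3 : ℝ)) := by
  obtain ⟨m, hm⟩ : ∃ m, m = min t₀ (c * min 1 c') := ⟨_, rfl⟩
  have hm0 : 0 < m := by rw [hm]; positivity
  have hm1 : m ≤ t₀ := by rw [hm]; exact min_le_left _ _
  have hm2 : m ≤ c * min 1 c' := by rw [hm]; exact min_le_right _ _
  have hm3 : m ≤ c := hm2.trans (mul_le_of_le_one_right hc.le (min_le_left _ _))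
  have hm4 : m ≤ c * c' := hm2.trans (mul_le_mul_of_nonneg_left (min_le_right _ _) hc.le)
  obtain ⟨C, hC, h⟩ := exists_rpow_mul_exp_neg_le hm0 (show 0 < ν / (2 + ν) by positivity) hk
  refine ⟨Real.exp (c * (K + 2)) * C, by positivity, fun ζ hζ t g ρ ht hg hρ => ?_⟩
  have hζp : 0 < ζ ^ (4 + ν) := Real.rpow_pos_of_pos hζ.1 _
  obtain ⟨a, ha⟩ : ∃ a, a = t * ζ ^ (4 + ν) * ρ ^ 2 := ⟨_, rfl⟩
  obtain ⟨e, he⟩ : ∃ e, e = max 0 (min (ρ ^ (ν / (1 + ν))) (g - 1) - 1) := ⟨_, rfl⟩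
  have ha0 : 0 ≤ a := by rw [ha]; have : 0 < t := by linarith
                         positivity
  have he0 : 0 ≤ e := by rw [he]; exact le_max_left _ _
  have key : m * ρ ^ (ν / (2 + ν)) ≤ a + c * e + c * (K + 2) := by
    have hce : 0 ≤ c * e := by positivity
    rcases le_or_gt ρ 1 with h1 | h1
    · have h2 : ρ ^ (ν / (2 + ν)) ≤ 1 := Real.rpow_le_one hρ h1 (by positivity)
      have h3 : m * ρ ^ (ν / (2 + ν)) ≤ c * 1 := mul_le_mul hm3 h2 (by positivity) hc.le
      nlinarith
    · have he1 : min (ρ ^ (ν / (1 + ν))) (g - 1) - 1 ≤ e := by rw [he]; exact le_max_right _ _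
      rcases min_choice (ρ ^ (ν / (1 + ν))) (g - 1) with h2 | h2
      · rw [h2] at he1
        have h3 : ρ ^ (ν / (2 + ν)) ≤ ρ ^ (ν / (1 + ν)) := by
          apply Real.rpow_le_rpow_of_exponent_le h1.le
          gcongr
          linarith
        have h4 : m * ρ ^ (ν / (2 + ν)) ≤ c * (e + 1) :=
          mul_le_mul hm3 (by linarith) (by positivity) hc.le
        nlinarith
      · rw [h2] at he1
        rcases rpow_le_regularization_add hν hζ h1.le with h3 | h3
        · have h4 : m * ρ ^ (ν / (2 + ν)) ≤ t * (ζ ^ (4 + ν) * ρ ^ 2) :=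
            mul_le_mul (hm1.trans ht) h3 (by positivity) (by linarith)
          nlinarith
        · have h4 : m * ρ ^ (ν / (2 + ν)) ≤ c * c' * ζ ^ (-ν) :=
            mul_le_mul hm4 h3 (by positivity) (by positivity)
          have h5 : c * (c' * ζ ^ (-ν)) ≤ c * (e + 2 + K) :=
            mul_le_mul_of_nonneg_left (by linarith) hc.le
          nlinarith
  rw [← ha, ← he, mul_assoc, ← Real.exp_add]
  calc ρ ^ k * Real.exp (-a + -(c * e)) ≤
        ρ ^ k * (Real.exp (c * (K + 2)) * Real.exp (-(m * ρ ^ (ν / (2 + ν))))) := by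
        rw [← Real.exp_add]
        exact mul_le_mul_of_nonneg_left (Real.exp_le_exp.2 (by linarith)) (by positivity)
    _ = Real.exp (c * (K + 2)) * (ρ ^ k * Real.exp (-(m * ρ ^ (ν / (2 + ν))))) := by ring
    _ ≤ Real.exp (c * (K + 2)) * (C * (1 + ρ) ^ (-(3 : ℝ))) :=
        mul_le_mul_of_nonneg_left (h ρ hρ) (Real.exp_pos _).le
    _ = _ := by ring

theorem lintegral_one_add_norm_lt_top :
    ∫⁻ ξ : ℝ × ℝ, ENNReal.ofReal ((1 + ‖(⟨ξ.1, ξ.2⟩ : ℂ)‖) ^ (-(3 : ℝ))) < ∞ := by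
  have h1 : Integrable (fun ξ : ℝ × ℝ => (1 + ‖ξ‖) ^ (-(3 : ℝ))) := by
    refine integrable_one_add_norm ?_
    rw [Module.finrank_prod, Module.finrank_self]
    norm_num
  refine lt_of_le_of_lt (lintegral_mono fun ξ => ?_) h1.lintegral_lt_top
  apply ENNReal.ofReal_le_ofReal
  refine Real.rpow_le_rpow_of_nonpos (by positivity) ?_ (by norm_num)
  rw [add_le_add_iff_left, Prod.norm_def]
  exact max_le (Complex.abs_re_le_norm (⟨ξ.1, ξ.2⟩ : ℂ)) (Complex.abs_im_le_norm (⟨ξ.1, ξ.2⟩ : ℂ))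

/-! ### The two expectations at time t. -/

section Expectation

variable {Ω : Type*} [MeasurableSpace Ω] {P : Measure Ω} [IsProbabilityMeasure P]
  {γ ν : ℝ} {b χ χ₁ I U : ℝ → ℝ} {f : ℝ → Measure Plane} {v : ℝ → ℝ → Plane} {T η₀ ε ζ t : ℝ}
  {V₀ : Ω → Plane} {τ R : ℕ → Ω → ℝ} {Z : ℤ → Ω → ℝ}

variable (b I U v V₀ τ R Z) in
/-- The random state of the chain at time `t`. -/
noncomputable def stateAt (t : ℝ) (ω : Ω) : ChainState :=
  stateAfter b I U v V₀ τ R Z (jumpCount (fun k => τ k ω) t) ω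

/-- The jump count is a cardinality, with no direct measurability; it agrees almost surely with the
measurable sum of n times the indicator of exactly n jumps. -/
theorem aemeasurable_stateAt
    (hS : IsRegularizedSystem P γ b χ χ₁ I f v T η₀ ε ζ V₀ τ R Z)
    (hlam : 0 < rate γ b η₀ ε ζ)
    (hang : Measurable (angle b)) (hI : Measurable I) (hU : Measurable U)
    (hv : Measurable (Function.uncurry v)) (ht : 0 ≤ t) :
    AEMeasurable (stateAt b I U v V₀ τ R Z t) P := by
  have hmono := ae_lt_arrival hS.measurable_τ hS.law_gap
  have hpos : ∀ᵐ ω ∂P, ∀ k, 0 ≤ τ k ω := by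
    filter_upwards [hmono] with ω hω k
    rw [← hS.τ_zero ω]
    exact (strictMono_nat_of_lt_succ (f := fun k => τ k ω) hω).monotone (Nat.zero_le k)
  have hJ := ae_tsum_countIndicator hmono hS.τ_zero ht
    (ae_exists_arrival_gt hlam hS.measurable_τ hS.τ_zero hS.law_gap hS.indep_gap hpos t)
  have hJm : Measurable fun ω => ⌊(∑' n : ℕ, (n : ℝ≥0∞) * countIndicator τ t n ω).toNNReal⌋₊ :=
    Nat.measurable_floor.comp (Measurable.tsum fun n =>
      (measurable_countIndicator hS.measurable_τ t n).const_mul _).ennreal_toNNReal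
  refine ⟨fun ω => stateAfter b I U v V₀ τ R Z
    ⌊(∑' n : ℕ, (n : ℝ≥0∞) * countIndicator τ t n ω).toNNReal⌋₊ ω, ?_, ?_⟩
  · have h1 : Measurable fun q : ℕ × Ω => stateAfter b I U v V₀ τ R Z q.1 q.2 :=
      measurable_from_prod_countable_right fun n => measurable_stateAfter hS hang hI hU hv n
    exact h1.comp (hJm.prodMk measurable_id)
  · filter_upwards [hJ] with ω hω
    rw [← hω fun n => (n : ℝ≥0∞)]
    simp [stateAt]

theorem stateAt_contraction_ne_zero (hθ : ∀ z, |angle b z| ≤ Real.pi / 2) (ω : Ω) :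
    (stateAt b I U v V₀ τ R Z t ω).2.1 ≠ 0 := chain_contraction_ne_zero hθ _

theorem norm_stateAt_contraction_le_one (hI : ∀ z, I z ∈ Icc (0 : ℝ) 1) (ω : Ω) :
    ‖(stateAt b I U v V₀ τ R Z t ω).2.1‖ ≤ 1 := norm_chain_contraction_le_one hI _

theorem norm_stateAt_sq_sum_le (ω : Ω) :
    ‖(stateAt b I U v V₀ τ R Z t ω).2.2.2‖ ≤ (stateAt b I U v V₀ τ R Z t ω).2.2.1 :=
  norm_chain_sq_sum_le _

variable (hγ : 0 < γ) (hν : 0 < ν) (hb : CrossSection ν b) (hχ : IsEvenMollifier χ)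
  (hχ₁ : IsBumpDensity χ₁) (hε : 0 < ε) (hΓ : 1 ≤ Gam η₀ ε) (hG : 0 ≤ angG b ζ)
  (hv : Measurable (Function.uncurry v)) (hI : IsAngularCutoff b ζ I) (hU : IsWeight b ζ U)
  (hS : IsRegularizedSystem P γ b χ χ₁ I f v T η₀ ε ζ V₀ τ R Z)

include hγ hν hb hχ hχ₁ hε hΓ hG hv hI hU hS in
/-- Negative moments of the contraction. -/
theorem lintegral_norm_stateAt_rpow_neg_le {K r : ℝ} (hK : 0 ≤ K)
    (hKb : ∫⁻ z, ENNReal.ofReal (angle b z ^ 2) ≤ ENNReal.ofReal K) (hr : 0 ≤ r)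
    (ht0 : 0 ≤ t) (ht : t ≤ T) :
    ∫⁻ ω, ENNReal.ofReal (‖(stateAt b I U v V₀ τ R Z t ω).2.1‖ ^ (-r)) ∂P ≤
      ENNReal.ofReal (Real.exp (r * Real.exp (3 * r) * K * (T + 1) * Gam η₀ ε ^ γ)) := by
  have hrate : 0 < rate γ b η₀ ε ζ := rate_pos hΓ hG
  have hg : 0 < Gam η₀ ε ^ γ := Real.rpow_pos_of_pos (by linarith) _
  have hang := measurable_angle hν hb
  have hθ : ∀ z, |angle b z| ≤ Real.pi / 2 := fun z => (abs_angle_lt hν hb z).le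
  obtain ⟨C, hCdef⟩ : ∃ C, C = r * Real.exp (3 * r) * K := ⟨_, rfl⟩
  have hC : 0 ≤ C := by rw [hCdef]; positivity
  -- The profile equals 1 up to time t and decreases continuously to 0 at t + 1, as the renewal
  -- bound asks for a continuous profile; its integral over [0, t + 1] is at most T + 1.
  have hθ0 : ∀ x : ℝ, 0 ≤ max 0 (min 1 (t + 1 - x)) := fun x => le_max_left _ _
  have hθ1 : ∀ x : ℝ, max 0 (min 1 (t + 1 - x)) ≤ 1 := fun x =>
    max_le zero_le_one (min_le_left _ _)
  have hc : 0 ≤ C * Gam η₀ ε ^ γ / rate γ b η₀ ε ζ := by positivity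
  have h := lintegral_stateAfter_jumpCount_le (c := C * Gam η₀ ε ^ γ / rate γ b η₀ ε ζ)
    (B := t + 1) (θ := fun x => max 0 (min 1 (t + 1 - x)))
    (Ψ := fun s => ENNReal.ofReal (‖s.2.1‖ ^ (-r)))
    hS hrate hang hθ hI.smooth.continuous.measurable hI.mem_Icc hU.smooth.continuous.measurable hv
    (by fun_prop) (by simp) ht0 ht (by fun_prop)
    (fun x => add_nonneg zero_le_one (mul_nonneg hc (hθ0 x)))
    (fun x _ => mul_nonneg hc (hθ0 x))
    (fun x hx => max_eq_left (min_le_of_right_le (by linarith)))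
    (fun t' ht' s _ _ => by
      have h1 := lintegral_norm_contraction_step_le hγ hχ hχ₁ hε hΓ hG hv hang hθ hI hU hK hKb hr t' s
      have h2 : max 0 (min 1 (t + 1 - t')) = 1 := by
        rw [min_eq_left (by linarith [ht'.2]), max_eq_right zero_le_one]
      rw [h2, mul_one, hCdef]
      exact h1)
  refine h.trans (ENNReal.ofReal_le_ofReal (Real.exp_le_exp.2 ?_))
  have h3 : ∫ x in (0 : ℝ)..(t + 1), max 0 (min 1 (t + 1 - x)) ≤ T + 1 := by
    calc _ ≤ ∫ x in (0 : ℝ)..(t + 1), (1 : ℝ) :=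
          intervalIntegral.integral_mono_on (by linarith)
            (Continuous.intervalIntegrable (by fun_prop) _ _)
            (Continuous.intervalIntegrable (by fun_prop) _ _) fun x _ => hθ1 x
      _ ≤ T + 1 := by simp; linarith
  calc _ = C * Gam η₀ ε ^ γ * ∫ x in (0 : ℝ)..(t + 1), max 0 (min 1 (t + 1 - x)) := by
        rw [mul_div_cancel₀ _ hrate.ne']
    _ ≤ C * Gam η₀ ε ^ γ * (T + 1) := by gcongr
    _ = _ := by rw [hCdef]; ring

/-- The tent is at least 1/4 on the middle half of the window. It replaces the indicator of the
window, which would not be continuous. -/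
theorem integral_tent_ge {s₁ s₂ : ℝ} (hs₁ : 0 ≤ s₁) (hs : s₁ < s₂) :
    (s₂ - s₁) / 8 ≤ ∫ x in (0 : ℝ)..s₂, max 0 (min (x - s₁) (s₂ - x)) / (s₂ - s₁) := by
  have hL : 0 < s₂ - s₁ := sub_pos.2 hs
  have hcont : Continuous fun x : ℝ => max 0 (min (x - s₁) (s₂ - x)) / (s₂ - s₁) := by fun_prop
  calc (s₂ - s₁) / 8 = ∫ x in (s₁ + (s₂ - s₁) / 4)..(s₂ - (s₂ - s₁) / 4), (1 / 4 : ℝ) := by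
        rw [intervalIntegral.integral_const, smul_eq_mul]; ring
    _ ≤ ∫ x in (s₁ + (s₂ - s₁) / 4)..(s₂ - (s₂ - s₁) / 4),
          max 0 (min (x - s₁) (s₂ - x)) / (s₂ - s₁) := by
        refine intervalIntegral.integral_mono_on (by linarith) (by simp)
          (hcont.intervalIntegrable _ _) fun x hx => ?_
        rw [le_div_iff₀ hL]
        exact le_max_of_le_right (le_min (by linarith [hx.1]) (by linarith [hx.2]))
    _ ≤ _ := by
        refine intervalIntegral.integral_mono_interval (by linarith) (by linarith) (by linarith)
          (Filter.Eventually.of_forall fun x => ?_) (hcont.intervalIntegrable _ _)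
        exact div_nonneg (le_max_left _ _) hL.le

include hγ hν hb hχ hχ₁ hε hΓ hG hv hI hU hS in
/-- The Laplace transform of the covariance in the direction `ξ`. -/
theorem lintegral_covExp_stateAt_le {κ c₀ s₁ s₂ : ℝ} (hκ : 0 < κ) (hκ1 : κ ≤ 1)
    (hc₀ : 0 < c₀) (hder : ∀ z, 1 ≤ |z| → c₀ * |z| ^ (-((1 + ν) / ν)) ≤ |deriv (angle b) z|)
    (hf : ∀ s ∈ Icc 0 T, IsProbabilityMeasure (f s)) (hrep : IsRepresentation T f v)
    (hs₁ : 0 ≤ s₁) (hs : s₁ < s₂) (hs₂ : s₂ ≤ t) (ht : t ≤ T)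
    (hnd : ∀ s ∈ Icc s₁ s₂, ∀ p q c, p ^ 2 + q ^ 2 = 1 →
      κ ≤ ∫ x, min 1 |affineForm p q c x| ∂(f s)) (ξ : ℂ) :
    ∫⁻ ω, ENNReal.ofReal (covExp ξ (stateAt b I U v V₀ τ R Z t ω)) ∂P ≤
      ENNReal.ofReal (Real.exp (-((1 - Real.exp (-(c₀ ^ 2 * κ ^ 2 / 16))) * (κ / 3) ^ γ * (κ / 2) *
        ((s₂ - s₁) / 8) * max 0 (min (‖ξ‖ ^ (ν / (1 + ν))) (angG b ζ - 1) - 1)))) := by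
  have hrate : 0 < rate γ b η₀ ε ζ := rate_pos hΓ hG
  have hL : 0 < s₂ - s₁ := sub_pos.2 hs
  obtain ⟨M, hM⟩ : ∃ M, M = max 0 (min (‖ξ‖ ^ (ν / (1 + ν))) (angG b ζ - 1) - 1) := ⟨_, rfl⟩
  rw [← hM]
  have hM0 : 0 ≤ M := by rw [hM]; exact le_max_left _ _
  rcases eq_or_ne ξ 0 with rfl | hξ
  · have hM00 : M = 0 := by
      rw [hM, norm_zero, Real.zero_rpow (by positivity)]
      exact max_eq_left (by linarith [min_le_left 0 (angG b ζ - 1)])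
    simp [covExp, hM00]
  have hg : 1 ≤ Gam η₀ ε ^ γ := Real.one_le_rpow hΓ hγ.le
  have hang := measurable_angle hν hb
  have hθ : ∀ z, |angle b z| ≤ Real.pi / 2 := fun z => (abs_angle_lt hν hb z).le
  obtain ⟨C, hCdef⟩ : ∃ C, C = (1 - Real.exp (-(c₀ ^ 2 * κ ^ 2 / 16))) * (κ / 3) ^ γ * (κ / 2) :=
    ⟨_, rfl⟩
  rw [← hCdef]
  have hc1 : 0 ≤ 1 - Real.exp (-(c₀ ^ 2 * κ ^ 2 / 16)) := by
    rw [sub_nonneg, Real.exp_le_one_iff]; have : 0 ≤ c₀ ^ 2 * κ ^ 2 / 16 := by positivity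
    linarith
  have hC0 : 0 ≤ C := by rw [hCdef]; positivity
  have hC1 : C ≤ 1 := by
    have h1 : (κ / 3) ^ γ ≤ 1 := Real.rpow_le_one (by positivity) (by linarith) hγ.le
    have h2 : 1 - Real.exp (-(c₀ ^ 2 * κ ^ 2 / 16)) ≤ 1 := by linarith [Real.exp_pos (-(c₀ ^ 2 * κ ^ 2 / 16))]
    rw [hCdef]
    exact mul_le_one₀ (mul_le_one₀ h2 (by positivity) h1) (by positivity) (by linarith)
  -- Guarantees that the per-jump factor 1 - CM/λ times the tent stays nonnegative; it holds because
  -- M ≤ G(ζ) + 1 and λ contains this factor.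
  have hMrate : C * M ≤ rate γ b η₀ ε ζ := by
    have h1 : M ≤ angG b ζ + 1 := by
      rw [hM]
      exact max_le (by linarith) (by linarith [min_le_right (‖ξ‖ ^ (ν / (1 + ν))) (angG b ζ - 1)])
    have h2 : C * M ≤ 1 * (angG b ζ + 1) := mul_le_mul hC1 h1 hM0 zero_le_one
    have h3 : (angG b ζ + 1) * 1 ≤ (angG b ζ + 1) * Gam η₀ ε ^ γ := by gcongr
    unfold rate
    nlinarith
  have hθ0 : ∀ x : ℝ, 0 ≤ max 0 (min (x - s₁) (s₂ - x)) / (s₂ - s₁) := fun x =>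
    div_nonneg (le_max_left _ _) hL.le
  have hθ1 : ∀ x : ℝ, max 0 (min (x - s₁) (s₂ - x)) / (s₂ - s₁) ≤ 1 := by
    intro x
    rw [div_le_one hL]
    refine max_le hL.le ?_
    rcases le_total x s₂ with h | h
    · exact min_le_of_left_le (by linarith)
    · exact min_le_of_right_le (by linarith)
  have hout : ∀ x, x ∉ Icc s₁ s₂ → max 0 (min (x - s₁) (s₂ - x)) / (s₂ - s₁) = 0 := by
    intro x hx
    rw [max_eq_left, zero_div]
    by_contra h
    have h1 := lt_min_iff.1 (not_le.1 h)
    exact hx ⟨by linarith [h1.1], by linarith [h1.2]⟩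
  have hcr : 0 ≤ C * M / rate γ b η₀ ε ζ := by positivity
  have hcr1 : C * M / rate γ b η₀ ε ζ ≤ 1 := (div_le_one hrate).2 hMrate
  have h := lintegral_stateAfter_jumpCount_le (c := -(C * M / rate γ b η₀ ε ζ))
    (B := s₂) (θ := fun x => max 0 (min (x - s₁) (s₂ - x)) / (s₂ - s₁))
    (Ψ := fun s => ENNReal.ofReal (covExp ξ s))
    hS hrate hang hθ hI.smooth.continuous.measurable hI.mem_Icc hU.smooth.continuous.measurable hv
    (measurable_covExp ξ).ennreal_ofReal (by simp [covExp]) (by linarith) ht (by fun_prop)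
    (fun x => by
      have := mul_le_one₀ hcr1 (hθ0 x) (hθ1 x)
      linarith)
    (fun x hx => by
      rw [hout x (fun h => by linarith [h.2]), mul_zero])
    (fun x hx => by
      rw [max_eq_left (min_le_of_right_le (by linarith)), zero_div])
    (fun t' ht' s hs0 hs1 => by
      by_cases ht1 : t' ∈ Icc s₁ s₂
      · have hT : t' ∈ Icc 0 T := ⟨ht'.1, ht'.2.trans ht⟩
        have := hf t' hT
        have h1 := covExp_step_le_of_nondegenerate (I := I) hγ hν hb hχ hχ₁ hε hΓ hG hv hU hκ hκ1 hc₀ hder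
          (hrep.law t' hT) (hnd t' ht1) hξ s hs0 hs1
        rw [← hM, ← hCdef] at h1
        refine h1.trans ?_
        gcongr
        have := mul_le_mul_of_nonneg_left (hθ1 t') hcr
        linarith
      · rw [hout t' ht1, mul_zero, add_zero, ENNReal.ofReal_one, one_mul]
        exact covExp_step_le hγ hχ hχ₁ hε hΓ hG hv t' ξ s)
  refine h.trans (ENNReal.ofReal_le_ofReal (Real.exp_le_exp.2 ?_))
  have h3 := mul_le_mul_of_nonneg_left (integral_tent_ge hs₁ hs) (mul_nonneg hC0 hM0)
  have h4 : rate γ b η₀ ε ζ * -(C * M / rate γ b η₀ ε ζ) = -(C * M) := by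
    rw [mul_neg, mul_div_cancel₀ _ hrate.ne']
  rw [h4]
  linarith

end Expectation

/-! ### Negative moments of the determinant and conclusion. -/

/-- The determinant of the regularized covariance with the contraction factored out. -/
noncomputable def reducedDet (u : ℝ) (s : ChainState) : ℝ :=
  u ^ 2 + u * s.2.2.1 + (s.2.2.1 ^ 2 - ‖s.2.2.2‖ ^ 2) / 4

theorem reducedDet_pos {u : ℝ} (hu : 0 < u) {s : ChainState} (hB : ‖s.2.2.2‖ ≤ s.2.2.1) :
    0 < reducedDet u s := by
  have h1 : ‖s.2.2.2‖ ^ 2 ≤ s.2.2.1 ^ 2 := by gcongr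
  have h2 : 0 ≤ s.2.2.1 := (norm_nonneg _).trans hB
  unfold reducedDet
  nlinarith [mul_nonneg hu.le h2, sq_pos_of_pos hu]

/-- With A = ∑|d_k|² and B = ∑d_k², `reducedDet` is the determinant of the quadratic form u|ξ|² +
(A|ξ|² + Re(conj(ξ)² B))/2, whose exponential is the Gaussian factor times `covExp`. -/
theorem reducedDet_rpow_neg_le_lintegral {m u : ℝ} (hm : 0 ≤ m) (hu : 0 < u) {s : ChainState}
    (hB : ‖s.2.2.2‖ ≤ s.2.2.1) :
    ENNReal.ofReal (Real.exp (-1) * (1 / 4) ^ m * reducedDet u s ^ (-(1 / 2 + m / 2))) ≤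
      ∫⁻ ξ : ℝ × ℝ, ENNReal.ofReal (‖(⟨ξ.1, ξ.2⟩ : ℂ)‖ ^ (2 * m) *
        Real.exp (-(u * ‖(⟨ξ.1, ξ.2⟩ : ℂ)‖ ^ 2))) * ENNReal.ofReal (covExp ⟨ξ.1, ξ.2⟩ s) := by
  have hre : |s.2.2.2.re| ≤ s.2.2.1 := (Complex.abs_re_le_norm _).trans hB
  have hre' := abs_le.1 hre
  have hdet : (u + (s.2.2.1 + s.2.2.2.re) / 2) * (u + (s.2.2.1 - s.2.2.2.re) / 2) -
      (s.2.2.2.im / 2) ^ 2 = reducedDet u s := by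
    rw [reducedDet, Complex.sq_norm, Complex.normSq_apply]; ring
  have h := det_rpow_neg_le_lintegral hm (α := u + (s.2.2.1 + s.2.2.2.re) / 2)
    (β := s.2.2.2.im / 2) (δ := u + (s.2.2.1 - s.2.2.2.re) / 2) (by linarith [hre'.1])
    (by rw [hdet]; exact reducedDet_pos hu hB)
  rw [hdet] at h
  refine h.trans (lintegral_mono fun ξ => ?_)
  have hn : ‖(⟨ξ.1, ξ.2⟩ : ℂ)‖ ^ 2 = ξ.1 ^ 2 + ξ.2 ^ 2 := by
    rw [Complex.sq_norm, Complex.normSq_mk]; ring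
  rw [← ENNReal.ofReal_mul (by positivity)]
  apply ENNReal.ofReal_le_ofReal (le_of_eq ?_)
  rw [covExp, mul_assoc (‖(⟨ξ.1, ξ.2⟩ : ℂ)‖ ^ (2 * m)), ← Real.exp_add, Real.rpow_mul (norm_nonneg _), Real.rpow_two, hn]
  congr 2
  simp only [pow_two, Complex.mul_re, Complex.mul_im, Complex.conj_re, Complex.conj_im]
  ring

theorem measurable_covExp_prod : Measurable fun q : (ℝ × ℝ) × ChainState =>
    covExp ⟨q.1.1, q.1.2⟩ q.2 := by
  have h1 : Measurable fun q : (ℝ × ℝ) × ChainState => (⟨q.1.1, q.1.2⟩ : ℂ) :=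
    Complex.measurableEquivRealProd.symm.measurable.comp measurable_fst
  have h2 : Measurable fun q : (ℝ × ℝ) × ChainState =>
      ((starRingEnd ℂ) (⟨q.1.1, q.1.2⟩ : ℂ) ^ 2 * q.2.2.2.2).re :=
    Complex.measurable_re.comp
      (((Complex.continuous_conj.measurable.comp h1).pow_const 2).mul (by fun_prop))
  have h3 := h1.norm
  unfold covExp
  fun_prop

/-- Negative moments of the reduced determinant from its Laplace transform. -/
theorem exists_lintegral_reducedDet_le {ν : ℝ} (hν : 0 < ν) {t₀ c c' K q : ℝ} (ht₀ : 0 < t₀)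
    (hc : 0 < c) (hc' : 0 < c') (hK : 0 ≤ K) (hq : 1 ≤ q) :
    ∃ C : ℝ, 0 ≤ C ∧ ∀ ζ ∈ Ioo (0 : ℝ) 1, ∀ t g : ℝ, t₀ ≤ t → c' * ζ ^ (-ν) - K ≤ g →
      ∀ (Ω : Type*) [MeasurableSpace Ω] (P : Measure Ω) [IsProbabilityMeasure P]
        (S : Ω → ChainState), AEMeasurable S P → (∀ ω, ‖(S ω).2.2.2‖ ≤ (S ω).2.2.1) →
        (∀ ξ : ℂ, ∫⁻ ω, ENNReal.ofReal (covExp ξ (S ω)) ∂P ≤ ENNReal.ofReal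
          (Real.exp (-(c * max 0 (min (‖ξ‖ ^ (ν / (1 + ν))) (g - 1) - 1))))) →
        ∫⁻ ω, ENNReal.ofReal (reducedDet (uReg ν ζ t) (S ω) ^ (-q)) ∂P ≤ ENNReal.ofReal C := by
  -- Makes the exponent 1/2 + m/2 of the Gaussian moment bound equal to q.
  obtain ⟨m, hm⟩ : ∃ m, m = 2 * q - 1 := ⟨_, rfl⟩
  have hm0 : 0 ≤ m := by linarith
  obtain ⟨C, hC, h⟩ := exists_regularized_exp_le hν ht₀ hc hc' hK (k := 2 * m) (by linarith)
  obtain ⟨L, hL⟩ : ∃ L, L = ∫⁻ ξ : ℝ × ℝ,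
    ENNReal.ofReal ((1 + ‖(⟨ξ.1, ξ.2⟩ : ℂ)‖) ^ (-(3 : ℝ))) := ⟨_, rfl⟩
  have hLt : L ≠ ∞ := by rw [hL]; exact lintegral_one_add_norm_lt_top.ne
  obtain ⟨a, ha⟩ : ∃ a, a = Real.exp (-1) * (1 / 4 : ℝ) ^ m := ⟨_, rfl⟩
  have ha0 : 0 < a := by rw [ha]; positivity
  refine ⟨a⁻¹ * (C * L.toReal), by positivity, ?_⟩
  intro ζ hζ t g ht hg Ω _ P _ S hSm hSB hlap
  have hu : 0 < uReg ν ζ t := mul_pos (by linarith) (Real.rpow_pos_of_pos hζ.1 _)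
  have hW : Measurable fun ξ : ℝ × ℝ => ENNReal.ofReal (‖(⟨ξ.1, ξ.2⟩ : ℂ)‖ ^ (2 * m) *
      Real.exp (-(uReg ν ζ t * ‖(⟨ξ.1, ξ.2⟩ : ℂ)‖ ^ 2))) := by
    have h1 : Measurable fun ξ : ℝ × ℝ => ‖(⟨ξ.1, ξ.2⟩ : ℂ)‖ :=
      Complex.measurableEquivRealProd.symm.measurable.norm
    fun_prop
  have hpt : ∀ ω, ENNReal.ofReal (reducedDet (uReg ν ζ t) (S ω) ^ (-q)) ≤ ENNReal.ofReal a⁻¹ *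
      ∫⁻ ξ : ℝ × ℝ, ENNReal.ofReal (‖(⟨ξ.1, ξ.2⟩ : ℂ)‖ ^ (2 * m) *
        Real.exp (-(uReg ν ζ t * ‖(⟨ξ.1, ξ.2⟩ : ℂ)‖ ^ 2))) *
          ENNReal.ofReal (covExp ⟨ξ.1, ξ.2⟩ (S ω)) := by
    intro ω
    have h1 := reducedDet_rpow_neg_le_lintegral hm0 hu (hSB ω)
    rw [← ha, show -(1 / 2 + m / 2) = -q by rw [hm]; ring] at h1
    refine le_trans (le_of_eq ?_) (mul_le_mul_right h1 _)
    rw [← ENNReal.ofReal_mul (by positivity), inv_mul_cancel_left₀ ha0.ne']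
  have hjoint : AEMeasurable (Function.uncurry fun (ω : Ω) (ξ : ℝ × ℝ) =>
      ENNReal.ofReal (‖(⟨ξ.1, ξ.2⟩ : ℂ)‖ ^ (2 * m) *
        Real.exp (-(uReg ν ζ t * ‖(⟨ξ.1, ξ.2⟩ : ℂ)‖ ^ 2))) *
          ENNReal.ofReal (covExp ⟨ξ.1, ξ.2⟩ (S ω))) (P.prod volume) := by
    refine AEMeasurable.mul (hW.comp measurable_snd).aemeasurable ?_
    exact measurable_covExp_prod.ennreal_ofReal.comp_aemeasurable
      (f := fun p : Ω × ℝ × ℝ => (p.2, S p.1)) (measurable_snd.aemeasurable.prodMk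
      (hSm.comp_quasiMeasurePreserving Measure.quasiMeasurePreserving_fst))
  calc _ ≤ ∫⁻ ω, ENNReal.ofReal a⁻¹ * (∫⁻ ξ : ℝ × ℝ,
        ENNReal.ofReal (‖(⟨ξ.1, ξ.2⟩ : ℂ)‖ ^ (2 * m) *
        Real.exp (-(uReg ν ζ t * ‖(⟨ξ.1, ξ.2⟩ : ℂ)‖ ^ 2))) *
          ENNReal.ofReal (covExp ⟨ξ.1, ξ.2⟩ (S ω))) ∂P := lintegral_mono hpt
    _ = ENNReal.ofReal a⁻¹ * ∫⁻ ξ : ℝ × ℝ, ∫⁻ ω,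
        ENNReal.ofReal (‖(⟨ξ.1, ξ.2⟩ : ℂ)‖ ^ (2 * m) *
        Real.exp (-(uReg ν ζ t * ‖(⟨ξ.1, ξ.2⟩ : ℂ)‖ ^ 2))) *
          ENNReal.ofReal (covExp ⟨ξ.1, ξ.2⟩ (S ω)) ∂P := by
        rw [lintegral_const_mul' _ _ ENNReal.ofReal_ne_top, lintegral_lintegral_swap hjoint]
    _ ≤ ENNReal.ofReal a⁻¹ * ∫⁻ ξ : ℝ × ℝ,
          ENNReal.ofReal C * ENNReal.ofReal ((1 + ‖(⟨ξ.1, ξ.2⟩ : ℂ)‖) ^ (-(3 : ℝ))) := by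
        refine mul_le_mul_right (lintegral_mono fun ξ => ?_) _
        rw [lintegral_const_mul' _ _ ENNReal.ofReal_ne_top]
        refine (mul_le_mul_right (hlap _) _).trans ?_
        rw [← ENNReal.ofReal_mul (by positivity), ← ENNReal.ofReal_mul hC]
        exact ENNReal.ofReal_le_ofReal (h ζ hζ t g _ ht hg (norm_nonneg _))
    _ = _ := by
        rw [lintegral_const_mul' _ _ ENNReal.ofReal_ne_top, ← hL,
          ENNReal.ofReal_mul (by positivity), ENNReal.ofReal_mul hC, ENNReal.ofReal_toReal hLt]

theorem covDet_rpow_neg_le {u p : ℝ} (hu : 0 < u) (hp : 0 ≤ p) {s : ChainState} (hY0 : s.2.1 ≠ 0)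
    (hY : ‖s.2.1‖ ≤ 1) (hB : ‖s.2.2.2‖ ≤ s.2.2.1) :
    0 ≤ covDet u s ^ (-p) ∧ covDet u s ^ (-p) ≤
      (‖s.2.1‖ ^ (-(8 * p)) + reducedDet u s ^ (-(2 * p))) / 2 := by
  have hD := reducedDet_pos hu hB
  have hYp : 0 < ‖s.2.1‖ := norm_pos_iff.2 hY0
  have h1 : ‖s.2.1‖ ^ 4 * reducedDet u s ≤ covDet u s := pow_mul_le_covDet hu.le hY hB
  have h2 : 0 < ‖s.2.1‖ ^ 4 * reducedDet u s := by positivity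
  refine ⟨Real.rpow_nonneg (h2.le.trans h1) _, ?_⟩
  calc covDet u s ^ (-p) ≤ (‖s.2.1‖ ^ 4 * reducedDet u s) ^ (-p) :=
        Real.rpow_le_rpow_of_nonpos h2 h1 (by linarith)
    _ = ‖s.2.1‖ ^ (-(4 * p)) * reducedDet u s ^ (-p) := by
        rw [Real.mul_rpow (by positivity) hD.le, ← Real.rpow_natCast, ← Real.rpow_mul hYp.le]
        congr 2
        push_cast
        ring
    _ ≤ ((‖s.2.1‖ ^ (-(4 * p))) ^ 2 + (reducedDet u s ^ (-p)) ^ 2) / 2 := by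
        linarith [two_mul_le_add_sq (‖s.2.1‖ ^ (-(4 * p))) (reducedDet u s ^ (-p))]
    _ = _ := by
        rw [← Real.rpow_mul_natCast hYp.le, ← Real.rpow_mul_natCast hD.le]
        congr 3 <;> · push_cast; ring

theorem measurable_covDet (u : ℝ) : Measurable (covDet u) := by
  unfold covDet
  fun_prop

end BoltzmannMalliavin

theorem proposition4p2
    (γ ν δ η₀ T : ℝ) (b : ℝ → ℝ) (f₀ : Measure Plane)
    (hγ : γ ∈ Ioo (0 : ℝ) 1) (hν : ν ∈ Ioo (0 : ℝ) 1) (hb : CrossSection ν b)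
    (hδ : γ < δ) (hη₀ : η₀ ∈ Ioo (1 / δ) (1 / max γ ν))
    (hf₀ : ∀ a : Plane, f₀ ≠ Measure.dirac a) :
    ∀ p : ℝ, 1 ≤ p → ∃ Cp : ℝ, ∀ t₀ : ℝ, 0 < t₀ → ∃ Ct₀p : ℝ,
      ∀ (f : ℝ → Measure Plane) (v : ℝ → ℝ → Plane) (χ χ₁ : ℝ → ℝ),
        IsWeakSolution γ b T f → f 0 = f₀ → HasExpMoment δ T f → IsRepresentation T f v →
        IsEvenMollifier χ → IsBumpDensity χ₁ →
      ∀ (ε ζ : ℝ) (I U : ℝ → ℝ),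
        ε ∈ Ioo (0 : ℝ) 1 → 3 * ε < 1 → 1 < Gam η₀ ε - 1 → ζ ∈ Ioo (0 : ℝ) 1 →
        IsAngularCutoff b ζ I → IsWeight b ζ U →
      ∀ (Ω : Type*) [MeasurableSpace Ω] (P : Measure Ω) [IsProbabilityMeasure P]
        (V₀ : Ω → Plane) (τ R : ℕ → Ω → ℝ) (Z : ℤ → Ω → ℝ),
        IsRegularizedSystem P γ b χ χ₁ I f v T η₀ ε ζ V₀ τ R Z →
      ∀ t : ℝ, t₀ < t → t < T →
        Integrable (fun ω => (uReg ν ζ t • (1 : Matrix (Fin 2) (Fin 2) ℝ) +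
          processCov b I U v (V₀ ω) (fun k => τ k ω) (fun k => R k ω) (fun k => Z k ω) t).det
            ^ (-p)) P ∧
        ∫ ω, (uReg ν ζ t • (1 : Matrix (Fin 2) (Fin 2) ℝ) +
          processCov b I U v (V₀ ω) (fun k => τ k ω) (fun k => R k ω) (fun k => Z k ω) t).det
            ^ (-p) ∂P ≤ Ct₀p * Real.exp (Cp * Gam η₀ ε ^ γ) := by
  intro p hp
  obtain ⟨K, hK, hKb⟩ := exists_lintegral_angle_sq_le hν hb
  obtain ⟨c₀, hc₀, hder⟩ := exists_le_abs_deriv_angle hν.1 hb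
  obtain ⟨c', K', hc', hK', hGlb⟩ := exists_le_angG hν.1 hb
  -- The exponential rate comes from the contraction moment of order 8p alone, hence does not
  -- involve t₀.
  obtain ⟨Cp, hCp⟩ : ∃ Cp, Cp = 8 * p * Real.exp (3 * (8 * p)) * K * (T + 1) := ⟨_, rfl⟩
  refine ⟨Cp, fun t₀ ht₀ => ?_⟩
  -- The constant depending on t₀ must be fixed before any solution is given, and its construction
  -- needs these properties of f₀. If one fails, no solution meets the remaining requirements and
  -- any constant will do.
  by_cases hgood : 0 ≤ T ∧ IsProbabilityMeasure f₀ ∧ Integrable (fun v : Plane => ‖v‖ ^ 2) f₀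
  swap
  · refine ⟨0, ?_⟩
    intro f v χ χ₁ hf hf0 _ _ _ _ ε ζ I U _ _ _ _ _ _ Ω _ P _ V₀ τ R Z _ t ht htT
    have hT : (0 : ℝ) ∈ Icc 0 T := ⟨le_rfl, by linarith⟩
    exact absurd ⟨hT.2, hf0 ▸ hf.prob 0 hT, hf0 ▸ hf.finite_energy 0 hT⟩ hgood
  obtain ⟨hT0, _, hE⟩ := hgood
  obtain ⟨s₁, s₂, κ', hs₁, hs, hs₂, hκ', hnd'⟩ := exists_window hγ hν hb hE hf₀ ht₀
  obtain ⟨κ, hκdef⟩ : ∃ κ, κ = min κ' 1 := ⟨_, rfl⟩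
  have hκ : 0 < κ := by rw [hκdef]; positivity
  have hκ1 : κ ≤ 1 := by rw [hκdef]; exact min_le_right _ _
  obtain ⟨c, hc⟩ : ∃ c, c = (1 - Real.exp (-(c₀ ^ 2 * κ ^ 2 / 16))) * (κ / 3) ^ γ * (κ / 2) *
    ((s₂ - s₁) / 8) := ⟨_, rfl⟩
  have hc0 : 0 < c := by
    have h1 : 0 < 1 - Real.exp (-(c₀ ^ 2 * κ ^ 2 / 16)) := by
      rw [sub_pos, Real.exp_lt_one_iff, neg_lt_zero]
      positivity
    have h2 : 0 < s₂ - s₁ := sub_pos.2 hs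
    rw [hc]
    positivity
  obtain ⟨C, hC, hmom⟩ := exists_lintegral_reducedDet_le hν.1 ht₀ hc0 hc' hK'
    (q := 2 * p) (by linarith)
  -- The moment of `reducedDet` contributes the constant C, absorbed through exp(C_p Γ^γ) ≥ 1.
  refine ⟨1 + C, ?_⟩
  intro f v χ χ₁ hf hf0 _ hrep hχ hχ₁ ε ζ I U hε _ hΓ2 hζ hI hU Ω _ P _ V₀ τ R Z hS t ht htT
  have hν0 := hν.1
  have hγ0 := hγ.1
  have hΓ : 1 ≤ Gam η₀ ε := by linarith
  have hζpi : ζ ∈ Ioo 0 (Real.pi / 2) := ⟨hζ.1, by linarith [hζ.2, Real.pi_gt_three]⟩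
  have hG : 0 ≤ angG b ζ := (angG_pos hb hζpi).le
  have hv := hrep.measurable
  have hθ : ∀ z, |angle b z| ≤ Real.pi / 2 := fun z => (abs_angle_lt hν0 hb z).le
  have ht0 : 0 ≤ t := by linarith
  have hu : 0 < uReg ν ζ t := mul_pos (by linarith) (Real.rpow_pos_of_pos hζ.1 _)
  have hnd : ∀ s ∈ Icc s₁ s₂, ∀ p q c, p ^ 2 + q ^ 2 = 1 →
      κ ≤ ∫ x, min 1 |affineForm p q c x| ∂(f s) := fun s hs p q c hpq =>
    (by rw [hκdef]; exact min_le_left _ _ : κ ≤ κ').trans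
      (hnd' T f hf hf0 (by linarith) s hs p q c hpq)
  have hSm := aemeasurable_stateAt (t := t) (U := U) hS (rate_pos hΓ hG) (measurable_angle hν0 hb)
    hI.smooth.continuous.measurable hU.smooth.continuous.measurable hv ht0
  have hY := lintegral_norm_stateAt_rpow_neg_le hγ0 hν0 hb hχ hχ₁ hε.1 hΓ hG hv hI hU hS hK hKb
    (r := 8 * p) (by linarith) ht0 htT.le
  rw [← hCp] at hY
  have hD := hmom ζ hζ t (angG b ζ) ht.le (hGlb ζ hζ) Ω P (stateAt b I U v V₀ τ R Z t) hSm
    norm_stateAt_sq_sum_le fun ξ => by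
      rw [hc]
      exact lintegral_covExp_stateAt_le hγ0 hν0 hb hχ hχ₁ hε.1 hΓ hG hv hI hU hS hκ hκ1 hc₀ hder
        hf.prob hrep hs₁ hs (by linarith) htT.le hnd ξ
  have hdet : ∀ ω, (uReg ν ζ t • (1 : Matrix (Fin 2) (Fin 2) ℝ) +
      processCov b I U v (V₀ ω) (fun k => τ k ω) (fun k => R k ω) (fun k => Z k ω) t).det =
      covDet (uReg ν ζ t) (stateAt b I U v V₀ τ R Z t ω) := fun ω => det_processCov hν0 hb hI hU _ t
  simp_rw [hdet]
  have hbd := fun ω => covDet_rpow_neg_le hu (zero_le_one.trans hp)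
    (stateAt_contraction_ne_zero (I := I) (U := U) (v := v) (V₀ := V₀) (τ := τ) (R := R) (Z := Z)
      (t := t) hθ ω) (norm_stateAt_contraction_le_one hI.mem_Icc ω) (norm_stateAt_sq_sum_le ω)
  have hDp := fun ω => reducedDet_pos hu (norm_stateAt_sq_sum_le (b := b) (I := I) (U := U) (v := v)
    (V₀ := V₀) (τ := τ) (R := R) (Z := Z) (t := t) ω)
  have hmeas : AEMeasurable
      (fun ω => covDet (uReg ν ζ t) (stateAt b I U v V₀ τ R Z t ω) ^ (-p)) P :=
    ((measurable_covDet _).pow_const _).comp_aemeasurable hSm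
  have hg : 0 < Gam η₀ ε ^ γ := Real.rpow_pos_of_pos (by linarith) _
  have hCp0 : 0 ≤ Cp := by rw [hCp]; have : 0 < p := by linarith
                           positivity
  have hexp : 1 ≤ Real.exp (Cp * Gam η₀ ε ^ γ) := Real.one_le_exp (by positivity)
  have hYm : AEMeasurable (fun ω => ENNReal.ofReal
      (‖(stateAt b I U v V₀ τ R Z t ω).2.1‖ ^ (-(8 * p)))) P :=
    (by fun_prop : Measurable fun s : ChainState => ENNReal.ofReal
      (‖s.2.1‖ ^ (-(8 * p)))).comp_aemeasurable hSm
  have hlint : ∫⁻ ω, ENNReal.ofReal (covDet (uReg ν ζ t) (stateAt b I U v V₀ τ R Z t ω) ^ (-p)) ∂P ≤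
      ENNReal.ofReal ((1 + C) * Real.exp (Cp * Gam η₀ ε ^ γ)) := by
    calc _ ≤ ∫⁻ ω, (ENNReal.ofReal (‖(stateAt b I U v V₀ τ R Z t ω).2.1‖ ^ (-(8 * p))) +
          ENNReal.ofReal (reducedDet (uReg ν ζ t) (stateAt b I U v V₀ τ R Z t ω) ^ (-(2 * p)))) ∂P := by
          refine lintegral_mono fun ω => ?_
          have h1 : 0 ≤ ‖(stateAt b I U v V₀ τ R Z t ω).2.1‖ ^ (-(8 * p)) := by positivity
          have h2 := Real.rpow_nonneg (hDp ω).le (-(2 * p))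
          rw [← ENNReal.ofReal_add h1 h2]
          apply ENNReal.ofReal_le_ofReal
          linarith [(hbd ω).2]
      _ ≤ ENNReal.ofReal (Real.exp (Cp * Gam η₀ ε ^ γ)) + ENNReal.ofReal C := by
          rw [lintegral_add_left' hYm]
          exact add_le_add hY hD
      _ ≤ _ := by
          rw [← ENNReal.ofReal_add (Real.exp_pos _).le hC]
          apply ENNReal.ofReal_le_ofReal
          nlinarith
  constructor
  · refine ⟨hmeas.aestronglyMeasurable, ?_⟩
    rw [hasFiniteIntegral_iff_ofReal (Filter.Eventually.of_forall fun ω => (hbd ω).1)]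
    exact hlint.trans_lt ENNReal.ofReal_lt_top
  · rw [integral_eq_lintegral_of_nonneg_ae (Filter.Eventually.of_forall fun ω => (hbd ω).1)
      hmeas.aestronglyMeasurable]
    exact ENNReal.toReal_le_of_le_ofReal (by positivity) hlint
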